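/- Let $K$ be a separably closed field of characteristic $p>0$ with algebraic closure $\overline K$, let $C$ be a geometrically integral curve over $K$ (a separated, geometrically integral $K$-scheme of finite type and of dimension $1$), and let $P\in C$ be a closed point at which $C$ is regular. Let $F\colon C\to C^{(p)}$ be the relative Frobenius morphism of $C$ over $K$, let $C_1$ be the normalization of the integral curve $C^{(p)}$, and let $P_1\in C_1$ be the point lying over $F(P)$. For a point $Q$ of a geometrically integral curve $D$ over $K$ (here $(D,Q)=(C,P)$ or $(C_1,P_1)$), let $\overline K\mathcal O_{D,Q}=\overline K\otimes_K\mathcal O_{D,Q}$ and let $\widetilde{\overline K\mathcal O_{D,Q}}$ be its integral closure in its field of fractions. The differential degree of $Q$ on $D$ is \[ d(D,Q)=1+\dim_{\overline K}\operatorname{Coker}\Bigl(\widetilde{\overline K\mathcal O_{D,Q}}\otimes_{\overline K\mathcal O_{D,Q}}\Omega_{\overline K\mathcal O_{D,Q}/\overline K}\to\Omega_{\widetilde{\overline K\mathcal O_{D,Q}}/\overline K}\Bigr). \] Suppose that $d(C_1,P_1)=1$. Then $\widetilde{\overline K\mathcal O_{C,P}}$ is a discrete valuation ring, the above cokernel for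 $(C,P)$ is finite-dimensional and, if $\nu$ denotes the normalized discrete valuation of $\widetilde{\overline K\mathcal O_{C,P}}$, \[ \{\nu(x)\;:\;0\ne x\in\overline K\mathcal O_{C,P}\}=d(C,P)\,\mathbb Z_{\ge 0}+p\,\mathbb Z_{\ge 0}, \] and consequently the $\delta$-invariant is finite and \[ \dim_{\overline K}\bigl(\widetilde{\overline K\mathcal O_{C,P}}/\overline K\mathcal O_{C,P}\bigr)=\frac{(d(C,P)-1)(p-1)}{2}. \] -/

import Mathlib

open CategoryTheory CategoryTheory.Limits AlgebraicGeometry TopologicalSpace Opposite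
open scoped TensorProduct

universe u

namespace FrobCurve

noncomputable section

/-! ### Frobenius morphisms -/

/-- The map `x ↦ x ^ p` on a commutative ring in which the prime `p` is zero (the zero ring is
allowed, which is why Mathlib's `frobenius` is not used here). -/
def powRingHom (p : ℕ) [hp : Fact p.Prime] (R : Type u) [CommRing R] (h : (p : R) = 0) :
    R →+* R where
  toFun x := x ^ p
  map_one' := one_pow p
  map_mul' x y := mul_pow x y p
  map_zero' := zero_pow hp.out.ne_zero
  map_add' x y := by
    obtain ⟨r, hr⟩ := exists_add_pow_prime_eq hp.out x y
    rw [hr, h]; ring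

theorem natCast_section_eq_zero {X : Scheme.{u}} {p : ℕ} (h : (p : Γ(X, ⊤)) = 0) (U : X.Opens) :
    (p : Γ(X, U)) = 0 := by
  have := congrArg (X.presheaf.map (homOfLE (le_top : U ≤ ⊤)).op).hom h
  simpa using this

/-- The absolute Frobenius of a scheme of characteristic `p`: the identity on points and
`s ↦ s ^ p` on sections. -/
def absoluteFrobenius (X : Scheme.{u}) (p : ℕ) [hp : Fact p.Prime] (h : (p : Γ(X, ⊤)) = 0) :
    X ⟶ X where
  base := 𝟙 _
  c :=
    { app := fun U =>
        CommRingCat.ofHom (powRingHom p Γ(X, U.unop) (natCast_section_eq_zero h U.unop))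
      naturality := fun U V i => by
        ext x
        exact (map_pow (X.presheaf.map i).hom x p).symm }
  prop x := by
    constructor
    intro a ha
    obtain ⟨U, hxU, s, rfl⟩ := X.presheaf.exists_germ_eq a
    erw [PresheafedSpace.stalkMap_germ_apply] at ha
    have h2 : IsUnit ((X.presheaf.germ U x hxU).hom (s ^ p)) := ha
    rw [map_pow] at h2
    exact (isUnit_pow_iff hp.out.ne_zero).1 h2

section OverField

variable {K : Type u} [Field K] (p : ℕ) [hp : Fact p.Prime] [CharP K p]
variable {X : Scheme.{u}} (f : X ⟶ Spec (.of K))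

/-- The structure map from `K` to the global functions of a `K`-scheme. -/
def toGlobalSections : K →+* Γ(X, ⊤) :=
  ((Scheme.ΓSpecIso (.of K)).inv ≫ f.appTop).hom

theorem natCast_globalSections_eq_zero {K : Type u} [Field K] (p : ℕ) [CharP K p]
    {X : Scheme.{u}} (f : X ⟶ Spec (.of K)) : (p : Γ(X, ⊤)) = 0 := by
  rw [← map_natCast (toGlobalSections f), CharP.cast_eq_zero, map_zero]

/-- The Frobenius `Spec K ⟶ Spec K` of the ground field. -/
def specFrobenius (K : Type u) [Field K] [CharP K p] : Spec (.of K) ⟶ Spec (.of K) :=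
  Spec.map (CommRingCat.ofHom (frobenius K p))

/-- The Frobenius twist `X^(p)`, i.e. the base change of `X` along the Frobenius of `K`. -/
def frobeniusTwist : Scheme.{u} := pullback f (specFrobenius p K)

/-- The structure morphism of `X^(p)`. -/
def frobeniusTwistStr : frobeniusTwist p f ⟶ Spec (.of K) := pullback.snd f (specFrobenius p K)

theorem isPullback_frobeniusTwist :
    IsPullback (pullback.fst f (specFrobenius p K) : frobeniusTwist p f ⟶ X)
      (frobeniusTwistStr p f) f (specFrobenius p K) :=
  IsPullback.of_hasPullback f (specFrobenius p K)

theorem absoluteFrobenius_comp :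
    absoluteFrobenius X p (natCast_globalSections_eq_zero p f) ≫ f = f ≫ specFrobenius p K := by
  apply ext_of_isAffine
  rw [Scheme.Hom.comp_appTop, Scheme.Hom.comp_appTop]
  have h : (specFrobenius p K).appTop = (Scheme.ΓSpecIso (.of K)).hom ≫
      CommRingCat.ofHom (frobenius K p) ≫ (Scheme.ΓSpecIso (.of K)).inv := by
    rw [← Category.assoc, Iso.eq_comp_inv]
    exact Scheme.ΓSpecIso_naturality _
  rw [h]
  ext x
  have h1 : (Scheme.ΓSpecIso (.of K)).inv.hom (((Scheme.ΓSpecIso (.of K)).hom.hom x) ^ p) =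
      x ^ p := by
    rw [map_pow]
    congr 1
    exact (Scheme.ΓSpecIso (.of K)).hom_inv_id_apply x
  exact ((map_pow f.appTop.hom x p).symm.trans (congrArg f.appTop.hom h1.symm))

/-- The relative Frobenius morphism `X ⟶ X^(p)` over `K`. -/
def relativeFrobenius : X ⟶ frobeniusTwist p f :=
  pullback.lift (absoluteFrobenius X p (natCast_globalSections_eq_zero p f)) f
    (absoluteFrobenius_comp p f)

end OverField

/-! ### Normalization -/

/-- The normalization of an integral scheme: its relative normalization in the spectrum of its
function field. -/
def normalization (X : Scheme.{u}) [IsIntegral X] [QuasiSeparatedSpace X] : Scheme.{u} :=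
  (X.fromSpecStalk (genericPoint X)).normalization

/-- The normalization morphism. -/
def normalizationMap (X : Scheme.{u}) [IsIntegral X] [QuasiSeparatedSpace X] :
    normalization X ⟶ X :=
  (X.fromSpecStalk (genericPoint X)).fromNormalization

section NormalizedFrobenius

variable {K : Type u} [Field K] (p : ℕ) [hp : Fact p.Prime] [CharP K p]
variable {X : Scheme.{u}} (f : X ⟶ Spec (.of K))

instance geometricallyIntegral_frobeniusTwistStr [GeometricallyIntegral f] :
    GeometricallyIntegral (frobeniusTwistStr p f) :=
  MorphismProperty.of_isPullback (P := @GeometricallyIntegral)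
    (isPullback_frobeniusTwist p f) inferInstance

instance isSeparated_frobeniusTwistStr [IsSeparated f] :
    IsSeparated (frobeniusTwistStr p f) :=
  MorphismProperty.of_isPullback (P := @IsSeparated) (isPullback_frobeniusTwist p f) inferInstance

instance isIntegral_frobeniusTwist [GeometricallyIntegral f] :
    IsIntegral (frobeniusTwist p f) :=
  GeometricallyIntegral.isIntegral_of_subsingleton (frobeniusTwistStr p f)

instance quasiSeparatedSpace_frobeniusTwist [IsSeparated f] :
    QuasiSeparatedSpace (frobeniusTwist p f) :=
  quasiSeparatedSpace_of_quasiSeparated (frobeniusTwistStr p f)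

variable [GeometricallyIntegral f] [IsSeparated f]

/-- The curve `X₁`: the normalization of `X^(p)`. -/
def normalizedFrobenius : Scheme.{u} := normalization (frobeniusTwist p f)

/-- The normalization morphism `X₁ ⟶ X^(p)`. -/
def normalizedFrobeniusMap : normalizedFrobenius p f ⟶ frobeniusTwist p f :=
  normalizationMap (frobeniusTwist p f)

/-- The structure morphism of `X₁` over `K`. -/
def normalizedFrobeniusStr : normalizedFrobenius p f ⟶ Spec (.of K) :=
  normalizedFrobeniusMap p f ≫ frobeniusTwistStr p f

end NormalizedFrobenius

/-! ### Local rings as `K`-algebras -/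

section LocalRing

variable {K : Type u} [Field K] {X : Scheme.{u}} (f : X ⟶ Spec (.of K)) (x : X)

/-- The local ring of the `K`-scheme `X` at `x`. -/
def LocalRing (_f : X ⟶ Spec (.of K)) (x : X) : Type u := X.presheaf.stalk x

instance : CommRing (LocalRing f x) := inferInstanceAs (CommRing (X.presheaf.stalk x))

instance : Algebra K (LocalRing f x) :=
  ((X.presheaf.germ ⊤ x trivial).hom.comp (toGlobalSections f)).toAlgebra

end LocalRing

/-! ### Invariants of a local ring after extension of scalars to an algebraic closure

Below `L` is an algebraic closure of `K` and `O` is the local ring of a geometrically integral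
curve over `K`. -/

section Invariants

variable (K : Type u) [Field K] (L : Type u) [Field L] [Algebra K L]
variable (O : Type u) [CommRing O] [Algebra K O]

/-- The ring `L O = L ⊗ O`. -/
def Geom : Type u := L ⊗[K] O

instance : CommRing (Geom K L O) := inferInstanceAs (CommRing (L ⊗[K] O))

instance : Algebra L (Geom K L O) := inferInstanceAs (Algebra L (L ⊗[K] O))

/-- The normalization of `L O`: its integral closure in its field of fractions. -/
def GeomNorm : Type u := integralClosure (Geom K L O) (FractionRing (Geom K L O))

instance : CommRing (GeomNorm K L O) :=
  inferInstanceAs (CommRing (integralClosure (Geom K L O) (FractionRing (Geom K L O))))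

instance : Algebra (Geom K L O) (GeomNorm K L O) :=
  inferInstanceAs
    (Algebra (Geom K L O) (integralClosure (Geom K L O) (FractionRing (Geom K L O))))

instance : Algebra L (GeomNorm K L O) :=
  ((algebraMap (Geom K L O) (GeomNorm K L O)).comp (algebraMap L (Geom K L O))).toAlgebra

instance : IsScalarTower L (Geom K L O) (GeomNorm K L O) := .of_algebraMap_eq' rfl

/-- The cokernel of the natural map `α : Õ ⊗ Ω(LO / L) → Ω(Õ / L)`, where `Õ` is the
normalization of `LO`. -/
abbrev DiffCoker : Type u :=
  Ω[GeomNorm K L O⁄L] ⧸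
    LinearMap.range (KaehlerDifferential.mapBaseChange L (Geom K L O) (GeomNorm K L O))

/-- The differential degree `1 + dim (coker α)`. -/
def differentialDegree : ℕ := 1 + Module.finrank L (DiffCoker K L O)

/-- The `L`-vector space `Õ / LO`. -/
abbrev DeltaQuotient : Type u :=
  GeomNorm K L O ⧸
    LinearMap.range (IsScalarTower.toAlgHom L (Geom K L O) (GeomNorm K L O)).toLinearMap

/-- The `δ`-invariant (singularity degree) `dim (Õ / LO)`. -/
def deltaInvariant : ℕ := Module.finrank L (DeltaQuotient K L O)

/-- The semigroup of `LO`: all integers that are values of elements of `LO` under the normalized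
discrete valuation with valuation ring `Õ` (the value of `0` is `∞`, hence not an integer). -/
def semigroup [IsDomain (GeomNorm K L O)] [IsDiscreteValuationRing (GeomNorm K L O)] : Set ℤ :=
  {l | ∃ (x : Geom K L O) (n : ℕ),
    IsDiscreteValuationRing.addVal (GeomNorm K L O)
      (algebraMap (Geom K L O) (GeomNorm K L O) x) = n ∧ l = n}

end Invariants

end

end FrobCurve

/-! Let `O` be the local ring of `C` at `P`, let `R` be the normalization of `L ⊗ O`, and let `O₁`
be the local ring at `P₁`. Over the perfect field `L`, the ring `R` is a discrete valuation ring
in which every element is a sum `∑ aᵢ ^ p * t ^ i` over `i < p`, with `t` a uniformizer, so that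
`Ω[R⁄L]` is free on `dt`. Frobenius embeds `O₁` into `O` as a subring containing the `p`-th
powers, and the `p`-th power map identifies `R` with the normalization of `L ⊗ O₁`. A differential
degree of `1` forces `L ⊗ O₁` to contain a uniformizer of its normalization, hence to be normal;
its image in `R` is then exactly `R ^ p`. As `O` has rank `p` over the discrete valuation ring
`O₁`, it is generated by a single element, so the image of `L ⊗ O` is `R ^ p [z]` for some `z`.

Subtracting a `p`-th power from `z` makes `m = ν z` prime to `p`. The terms `aᵢ ^ p * z ^ i` of an
element of `R ^ p [z]` then have pairwise distinct values, which gives the semigroup generated by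
`m` and `p`. The image of the map on differentials is generated by `dz = (dz/dt) dt` with
`ν (dz/dt) = m - 1`, so `m` is the differential degree. The `δ`-invariant counts the gaps of the
semigroup, of which there are `(m - 1) * (p - 1) / 2` by the symmetry `l ↦ m * p - m - p - l`. -/

namespace FrobCurve

/-! ### Values of subspaces of a discrete valuation ring -/

section AddValuation

theorem addValuation_sum_eq_inf {R Γ₀ ι : Type*} [Ring R] [LinearOrderedAddCommMonoidWithTop Γ₀]
    (v : AddValuation R Γ₀) (s : Finset ι) (f : ι → R)
    (h : (s : Set ι).Pairwise fun i j => v (f i) = v (f j) → v (f i) = ⊤) :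
    v (∑ i ∈ s, f i) = s.inf fun i => v (f i) := by
  classical
  induction s using Finset.induction_on with
  | empty => simp
  | insert a s ha ih =>
    rw [Finset.coe_insert] at h
    specialize ih (h.mono (Set.subset_insert _ _))
    rw [Finset.sum_insert ha, Finset.inf_insert, ← ih]
    by_cases hne : v (f a) = v (∑ i ∈ s, f i)
    · have htop : v (f a) = ⊤ := by
        rcases s.eq_empty_or_nonempty with rfl | hs
        · simpa using hne
        · obtain ⟨j, hj, hinf⟩ := Finset.exists_mem_eq_inf s hs fun i => v (f i)
          exact h (Set.mem_insert _ _) (Set.mem_insert_of_mem _ hj) (by rintro rfl; exact ha hj)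
            (by rw [hne, ih, hinf])
      have := v.map_add (f a) (∑ i ∈ s, f i)
      rw [← hne, min_self, htop, top_le_iff] at this
      rw [this, ← hne, htop, min_self]
    · exact v.map_add_of_distinct_val hne

end AddValuation

section ValueSet

open IsDiscreteValuationRing
open IsLocalRing (ResidueField)

variable {R : Type*} [CommRing R] [IsDomain R] [IsDiscreteValuationRing R]

theorem exists_addVal_eq_natCast {x : R} (hx : x ≠ 0) : ∃ n : ℕ, addVal R x = n := by
  obtain ⟨n, hn⟩ := ENat.ne_top_iff_exists.1 (addVal_eq_top_iff.not.2 hx)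
  exact ⟨n, hn.symm⟩

theorem ne_zero_of_addVal_eq_natCast {x : R} {n : ℕ} (hx : addVal R x = n) : x ≠ 0 := by
  rintro rfl
  exact ENat.natCast_ne_top n (hx.symm.trans addVal_zero)

theorem dvd_of_addVal_pow_eq_natCast {x : R} {m n : ℕ} (h : addVal R (x ^ m) = n) : m ∣ n := by
  rcases eq_or_ne m 0 with rfl | hm
  · rw [pow_zero, addVal_one] at h
    exact zero_dvd_iff.2 (by exact_mod_cast h.symm)
  · obtain ⟨k, hk⟩ := exists_addVal_eq_natCast (x := x) fun hx =>
      ne_zero_of_addVal_eq_natCast h (by rw [hx, zero_pow hm])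
    rw [addVal_pow, hk, nsmul_eq_mul] at h
    exact ⟨k, by exact_mod_cast h.symm⟩

theorem natCast_lt_addVal_iff {n : ℕ} {x : R} :
    (n : ℕ∞) < addVal R x ↔ ((n + 1 : ℕ) : ℕ∞) ≤ addVal R x := by
  rw [Nat.cast_succ]
  exact (ENat.add_one_le_iff (ENat.natCast_ne_top n)).symm

theorem one_le_addVal_iff {x : R} : 1 ≤ addVal R x ↔ x ∈ IsLocalRing.maximalIdeal R := by
  rw [Order.one_le_iff_ne_zero, Ne, addVal_eq_zero_iff, IsLocalRing.mem_maximalIdeal,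
    mem_nonunits_iff]

theorem exists_sub_algebraMap_mem_maximalIdeal {L R : Type*} [CommRing L] [CommRing R]
    [IsLocalRing R] [Algebra L R] (hres : Function.Surjective (algebraMap L (ResidueField R)))
    (x : R) : ∃ c : L, x - algebraMap L R c ∈ IsLocalRing.maximalIdeal R := by
  obtain ⟨c, hc⟩ := hres (IsLocalRing.residue R x)
  exact ⟨c, by rw [← IsLocalRing.residue_eq_zero_iff, map_sub, ← hc, ← ResidueField.algebraMap_eq,
    ← IsScalarTower.algebraMap_apply, sub_self]⟩

variable {L : Type*} [Field L] [Algebra L R]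

theorem addVal_smul_of_ne_zero {c : L} (hc : c ≠ 0) (x : R) : addVal R (c • x) = addVal R x := by
  rw [Algebra.smul_def, addVal_mul, addVal_eq_zero_iff.2 ((IsUnit.mk0 c hc).map _), zero_add]

theorem exists_add_one_le_addVal_sub_smul
    (hres : Function.Surjective (algebraMap L (ResidueField R)))
    {x w : R} {n : ℕ} (hx : (n : ℕ∞) ≤ addVal R x) (hw : addVal R w = n) :
    ∃ c : L, ((n + 1 : ℕ) : ℕ∞) ≤ addVal R (x - c • w) := by
  obtain ⟨u, rfl⟩ := addVal_le_iff_dvd.1 (hw.trans_le hx)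
  obtain ⟨c, hc⟩ := exists_sub_algebraMap_mem_maximalIdeal hres u
  refine ⟨c, ?_⟩
  rw [Algebra.smul_def, mul_comm w, ← sub_mul, addVal_mul, hw, Nat.cast_succ, add_comm]
  gcongr
  exact one_le_addVal_iff.2 hc

theorem exists_addVal_sum_smul_pow_eq {ι : Type*} {t : R} (ht : Irreducible t) {e : ι → ℕ}
    (he : Function.Injective e) (s : Finset ι) (c : ι → L) (hc : ∃ i ∈ s, c i ≠ 0) :
    ∃ i ∈ s, addVal R (∑ i ∈ s, c i • t ^ e i) = e i := by
  have hval {i : ι} (hi : c i ≠ 0) : addVal R (c i • t ^ e i) = e i := by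
    rw [addVal_smul_of_ne_zero hi, ht.addVal_pow]
  have hzero {i : ι} (hi : c i = 0) : addVal R (c i • t ^ e i) = ⊤ := by simp [hi]
  have hsum := addValuation_sum_eq_inf (addVal R) s (fun i => c i • t ^ e i) fun i _ j _ hij heq =>
    by_contra fun htop => hij (he (by
      have hi : c i ≠ 0 := fun h => htop (hzero h)
      have hj : c j ≠ 0 := fun h => htop (heq.trans (hzero h))
      rw [hval hi, hval hj] at heq
      exact_mod_cast heq))
  obtain ⟨k, hk, hck⟩ := hc
  obtain ⟨i, hi, hinf⟩ := Finset.exists_mem_eq_inf s ⟨k, hk⟩ fun i => addVal R (c i • t ^ e i)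
  rw [hinf] at hsum
  refine ⟨i, hi, hsum.trans (hval fun h => ?_)⟩
  have hle := hinf.symm.trans_le (Finset.inf_le hk)
  rw [hzero h, hval hck] at hle
  exact ENat.natCast_ne_top _ (top_le_iff.1 hle)

/-- The set of values of the nonzero elements of a subspace of a discrete valuation ring. -/
def valueSet (W : Submodule L R) : Set ℕ := {n | ∃ w ∈ W, addVal R w = n}

variable {W : Submodule L R} {s : R}

theorem mem_of_addVal_le_addVal (hs : ∀ x, s * x ∈ W) {x : R} (hx : addVal R s ≤ addVal R x) :
    x ∈ W := by
  obtain ⟨y, rfl⟩ := addVal_le_iff_dvd.1 hx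
  exact hs y

theorem finite_compl_valueSet (hs0 : s ≠ 0) (hs : ∀ x, s * x ∈ W) : (valueSet W)ᶜ.Finite := by
  obtain ⟨N, hN⟩ := exists_addVal_eq_natCast hs0
  obtain ⟨t, ht⟩ := exists_irreducible R
  refine (Set.finite_Iio N).subset fun n hn => Set.mem_Iio.2 (not_le.1 fun hle => hn ?_)
  exact ⟨t ^ n, mem_of_addVal_le_addVal hs (by rw [hN, ht.addVal_pow]; exact_mod_cast hle),
    ht.addVal_pow n⟩

theorem exists_mem_valueSet_not_dvd {p : ℕ} (hp : p ≠ 1) (hs0 : s ≠ 0) (hs : ∀ x, s * x ∈ W) :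
    ∃ n ∈ valueSet W, ¬ p ∣ n := by
  obtain ⟨n, hn⟩ := exists_addVal_eq_natCast hs0
  obtain ⟨t, ht⟩ := exists_irreducible R
  by_contra! hdvd
  have hn_dvd : p ∣ n := hdvd n ⟨s * 1, hs 1, by rw [mul_one, hn]⟩
  have hn1_dvd : p ∣ n + 1 :=
    hdvd (n + 1) ⟨s * t, hs t, by rw [addVal_mul, hn, addVal_uniformizer ht, Nat.cast_succ]⟩
  exact hp (Nat.dvd_one.1 ((Nat.dvd_add_right hn_dvd).1 hn1_dvd))

theorem linearIndependent_mkQ_pow {t : R} (ht : Irreducible t) :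
    LinearIndependent L fun n : ↥(valueSet W)ᶜ => W.mkQ (t ^ (n : ℕ)) := by
  refine linearIndependent_iff'.2 fun S c hc i hi => by_contra fun hci => ?_
  obtain ⟨j, -, hj⟩ := exists_addVal_sum_smul_pow_eq ht Subtype.val_injective S c ⟨i, hi, hci⟩
  simp only [← map_smul, ← map_sum] at hc
  exact j.2 ⟨_, (Submodule.Quotient.mk_eq_zero W).1 hc, hj⟩

theorem span_range_mkQ_pow_eq_top (hres : Function.Surjective (algebraMap L (ResidueField R)))
    {t : R} (ht : Irreducible t) (hs0 : s ≠ 0) (hs : ∀ x, s * x ∈ W) :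
    Submodule.span L (Set.range fun n : ↥(valueSet W)ᶜ => W.mkQ (t ^ (n : ℕ))) = ⊤ := by
  obtain ⟨N, hN⟩ := exists_addVal_eq_natCast hs0
  set S := Submodule.span L (Set.range fun n : ↥(valueSet W)ᶜ => W.mkQ (t ^ (n : ℕ)))
  have hW {w : R} (hw : w ∈ W) : W.mkQ w ∈ S := by
    rw [Submodule.mkQ_apply, (Submodule.Quotient.mk_eq_zero W).2 hw]
    exact zero_mem S
  have hvalue (n : ℕ) : ∃ w, addVal R w = n ∧ W.mkQ w ∈ S := by
    by_cases hn : n ∈ valueSet W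
    · obtain ⟨w, hw, hwn⟩ := hn
      exact ⟨w, hwn, hW hw⟩
    · exact ⟨t ^ n, ht.addVal_pow n, Submodule.subset_span ⟨⟨n, hn⟩, rfl⟩⟩
  have hmem : ∀ x : R, ((0 : ℕ) : ℕ∞) ≤ addVal R x → W.mkQ x ∈ S := by
    refine Nat.decreasingInduction (motive := fun n _ => ∀ x : R, (n : ℕ∞) ≤ addVal R x →
      W.mkQ x ∈ S) (fun n _ ih x hx => ?_)
      (fun x hx => hW (mem_of_addVal_le_addVal hs (hN.trans_le hx))) N.zero_le
    obtain ⟨w, hwn, hwS⟩ := hvalue n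
    obtain ⟨c, hc⟩ := exists_add_one_le_addVal_sub_smul hres hx hwn
    have := add_mem (ih _ hc) (S.smul_mem c hwS)
    rwa [← map_smul, ← map_add, sub_add_cancel] at this
  refine eq_top_iff.2 fun y _ => ?_
  obtain ⟨x, rfl⟩ := W.mkQ_surjective y
  exact hmem x (by simp)

theorem finite_quotient_and_finrank_eq_ncard
    (hres : Function.Surjective (algebraMap L (ResidueField R)))
    (hs0 : s ≠ 0) (hs : ∀ x, s * x ∈ W) :
    Module.Finite L (R ⧸ W) ∧ Module.finrank L (R ⧸ W) = (valueSet W)ᶜ.ncard := by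
  obtain ⟨t, ht⟩ := exists_irreducible R
  let b := Module.Basis.mk (linearIndependent_mkQ_pow (W := W) ht)
    (span_range_mkQ_pow_eq_top hres ht hs0 hs).ge
  have := (finite_compl_valueSet hs0 hs).to_subtype
  exact ⟨Module.Finite.of_basis b, Module.finrank_eq_nat_card_basis b⟩

theorem eq_top_of_valueSet_eq_univ (hres : Function.Surjective (algebraMap L (ResidueField R)))
    (hs0 : s ≠ 0) (hs : ∀ x, s * x ∈ W) (hW : valueSet W = Set.univ) : W = ⊤ := by
  obtain ⟨_, hrank⟩ := finite_quotient_and_finrank_eq_ncard hres hs0 hs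
  rwa [hW, Set.compl_univ, Set.ncard_empty, Module.finrank_zero_iff,
    Submodule.Quotient.subsingleton_iff] at hrank

theorem finite_quotient_span_singleton_and_finrank_eq
    (hres : Function.Surjective (algebraMap L (ResidueField R)))
    {x : R} {n : ℕ} (hx : addVal R x = n) :
    Module.Finite L (R ⧸ Ideal.span {x}) ∧ Module.finrank L (R ⧸ Ideal.span {x}) = n := by
  obtain ⟨t, ht⟩ := exists_irreducible R
  have hmem (y : R) : y ∈ Ideal.span {x} ↔ (n : ℕ∞) ≤ addVal R y := by
    rw [Ideal.mem_span_singleton, ← addVal_le_iff_dvd, hx]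
  have hvalues : (valueSet ((Ideal.span {x}).restrictScalars L))ᶜ = Set.Iio n := by
    refine compl_eq_comm.1 (Set.ext fun k => ⟨fun hk => ?_, ?_⟩)
    · refine ⟨t ^ k, (hmem _).2 ?_, ht.addVal_pow k⟩
      rw [ht.addVal_pow]
      exact_mod_cast Set.notMem_Iio.1 hk
    · rintro ⟨w, hw, hwk⟩
      have := (hmem w).1 hw
      rw [hwk] at this
      exact not_lt.2 (by exact_mod_cast this)
  obtain ⟨hfin, hrank⟩ := finite_quotient_and_finrank_eq_ncard
    (W := (Ideal.span {x}).restrictScalars L) hres (ne_zero_of_addVal_eq_natCast hx)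
    fun y => Ideal.mul_mem_right y _ (Ideal.mem_span_singleton_self x)
  exact ⟨hfin, by rwa [hvalues, ← Finset.coe_Iio, Set.ncard_coe_finset, Nat.card_Iio] at hrank⟩

end ValueSet

/-! ### Expansions in powers of an element over the subring of `p`-th powers -/

section FrobEval

open Polynomial

/-- Every element of `R` is an `R ^ p`-linear combination of `1, t, …, t ^ (p - 1)`. -/
def HasFrobeniusExpansion {R : Type*} [CommRing R] (p : ℕ) (t : R) : Prop :=
  ∀ x : R, ∃ a : ℕ → R, x = ∑ i ∈ Finset.range p, a i ^ p * t ^ i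

/-- The element `t` alone is a `p`-basis of `R`: the powers `1, t, …, t ^ (p - 1)` form a basis of
`R` over its subring of `p`-th powers. -/
structure IsPBasis {R : Type*} [CommRing R] (p : ℕ) (t : R) : Prop where
  hasFrobeniusExpansion : HasFrobeniusExpansion p t
  eq_zero_of_sum_eq_zero (a : ℕ → R) :
    ∑ i ∈ Finset.range p, a i ^ p * t ^ i = 0 → ∀ i < p, a i = 0

theorem natDegree_modByMonic_X_pow_sub_C_lt {R : Type*} [CommRing R] {n : ℕ} (hn : n ≠ 0)
    (f : R[X]) (c : R) : (f %ₘ (X ^ n - C c)).natDegree < n := by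
  rcases subsingleton_or_nontrivial R with _ | _
  · rw [Subsingleton.elim (f %ₘ (X ^ n - C c)) 0, natDegree_zero]
    exact Nat.pos_of_ne_zero hn
  have hdeg : (X ^ n - C c).natDegree = n := natDegree_X_pow_sub_C
  refine (natDegree_modByMonic_lt f (monic_X_pow_sub_C c hn) fun h => hn ?_).trans_eq hdeg
  rw [← hdeg, h, natDegree_one]

variable {R : Type*} [CommRing R] (p : ℕ) [hp : Fact p.Prime] [CharP R p]

/-- The ring homomorphism `∑ aᵢ Xⁱ ↦ ∑ aᵢᵖ tⁱ`. -/
noncomputable def frobEval (t : R) : R[X] →+* R := eval₂RingHom (frobenius R p) t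

theorem frobEval_C (t a : R) : frobEval p t (C a) = a ^ p := by
  simp [frobEval, frobenius_def]

theorem frobEval_X (t : R) : frobEval p t X = t := by
  simp [frobEval]

theorem frobEval_X_pow_sub_C (t : R) : frobEval p t (X ^ p - C t) = 0 := by
  simp [frobEval_C, frobEval_X]

theorem frobEval_of_natDegree_lt (t : R) {f : R[X]} (hf : f.natDegree < p) :
    frobEval p t f = ∑ i ∈ Finset.range p, f.coeff i ^ p * t ^ i := by
  simp [frobEval, eval₂_eq_sum_range' _ hf, frobenius_def]

theorem frobEval_modByMonic_X_pow_sub_C (t : R) (f : R[X]) :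
    frobEval p t (f %ₘ (X ^ p - C t)) = frobEval p t f := by
  conv_rhs => rw [← modByMonic_add_div f (X ^ p - C t)]
  rw [map_add, map_mul, frobEval_X_pow_sub_C, zero_mul, add_zero]

theorem mem_frobEval_range_iff {t x : R} : x ∈ (frobEval p t).range ↔
    ∃ a : ℕ → R, x = ∑ i ∈ Finset.range p, a i ^ p * t ^ i := by
  constructor
  · rintro ⟨f, rfl⟩
    exact ⟨_, (frobEval_modByMonic_X_pow_sub_C p t f).symm.trans (frobEval_of_natDegree_lt p t
      (natDegree_modByMonic_X_pow_sub_C_lt hp.out.ne_zero f t))⟩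
  · rintro ⟨a, rfl⟩
    exact ⟨∑ i ∈ Finset.range p, C (a i) * X ^ i, by simp [frobEval_C, frobEval_X]⟩

theorem frobEval_range_sub_pow (t c : R) :
    (frobEval p (t - c ^ p)).range = (frobEval p t).range := by
  have key (t c : R) : (frobEval p t).range ≤ (frobEval p (t - c ^ p)).range := by
    rintro _ ⟨f, rfl⟩
    have hcomp : (frobEval p (t - c ^ p)).comp (compRingHom (X + C c)) = frobEval p t := by
      ext <;> simp [frobEval_C, frobEval_X]
    exact ⟨f.comp (X + C c), congrArg (fun g : R[X] →+* R => g f) hcomp⟩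
  refine le_antisymm ?_ (key t c)
  have h := key (t - c ^ p) (-c)
  rwa [← frobenius_def p (-c), map_neg, frobenius_def, sub_neg_eq_add, sub_add_cancel] at h

theorem leibniz_frobEval {L M : Type*} [CommRing L] [Algebra L R] [AddCommGroup M] [Module L M]
    [Module R M] (δ : Derivation L R M) (t : R) (f : R[X]) :
    δ (frobEval p t f) = frobEval p t (derivative f) • δ t := by
  have hC (a : R) : δ (frobEval p t (C a)) = 0 := by
    rw [frobEval_C, Derivation.leibniz_pow, ← Nat.cast_smul_eq_nsmul R, CharP.cast_eq_zero,
      zero_smul]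
  induction f using Polynomial.induction_on with
  | C a => rw [hC, derivative_C, map_zero, zero_smul]
  | add f g hf hg => simp only [map_add, add_smul, hf, hg]
  | monomial n a _ =>
    rw [map_mul, map_pow, frobEval_X, Derivation.leibniz, hC, smul_zero, add_zero,
      Derivation.leibniz_pow, derivative_C_mul_X_pow, map_mul, map_pow, frobEval_X,
      ← Nat.cast_smul_eq_nsmul R, smul_smul, smul_smul, C_mul, map_mul]
    simp only [map_natCast]

variable {p} {t : R}

theorem HasFrobeniusExpansion.frobEval_surjective (h : HasFrobeniusExpansion p t) :
    Function.Surjective (frobEval p t) :=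
  fun x => (mem_frobEval_range_iff p).2 (h x)

namespace IsPBasis

theorem frobEval_derivative_eq_zero (h : IsPBasis p t) {f : R[X]} (hf : frobEval p t f = 0) :
    frobEval p t (derivative f) = 0 := by
  have hdeg := natDegree_modByMonic_X_pow_sub_C_lt hp.out.ne_zero f t
  have hmod : f %ₘ (X ^ p - C t) = 0 := by
    rw [← frobEval_modByMonic_X_pow_sub_C, frobEval_of_natDegree_lt p t hdeg] at hf
    ext i
    by_cases hi : i < p
    · exact h.eq_zero_of_sum_eq_zero _ hf i hi
    · exact coeff_eq_zero_of_natDegree_lt (hdeg.trans_le (not_lt.1 hi))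
  have hder : derivative (X ^ p - C t) = 0 := by
    simp [derivative_X_pow]
  rw [← modByMonic_add_div f (X ^ p - C t), hmod, zero_add, derivative_mul, hder, zero_mul,
    zero_add, map_mul, frobEval_X_pow_sub_C, zero_mul]

theorem frobEval_derivative_congr (h : IsPBasis p t) {f g : R[X]}
    (hfg : frobEval p t f = frobEval p t g) :
    frobEval p t (derivative f) = frobEval p t (derivative g) := by
  rw [← sub_eq_zero, ← map_sub, ← derivative_sub]
  exact h.frobEval_derivative_eq_zero (by rw [map_sub, hfg, sub_self])

variable (L : Type*) [CommRing L] [CharP L p] [PerfectRing L p] [Algebra L R]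

/-- The derivation `d / dt` of a ring with `p`-basis `t`, linear over any perfect base ring. -/
noncomputable def derivation (h : IsPBasis p t) : Derivation L R R :=
  let s := Function.surjInv h.hasFrobeniusExpansion.frobEval_surjective
  have hs (x : R) : frobEval p t (s x) = x :=
    Function.surjInv_eq h.hasFrobeniusExpansion.frobEval_surjective x
  Derivation.mk'
    { toFun := fun x => frobEval p t (derivative (s x))
      map_add' := fun x y => by
        rw [h.frobEval_derivative_congr (g := s x + s y) (by simp [hs]), derivative_add, map_add]
      map_smul' := fun c x => by
        obtain ⟨c', rfl⟩ : ∃ c', c' ^ p = c := (bijective_frobenius L p).2 c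
        rw [h.frobEval_derivative_congr (g := C (algebraMap L R c') * s x)
          (by simp [hs, frobEval_C, Algebra.smul_def])]
        simp [frobEval_C, Algebra.smul_def] }
    fun x y => by
      change frobEval p t (derivative (s (x * y))) = x • frobEval p t (derivative (s y)) +
        y • frobEval p t (derivative (s x))
      rw [h.frobEval_derivative_congr (g := s x * s y) (by simp [hs]), derivative_mul, map_add,
        map_mul, map_mul, hs, hs, smul_eq_mul, smul_eq_mul, mul_comm, add_comm]

theorem derivation_frobEval (h : IsPBasis p t) (f : R[X]) :
    h.derivation L (frobEval p t f) = frobEval p t (derivative f) :=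
  h.frobEval_derivative_congr (Function.surjInv_eq h.hasFrobeniusExpansion.frobEval_surjective _)

theorem derivation_self (h : IsPBasis p t) : h.derivation L t = 1 := by
  simpa [frobEval_X] using h.derivation_frobEval L X

theorem kaehlerD_eq_derivation_smul (h : IsPBasis p t) (x : R) :
    KaehlerDifferential.D L R x = h.derivation L x • KaehlerDifferential.D L R t := by
  obtain ⟨f, rfl⟩ := h.hasFrobeniusExpansion.frobEval_surjective x
  rw [leibniz_frobEval, derivation_frobEval]

/-- The module of differentials of a ring with `p`-basis `t` is free with basis `dt`. -/
noncomputable def kaehlerEquiv (h : IsPBasis p t) : Ω[R⁄L] ≃ₗ[R] R :=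
  LinearEquiv.ofLinearMap (h.derivation L).liftKaehlerDifferential
    (LinearMap.toSpanSingleton R _ (KaehlerDifferential.D L R t))
    (by ext; simp [derivation_self])
    (by ext x; simp [← kaehlerD_eq_derivation_smul])

theorem kaehlerEquiv_D (h : IsPBasis p t) (x : R) :
    h.kaehlerEquiv L (KaehlerDifferential.D L R x) = h.derivation L x :=
  Derivation.liftKaehlerDifferential_comp_D _ _

end IsPBasis

end FrobEval

section FrobeniusExpansion

open IsDiscreteValuationRing

variable {R : Type*} [CommRing R] [IsDomain R] [IsDiscreteValuationRing R]
variable (p : ℕ) [hp : Fact p.Prime]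

theorem eq_of_mul_add_mul_eq {p k l i j m : ℕ} (hm : p.Coprime m) (hi : i < p) (hj : j < p)
    (h : p * k + i * m = p * l + j * m) : i = j := by
  have hmod : i * m ≡ j * m [MOD p] := by
    rw [Nat.ModEq, ← Nat.mul_add_mod p k, h, Nat.mul_add_mod]
  exact (Nat.ModEq.cancel_right_of_coprime hm hmod).eq_of_lt_of_lt hi hj

theorem addVal_sum_mul_pow {z : R} {m : ℕ} (hz : addVal R z = m) (hm : ¬ p ∣ m)
    {b : ℕ → R} (hb : ∀ (i n : ℕ), addVal R (b i) = n → p ∣ n) {s : Finset ℕ}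
    (hs : s ⊆ Finset.range p) :
    addVal R (∑ i ∈ s, b i * z ^ i) = s.inf fun i => addVal R (b i) + (i * m : ℕ) := by
  have hval (i : ℕ) : addVal R (b i * z ^ i) = addVal R (b i) + (i * m : ℕ) := by
    rw [addVal_mul, addVal_pow, hz, nsmul_eq_mul, Nat.cast_mul]
  simp only [← hval]
  refine addValuation_sum_eq_inf (addVal R) s _ fun i hi j hj hij heq => by_contra fun htop => ?_
  have hdvd {k : ℕ} (hk : addVal R (b k * z ^ k) ≠ ⊤) : ∃ n, addVal R (b k) = (p * n : ℕ) := by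
    obtain ⟨n, hn⟩ := exists_addVal_eq_natCast (R := R) (x := b k) fun h0 => hk (by simp [h0])
    obtain ⟨n, rfl⟩ := hb k n hn
    exact ⟨n, hn⟩
  obtain ⟨k, hk⟩ := hdvd htop
  obtain ⟨l, hl⟩ := hdvd (heq ▸ htop)
  rw [hval, hval, hk, hl] at heq
  exact hij (eq_of_mul_add_mul_eq ((Nat.Prime.coprime_iff_not_dvd hp.out).2 hm)
    (Finset.mem_range.1 (hs hi)) (Finset.mem_range.1 (hs hj)) (by exact_mod_cast heq))

theorem addVal_sum_pow_mul_pow {z : R} {m : ℕ} (hz : addVal R z = m) (hm : ¬ p ∣ m)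
    (a : ℕ → R) {s : Finset ℕ} (hs : s ⊆ Finset.range p) :
    addVal R (∑ i ∈ s, a i ^ p * z ^ i) =
      s.inf fun i => p * addVal R (a i) + (i * m : ℕ) := by
  rw [addVal_sum_mul_pow p hz hm (fun i _ => dvd_of_addVal_pow_eq_natCast) hs]
  simp only [addVal_pow, nsmul_eq_mul]

theorem eq_zero_of_sum_pow_mul_pow_eq_zero {z : R} {m : ℕ} (hz : addVal R z = m) (hm : ¬ p ∣ m)
    {a : ℕ → R} (h : ∑ i ∈ Finset.range p, a i ^ p * z ^ i = 0) {i : ℕ} (hi : i < p) :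
    a i = 0 := by
  have hinf := addVal_sum_pow_mul_pow p hz hm a subset_rfl
  rw [h, addVal_zero] at hinf
  have htop := top_le_iff.1 (hinf.le.trans (Finset.inf_le (Finset.mem_range.2 hi)))
  by_contra hne
  obtain ⟨k, hk⟩ := exists_addVal_eq_natCast hne
  rw [hk] at htop
  exact ENat.natCast_ne_top (p * k + i * m) (by exact_mod_cast htop)

variable {p}

theorem HasFrobeniusExpansion.isPBasis {t : R} (h : HasFrobeniusExpansion p t)
    (ht : Irreducible t) : IsPBasis p t where
  hasFrobeniusExpansion := h
  eq_zero_of_sum_eq_zero _ ha _ hi := eq_zero_of_sum_pow_mul_pow_eq_zero p (m := 1)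
    (by simpa using addVal_uniformizer ht) (by simpa using hp.out.ne_one) ha hi

theorem HasFrobeniusExpansion.exists_addVal_sub_pow_eq {t : R} (h : HasFrobeniusExpansion p t)
    (ht : Irreducible t) {z : R} (hz : ¬ ∃ c, z = c ^ p) :
    ∃ (c : R) (m : ℕ), addVal R (z - c ^ p) = m ∧ ¬ p ∣ m := by
  obtain ⟨a, ha⟩ := h z
  have hsub : z - a 0 ^ p = ∑ i ∈ (Finset.range p).erase 0, a i ^ p * t ^ i := by
    rw [ha, ← Finset.add_sum_erase _ _ (Finset.mem_range.2 hp.out.pos), pow_zero, mul_one,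
      add_sub_cancel_left]
  have hval := addVal_sum_pow_mul_pow p (z := t) (m := 1) (by simpa using addVal_uniformizer ht)
    (by simpa using hp.out.ne_one) a (Finset.erase_subset 0 (Finset.range p))
  obtain ⟨i, hi, hinf⟩ := Finset.exists_mem_eq_inf ((Finset.range p).erase 0)
    ⟨1, by simp [hp.out.one_lt]⟩ (fun i => p * addVal R (a i) + (i * 1 : ℕ))
  rw [← hsub, hinf, mul_one] at hval
  have hai : a i ≠ 0 := by
    intro h0
    rw [h0, addVal_zero, ENat.mul_top (by exact_mod_cast hp.out.ne_zero), top_add] at hval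
    exact hz ⟨a 0, sub_eq_zero.1 (addVal_eq_top_iff.1 hval)⟩
  obtain ⟨k, hk⟩ := exists_addVal_eq_natCast hai
  refine ⟨a 0, p * k + i, by rw [hval, hk]; push_cast; rfl, fun hdvd => ?_⟩
  rw [Nat.dvd_add_right (dvd_mul_right p k)] at hdvd
  rw [Finset.mem_erase, Finset.mem_range] at hi
  exact absurd (Nat.le_of_dvd (Nat.pos_of_ne_zero hi.1) hdvd) (not_le.2 hi.2)

theorem addVal_derivation_add_one {L : Type*} [CommRing L] [Algebra L R] [CharP R p]
    {δ : Derivation L R R} {t : R} (ht : Irreducible t) (hδ : δ t = 1) {z : R} {m : ℕ}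
    (hz : addVal R z = m) (hm : ¬ p ∣ m) : addVal R (δ z) + 1 = m := by
  obtain ⟨k, rfl⟩ : ∃ k, m = k + 1 :=
    Nat.exists_eq_succ_of_ne_zero fun h => hm (h ▸ dvd_zero p)
  obtain ⟨n, u, rfl⟩ := eq_unit_mul_pow_irreducible (ne_zero_of_addVal_eq_natCast hz) ht
  obtain rfl : n = k + 1 := by rw [addVal_def' u ht] at hz; exact_mod_cast hz
  have hδz : δ (u * t ^ (k + 1)) = t ^ k * (((k + 1 : ℕ) : R) * u + t * δ u) := by
    rw [Derivation.leibniz, Derivation.leibniz_pow, hδ]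
    simp only [smul_eq_mul, nsmul_eq_mul, add_tsub_cancel_right]
    ring
  have hunit : addVal R (((k + 1 : ℕ) : R) * u) = 0 :=
    addVal_eq_zero_iff.2 (((CharP.isUnit_natCast_iff hp.out).2 hm).mul u.isUnit)
  have hlt : addVal R (((k + 1 : ℕ) : R) * u) < addVal R (t * δ u) := by
    rw [hunit, addVal_mul, addVal_uniformizer ht]
    exact lt_of_lt_of_le zero_lt_one le_self_add
  rw [hδz, addVal_mul, (addVal R).map_add_eq_of_lt_left hlt, hunit, ht.addVal_pow, add_zero,
    Nat.cast_succ]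

end FrobeniusExpansion

/-! ### Numerical semigroups with two coprime generators -/

section CoprimeGenerators

theorem exists_eq_mul_add_mul_of_coprime {m p : ℕ} (hp : 0 < p) (h : m.Coprime p) (n : ℤ) :
    ∃ a b : ℤ, 0 ≤ a ∧ a < p ∧ n = a * m + b * p := by
  obtain ⟨u, w, huw⟩ : IsCoprime (m : ℤ) (p : ℤ) := Nat.isCoprime_iff_coprime.2 h
  refine ⟨(n * u) % p, n * w + m * ((n * u) / p), Int.emod_nonneg _ (by lia),
    Int.emod_lt_of_pos _ (by lia), ?_⟩
  linear_combination (-n) * huw - m * Int.emod_add_mul_ediv (n * u) p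

theorem mem_closure_pair_iff_nonneg_of_coprime {m p n : ℕ} (h : m.Coprime p) {a b : ℤ}
    (ha : 0 ≤ a) (hap : a < p) (hn : (n : ℤ) = a * m + b * p) :
    n ∈ AddSubmonoid.closure {m, p} ↔ 0 ≤ b := by
  rw [AddSubmonoid.mem_closure_pair]
  constructor
  · rintro ⟨c, d, rfl⟩
    push_cast [smul_eq_mul] at hn
    by_contra! hb
    have hdvd : (p : ℤ) ∣ a - c := (Nat.isCoprime_iff_coprime.2 h.symm).dvd_of_dvd_mul_right
      ⟨d - b, by linear_combination -hn⟩
    have hac : a - c ≤ 0 := not_lt.1 fun hlt => by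
      have := Int.le_of_dvd hlt hdvd
      lia
    nlinarith
  · intro hb
    lift a to ℕ using ha
    lift b to ℕ using hb
    exact ⟨a, b, by exact_mod_cast hn.symm⟩

variable {m p : ℕ}

theorem mem_closure_pair_iff_notMem_of_coprime (hm : 0 < m) (hp : 0 < p) (h : m.Coprime p)
    {n k : ℕ} (hnk : n + k + 1 = (m - 1) * (p - 1)) :
    n ∈ AddSubmonoid.closure {m, p} ↔ k ∉ AddSubmonoid.closure {m, p} := by
  obtain ⟨a, b, ha, hap, hab⟩ := exists_eq_mul_add_mul_of_coprime hp h n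
  have hk : (k : ℤ) = (p - 1 - a) * m + (-1 - b) * p := by
    zify [Nat.one_le_iff_ne_zero.2 hm.ne', Nat.one_le_iff_ne_zero.2 hp.ne'] at hnk
    linear_combination hnk - hab
  rw [mem_closure_pair_iff_nonneg_of_coprime h ha hap hab,
    mem_closure_pair_iff_nonneg_of_coprime h (by lia) (by lia) hk]
  lia

theorem mem_closure_pair_of_le_of_coprime (hm : 0 < m) (hp : 0 < p) (h : m.Coprime p) {n : ℕ}
    (hn : (m - 1) * (p - 1) ≤ n) : n ∈ AddSubmonoid.closure {m, p} := by
  obtain ⟨a, b, ha, hap, hab⟩ := exists_eq_mul_add_mul_of_coprime hp h n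
  rw [mem_closure_pair_iff_nonneg_of_coprime h ha hap hab]
  by_contra! hb
  zify [Nat.one_le_iff_ne_zero.2 hm.ne', Nat.one_le_iff_ne_zero.2 hp.ne'] at hn
  nlinarith

theorem two_mul_ncard_compl_closure_pair_of_coprime (hm : 0 < m) (hp : 0 < p)
    (h : m.Coprime p) :
    2 * ((AddSubmonoid.closure {m, p} : Set ℕ)ᶜ).ncard = (m - 1) * (p - 1) := by
  classical
  set N := (m - 1) * (p - 1)
  set S := AddSubmonoid.closure {m, p}
  have hgaps : (S : Set ℕ)ᶜ = (Finset.range N).filter (· ∉ S) := by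
    ext n
    simpa using fun hn => not_le.1 (mt (mem_closure_pair_of_le_of_coprime hm hp h) hn)
  have hsymm : ((Finset.range N).filter (· ∈ S)).card = ((Finset.range N).filter (· ∉ S)).card := by
    refine Finset.card_nbij' (N - 1 - ·) (N - 1 - ·) ?_ ?_ ?_ ?_ <;> intro n hn <;>
      simp only [Finset.coe_filter, Finset.mem_range, Set.mem_ofPred_eq] at hn ⊢
    · exact ⟨by lia, (mem_closure_pair_iff_notMem_of_coprime hm hp h (by lia)).1 hn.2⟩
    · exact ⟨by lia, (mem_closure_pair_iff_notMem_of_coprime hm hp h (by lia)).2 hn.2⟩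
    all_goals lia
  have hcard := Finset.card_filter_add_card_filter_not (s := Finset.range N) (· ∈ S)
  rw [hsymm, Finset.card_range, ← two_mul] at hcard
  rw [hgaps, Set.ncard_coe_finset, hcard]

end CoprimeGenerators

/-! ### Differentials of a discrete valuation ring with a `p`-basis -/

section Cokernel

open IsDiscreteValuationRing
open IsLocalRing (ResidueField)

section

variable (L B R : Type*) [CommRing L] [CommRing B] [CommRing R]
variable [Algebra L B] [Algebra L R] [Algebra B R] [IsScalarTower L B R]

/-- The cokernel of `R ⊗ Ω(B / L) → Ω(R / L)`. -/
abbrev KaehlerCoker : Type _ :=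
  Ω[R⁄L] ⧸ LinearMap.range (KaehlerDifferential.mapBaseChange L B R)

/-- The image of `B` in `R` as an `L`-submodule. -/
abbrev imageSubmodule : Submodule L R :=
  LinearMap.range (IsScalarTower.toAlgHom L B R).toLinearMap

theorem range_mapBaseChange_eq_span :
    LinearMap.range (KaehlerDifferential.mapBaseChange L B R) =
      Submodule.span R (Set.range fun b : B => KaehlerDifferential.D L R (algebraMap B R b)) := by
  rw [LinearMap.range_eq_map, ← Submodule.baseChange_top,
    ← KaehlerDifferential.span_range_derivation, Submodule.baseChange_span, Submodule.map_span,
    ← Set.range_comp, ← Set.range_comp]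
  congr 2
  ext b
  simp

end

section

variable {R : Type*} [CommRing R]
variable {L : Type*} [CommRing L] [Algebra L R] {δ : Derivation L R R} {t : R}

theorem exists_mem_derivation_ne_zero {W : Submodule L R} {s : R} (hδ : δ t = 1) (hs0 : s ≠ 0)
    (hs : ∀ x, s * x ∈ W) : ∃ w ∈ W, δ w ≠ 0 := by
  by_contra! hzero
  have hδs : δ s = 0 := by simpa using hzero _ (hs 1)
  have hδst := hzero _ (hs t)
  rw [Derivation.leibniz, hδ, hδs, smul_zero, add_zero, smul_eq_mul, mul_one] at hδst
  exact hs0 hδst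

theorem addVal_sub_algebraMap_eq_one_of_isUnit_derivation [IsDomain R]
    [IsDiscreteValuationRing R] (ht : Irreducible t) (hδ : δ t = 1) {b : R} (hb : IsUnit (δ b))
    {c : L} (hc : b - algebraMap L R c ∈ IsLocalRing.maximalIdeal R) :
    addVal R (b - algebraMap L R c) = 1 := by
  rw [ht.maximalIdeal_eq, Ideal.mem_span_singleton] at hc
  obtain ⟨u, hu⟩ := hc
  have hδb : δ b = t * δ u + u := by
    have h := congrArg δ hu
    rwa [map_sub, Derivation.map_algebraMap, sub_zero, Derivation.leibniz, hδ, smul_eq_mul,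
      smul_eq_mul, mul_one] at h
  have hunit : IsUnit u := by
    by_contra hnu
    refine IsLocalRing.mem_maximalIdeal _ |>.1 ?_ hb
    rw [hδb]
    exact add_mem (Ideal.mul_mem_right _ _ ht.not_isUnit) hnu
  rw [hu, addVal_mul, addVal_uniformizer ht, addVal_eq_zero_iff.2 hunit, add_zero]

end

variable {R : Type*} [CommRing R]
variable {p : ℕ} [hp : Fact p.Prime] [CharP R p]

theorem span_derivation_frobEval_eq {L : Type*} [CommRing L] [Algebra L R] (δ : Derivation L R R)
    (z : R) : Ideal.span (δ '' (frobEval p z).range) = Ideal.span {δ z} := by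
  refine le_antisymm (Ideal.span_le.2 ?_) (Ideal.span_mono ?_)
  · rintro _ ⟨_, ⟨f, rfl⟩, rfl⟩
    rw [leibniz_frobEval]
    exact Ideal.mul_mem_left _ _ (Ideal.mem_span_singleton_self _)
  · exact Set.singleton_subset_iff.2 ⟨z, ⟨Polynomial.X, frobEval_X p z⟩, rfl⟩

section

variable [IsDomain R] [IsDiscreteValuationRing R] {z : R} {m : ℕ}

theorem exists_addVal_frobEval_eq_iff (hz : addVal R z = m) (hm : ¬ p ∣ m) {n : ℕ} :
    (∃ x ∈ (frobEval p z).range, addVal R x = n) ↔ n ∈ AddSubmonoid.closure {m, p} := by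
  obtain ⟨t, ht⟩ := exists_irreducible R
  rw [AddSubmonoid.mem_closure_pair]
  constructor
  · rintro ⟨x, hx, hn⟩
    obtain ⟨a, rfl⟩ := (mem_frobEval_range_iff p).1 hx
    rw [addVal_sum_pow_mul_pow p hz hm a subset_rfl] at hn
    obtain ⟨i, -, hi⟩ := Finset.exists_mem_eq_inf (Finset.range p)
      ⟨0, Finset.mem_range.2 hp.out.pos⟩ (fun i => p * addVal R (a i) + (i * m : ℕ))
    rw [hi] at hn
    obtain ⟨k, hk⟩ := exists_addVal_eq_natCast (x := a i) fun h0 => by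
      rw [h0, addVal_zero, ENat.mul_top (by exact_mod_cast hp.out.ne_zero), top_add] at hn
      exact ENat.natCast_ne_top n hn.symm
    rw [hk] at hn
    refine ⟨i, k, ?_⟩
    rw [smul_eq_mul, smul_eq_mul, add_comm, mul_comm k]
    exact_mod_cast hn
  · rintro ⟨a, b, rfl⟩
    refine ⟨z ^ a * (t ^ b) ^ p, ⟨Polynomial.X ^ a * Polynomial.C (t ^ b), ?_⟩, ?_⟩
    · rw [map_mul, map_pow, frobEval_X, frobEval_C]
    · rw [addVal_mul, addVal_pow, addVal_pow, ht.addVal_pow, hz]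
      simp only [nsmul_eq_mul, smul_eq_mul]
      push_cast
      ring

variable {L : Type*} [Field L] [Algebra L R]

theorem valueSet_eq_closure_pair {W : Submodule L R} (hW : (W : Set R) = (frobEval p z).range)
    (hz : addVal R z = m) (hm : ¬ p ∣ m) :
    valueSet W = AddSubmonoid.closure {m, p} := by
  ext n
  rw [SetLike.mem_coe, ← exists_addVal_frobEval_eq_iff hz hm]
  simp only [valueSet, Set.mem_ofPred_eq, ← SetLike.mem_coe, hW]

theorem finite_quotient_and_two_mul_finrank_eq
    (hres : Function.Surjective (algebraMap L (ResidueField R)))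
    {W : Submodule L R} (hW : (W : Set R) = (frobEval p z).range) {s : R} (hs0 : s ≠ 0)
    (hs : ∀ x, s * x ∈ W) (hz : addVal R z = m) (hm : ¬ p ∣ m) :
    Module.Finite L (R ⧸ W) ∧ 2 * Module.finrank L (R ⧸ W) = (m - 1) * (p - 1) := by
  obtain ⟨hfin, hrank⟩ := finite_quotient_and_finrank_eq_ncard hres hs0 hs
  refine ⟨hfin, ?_⟩
  rw [hrank, valueSet_eq_closure_pair hW hz hm]
  exact two_mul_ncard_compl_closure_pair_of_coprime
    (Nat.pos_of_ne_zero fun h => hm (h ▸ dvd_zero p)) hp.out.pos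
    ((Nat.Prime.coprime_iff_not_dvd hp.out).2 hm).symm

theorem HasFrobeniusExpansion.exists_addVal_eq_and_frobEval_range_eq {t : R}
    (h : HasFrobeniusExpansion p t) (ht : Irreducible t) {W : Submodule L R}
    (hW : (W : Set R) = (frobEval p z).range) {s : R} (hs0 : s ≠ 0) (hs : ∀ x, s * x ∈ W) :
    ∃ (z' : R) (m : ℕ), addVal R z' = m ∧ ¬ p ∣ m ∧
      (frobEval p z').range = (frobEval p z).range := by
  have hz : ¬ ∃ c, z = c ^ p := by
    rintro ⟨c, rfl⟩
    obtain ⟨n, ⟨x, hx, hxn⟩, hn⟩ := exists_mem_valueSet_not_dvd hp.out.ne_one hs0 hs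
    rw [← SetLike.mem_coe, hW] at hx
    obtain ⟨f, rfl⟩ := hx
    rw [frobEval, Polynomial.coe_eval₂RingHom, ← frobenius_def, Polynomial.eval₂_at_apply,
      frobenius_def] at hxn
    exact hn (dvd_of_addVal_pow_eq_natCast hxn)
  obtain ⟨c, m, hc, hm⟩ := h.exists_addVal_sub_pow_eq ht hz
  exact ⟨z - c ^ p, m, hc, hm, frobEval_range_sub_pow p z c⟩

end

variable {L : Type*} [CommRing L] [CharP L p] [PerfectRing L p] [Algebra L R]
variable {B : Type*} [CommRing B] [Algebra L B] [Algebra B R] [IsScalarTower L B R] {t : R}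

theorem IsPBasis.map_kaehlerEquiv_range_mapBaseChange (h : IsPBasis p t) :
    (LinearMap.range (KaehlerDifferential.mapBaseChange L B R)).map (h.kaehlerEquiv L).toLinearMap =
      Ideal.span (h.derivation L '' imageSubmodule L B R) := by
  rw [range_mapBaseChange_eq_span, Submodule.map_span, ← Set.range_comp, LinearMap.coe_range,
    ← Set.range_comp]
  exact congrArg (fun f : B → R => Ideal.span (Set.range f))
    (funext fun b => h.kaehlerEquiv_D L (algebraMap B R b))

end Cokernel

section CokernelOfDiscreteValuationRing

open IsDiscreteValuationRing
open IsLocalRing (ResidueField)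

variable {R : Type*} [CommRing R] [IsDomain R] [IsDiscreteValuationRing R]
variable {p : ℕ} [hp : Fact p.Prime] [CharP R p]
variable {L : Type*} [Field L] [CharP L p] [PerfectRing L p] [Algebra L R]
variable {B : Type*} [CommRing B] [Algebra L B] [Algebra B R] [IsScalarTower L B R] {t : R}

theorem IsPBasis.finite_kaehlerCoker_and_finrank_eq (h : IsPBasis p t)
    (hres : Function.Surjective (algebraMap L (ResidueField R))) {x : R} {n : ℕ}
    (hx : addVal R x = n)
    (hspan : Ideal.span (h.derivation L '' imageSubmodule L B R) = Ideal.span {x}) :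
    Module.Finite L (KaehlerCoker L B R) ∧ Module.finrank L (KaehlerCoker L B R) = n := by
  obtain ⟨hfin, hrank⟩ := finite_quotient_span_singleton_and_finrank_eq hres hx
  let e := (Submodule.Quotient.equiv _ _ (h.kaehlerEquiv L)
    (h.map_kaehlerEquiv_range_mapBaseChange.trans hspan)).restrictScalars L
  exact ⟨Module.Finite.equiv e.symm, e.finrank_eq.trans hrank⟩

theorem IsPBasis.exists_isUnit_derivation_of_finrank_kaehlerCoker_eq_zero (h : IsPBasis p t)
    (hres : Function.Surjective (algebraMap L (ResidueField R))) {s : R} (hs0 : s ≠ 0)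
    (hs : ∀ x, s * x ∈ imageSubmodule L B R) (hd : Module.finrank L (KaehlerCoker L B R) = 0) :
    ∃ b ∈ imageSubmodule L B R, IsUnit (h.derivation L b) := by
  set I := Ideal.span (h.derivation L '' imageSubmodule L B R) with hI
  obtain ⟨x, hx⟩ : ∃ x, I = Ideal.span {x} := (IsPrincipalIdealRing.principal I).principal
  have hx0 : x ≠ 0 := by
    rintro rfl
    obtain ⟨w, hw, hδw⟩ := exists_mem_derivation_ne_zero (h.derivation_self L) hs0 hs
    have hmem : h.derivation L w ∈ I := Ideal.subset_span ⟨w, hw, rfl⟩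
    exact hδw (by simpa [hx] using hmem)
  obtain ⟨n, hn⟩ := exists_addVal_eq_natCast hx0
  obtain rfl : 0 = n := hd.symm.trans (h.finite_kaehlerCoker_and_finrank_eq hres hn hx).2
  by_contra! hno
  have hle : I ≤ IsLocalRing.maximalIdeal R := by
    rw [hI, Ideal.span_le]
    rintro _ ⟨b, hb, rfl⟩
    exact hno b hb
  rw [hx, Ideal.span_singleton_eq_top.2 (addVal_eq_zero_iff.1 hn), top_le_iff] at hle
  exact (IsLocalRing.maximalIdeal.isMaximal R).ne_top hle

theorem IsPBasis.algebraMap_surjective_of_finrank_kaehlerCoker_eq_zero (h : IsPBasis p t)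
    (ht : Irreducible t) (hres : Function.Surjective (algebraMap L (ResidueField R)))
    {s : R} (hs0 : s ≠ 0) (hs : ∀ x, s * x ∈ imageSubmodule L B R)
    (hd : Module.finrank L (KaehlerCoker L B R) = 0) : Function.Surjective (algebraMap B R) := by
  obtain ⟨_, ⟨b, rfl⟩, hb⟩ :=
    h.exists_isUnit_derivation_of_finrank_kaehlerCoker_eq_zero hres hs0 hs hd
  obtain ⟨c, hc⟩ := exists_sub_algebraMap_mem_maximalIdeal hres (algebraMap B R b)
  have hval : addVal R (algebraMap B R b - algebraMap L R c) = 1 :=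
    addVal_sub_algebraMap_eq_one_of_isUnit_derivation ht (h.derivation_self L) hb hc
  refine LinearMap.range_eq_top.1 (eq_top_of_valueSet_eq_univ hres hs0 hs
    (Set.eq_univ_of_forall fun n => ⟨_, ⟨(b - algebraMap L B c) ^ n, rfl⟩, ?_⟩))
  simp [← IsScalarTower.algebraMap_apply, hval]

theorem IsPBasis.finite_kaehlerCoker_and_one_add_finrank_eq (h : IsPBasis p t)
    (ht : Irreducible t) (hres : Function.Surjective (algebraMap L (ResidueField R)))
    {z : R} (hB : (imageSubmodule L B R : Set R) = (frobEval p z).range) {m : ℕ}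
    (hz : addVal R z = m) (hm : ¬ p ∣ m) :
    Module.Finite L (KaehlerCoker L B R) ∧ 1 + Module.finrank L (KaehlerCoker L B R) = m := by
  have hδz := addVal_derivation_add_one ht (h.derivation_self L) hz hm
  obtain ⟨k, rfl⟩ : ∃ k, m = k + 1 := Nat.exists_eq_succ_of_ne_zero fun h => hm (h ▸ dvd_zero p)
  obtain ⟨hfin, hrank⟩ := h.finite_kaehlerCoker_and_finrank_eq (L := L) (B := B) (n := k) hres
    (ENat.add_left_injective_of_ne_top ENat.one_ne_top (by simpa using hδz))
    (by rw [hB, span_derivation_frobEval_eq])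
  exact ⟨hfin, by rw [hrank, add_comm]⟩

end CokernelOfDiscreteValuationRing

section FrobeniusFinite

open Polynomial

theorem finite_of_finite_comp_of_injective {P U T : Type*} [CommRing P] [CommRing U] [CommRing T]
    [IsNoetherianRing P] {g : P →+* U} {φ : U →+* T} (hφ : Function.Injective φ)
    (h : (φ.comp g).Finite) : g.Finite := by
  algebraize [g, φ, φ.comp g]
  have := isNoetherian_of_isNoetherianRing_of_finite P T
  exact Module.Finite.of_injective (IsScalarTower.toAlgHom P U T).toLinearMap hφ

variable {p : ℕ} [hp : Fact p.Prime]

theorem hasFrobeniusExpansion_X (L : Type*) [CommRing L] [CharP L p] [PerfectRing L p] :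
    HasFrobeniusExpansion p (X : L[X]) := by
  intro f
  rw [← mem_frobEval_range_iff]
  have hC (c : L) : C c ∈ (frobEval p (X : L[X])).range := by
    obtain ⟨c, rfl⟩ := (bijective_frobenius L p).2 c
    exact ⟨C (C c), by rw [frobEval_C, frobenius_def, C_pow]⟩
  induction f using Polynomial.induction_on' with
  | add f g hf hg => exact add_mem hf hg
  | monomial n c =>
    rw [← C_mul_X_pow_eq_monomial]
    exact mul_mem (hC c) (pow_mem (RingHom.mem_range.2 ⟨X, frobEval_X p X⟩) n)

theorem HasFrobeniusExpansion.algebraMap_of_isFractionRing {A M : Type*} [CommRing A] [Field M]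
    [Algebra A M] [IsFractionRing A M] {t : A} (h : HasFrobeniusExpansion p t) :
    HasFrobeniusExpansion p (algebraMap A M t) := by
  intro x
  obtain ⟨f, g, hg, rfl⟩ := IsFractionRing.div_surjective (A := A) x
  have : Nontrivial A := (algebraMap A M).domain_nontrivial
  have hg0 : algebraMap A M g ≠ 0 := IsFractionRing.to_map_ne_zero_of_mem_nonZeroDivisors hg
  obtain ⟨a, ha⟩ := h (f * g ^ (p - 1))
  refine ⟨fun i => algebraMap A M (a i) / algebraMap A M g,
    mul_right_cancel₀ (pow_ne_zero p hg0) ?_⟩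
  calc algebraMap A M f / algebraMap A M g * algebraMap A M g ^ p
      = algebraMap A M (f * g ^ (p - 1)) := by
        rw [← Nat.sub_add_cancel hp.out.one_le, pow_succ', ← mul_assoc, div_mul_cancel₀ _ hg0,
          Nat.add_sub_cancel, map_mul, map_pow]
    _ = ∑ i ∈ Finset.range p, algebraMap A M (a i) ^ p * algebraMap A M t ^ i := by
        simp only [ha, map_sum, map_mul, map_pow]
    _ = _ := by
        rw [Finset.sum_mul]
        refine Finset.sum_congr rfl fun i _ => ?_
        rw [mul_right_comm, div_pow, div_mul_cancel₀ _ (pow_ne_zero p hg0)]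

theorem HasFrobeniusExpansion.finite_frobenius {A : Type*} [CommRing A] [CharP A p] {t : A}
    (h : HasFrobeniusExpansion p t) : (frobenius A p).Finite := by
  have hmonic : (X ^ p - C t).Monic := monic_X_pow_sub_C t hp.out.ne_zero
  let φ := AdjoinRoot.lift (frobenius A p) t (f := X ^ p - C t) (frobEval_X_pow_sub_C p t)
  have hφ : Function.Surjective φ := fun x => by
    obtain ⟨f, rfl⟩ := h.frobEval_surjective x
    exact ⟨AdjoinRoot.mk _ f, AdjoinRoot.lift_mk _ f⟩
  have hcomp : φ.comp (AdjoinRoot.of (X ^ p - C t)) = frobenius A p :=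
    RingHom.ext fun _ => AdjoinRoot.lift_of (frobEval_X_pow_sub_C p t)
  rw [← hcomp]
  exact (RingHom.Finite.of_surjective φ hφ).comp
    (RingHom.finite_algebraMap.2 hmonic.finite_adjoinRoot)

theorem finite_iterateFrobenius {A : Type*} [CommRing A] [CharP A p] (h : (frobenius A p).Finite)
    (n : ℕ) : (iterateFrobenius A p n).Finite := by
  induction n with
  | zero => rw [iterateFrobenius_zero]; exact RingHom.Finite.id A
  | succ n ih =>
    rw [iterateFrobenius_add, iterateFrobenius_one]
    exact ih.comp h

theorem finite_integralClosure_of_finite_frobenius {A E : Type*} (M : Type*) [CommRing A]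
    [IsNoetherianRing A] [IsIntegrallyClosed A] [CharP A p] [Field M] [Field E] [Algebra A M]
    [IsFractionRing A M] [Algebra A E] [Algebra M E] [IsScalarTower A M E] [FiniteDimensional M E]
    (h : (frobenius A p).Finite) : Module.Finite A (integralClosure A E) := by
  have : IsDomain A := (IsFractionRing.injective A M).isDomain
  have : CharP M p := charP_of_injective_algebraMap (IsFractionRing.injective A M) p
  let S := separableClosure M E
  let n := IsPurelyInseparable.exponent S E
  let φ := IsPurelyInseparable.iterateFrobenius S E p (n := n) le_rfl
  have hφ (x : E) : algebraMap S E (φ x) = x ^ p ^ n :=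
    IsPurelyInseparable.algebraMap_iterateFrobenius S p le_rfl x
  have : IsScalarTower A S E := .of_algebraMap_eq' <| by
    rw [IsScalarTower.algebraMap_eq A M E, IsScalarTower.algebraMap_eq A M S, ← RingHom.comp_assoc,
      ← IsScalarTower.algebraMap_eq M S E]
  have hmem (x : E) (hx : x ∈ integralClosure A E) : φ x ∈ integralClosure A S := by
    refine (isIntegral_algebraMap_iff (algebraMap S E).injective).1 ?_
    rw [hφ]
    exact IsIntegral.pow hx _
  let ψ : integralClosure A E →+* integralClosure A S := φ.restrict _ _ hmem
  have hcomp : ψ.comp (algebraMap A (integralClosure A E)) =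
      (algebraMap A (integralClosure A S)).comp (iterateFrobenius A p n) := by
    ext a
    refine (hφ _).trans ?_
    rw [RingHom.comp_apply, iterateFrobenius_def, map_pow]
    rfl
  have hfin : (algebraMap A (integralClosure A S)).Finite :=
    RingHom.finite_algebraMap.2 (IsIntegralClosure.finite A M S _)
  refine RingHom.finite_algebraMap.1 (finite_of_finite_comp_of_injective (φ := ψ) ?_ ?_)
  · exact fun x y hxy => Subtype.ext (φ.injective (congrArg Subtype.val hxy))
  · rw [hcomp]
    exact hfin.comp (finite_iterateFrobenius h n)

end FrobeniusFinite

section FiniteExtension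

variable {M₁ M₂ E₁ E₂ : Type*} [Field M₁] [Field M₂] [Field E₁] [Field E₂]
  [Algebra M₁ E₁] [Algebra M₂ E₂] [FiniteDimensional M₁ E₁] [FiniteDimensional M₂ E₂]

theorem finite_and_finrank_eq_of_finrank_eq [Algebra M₁ M₂] [Algebra E₁ E₂] [Algebra M₁ E₂]
    [IsScalarTower M₁ M₂ E₂] [IsScalarTower M₁ E₁ E₂] [FiniteDimensional M₁ M₂]
    (h : Module.finrank M₁ E₁ = Module.finrank M₂ E₂) :
    FiniteDimensional E₁ E₂ ∧ Module.finrank E₁ E₂ = Module.finrank M₁ M₂ := by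
  have : FiniteDimensional M₁ E₂ := FiniteDimensional.trans M₁ M₂ E₂
  have : FiniteDimensional E₁ E₂ := Module.Finite.of_restrictScalars_finite M₁ E₁ E₂
  have hmul : Module.finrank M₁ E₁ * Module.finrank E₁ E₂ =
      Module.finrank M₁ M₂ * Module.finrank M₂ E₂ := by
    rw [Module.finrank_mul_finrank, Module.finrank_mul_finrank]
  rw [h, mul_comm] at hmul
  exact ⟨this, Nat.eq_of_mul_eq_mul_right Module.finrank_pos hmul⟩

theorem span_eq_top_of_finrank_eq [Algebra M₁ M₂] [Algebra E₁ E₂] [Algebra M₁ E₂]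
    [IsScalarTower M₁ M₂ E₂] [IsScalarTower M₁ E₁ E₂] {ι : Type*} [Finite ι]
    (h : Module.finrank M₁ E₁ = Module.finrank M₂ E₂) {w : ι → M₂}
    (hw : Submodule.span M₁ (Set.range w) = ⊤) {v : ι → E₂} (hv : LinearIndependent E₁ v) :
    Submodule.span E₁ (Set.range v) = ⊤ := by
  have := Fintype.ofFinite ι
  have : FiniteDimensional M₁ M₂ :=
    Module.finite_def.2 (hw ▸ Submodule.fg_span (Set.finite_range w))
  have hle : Module.finrank M₁ M₂ ≤ Fintype.card ι := by
    have hcard := finrank_range_le_card (R := M₁) w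
    rwa [Set.finrank, hw, finrank_top] at hcard
  obtain ⟨_, hrank⟩ := finite_and_finrank_eq_of_finrank_eq h
  exact hv.span_eq_top_of_card_eq_finrank'
    (hv.fintype_card_le_finrank.antisymm (hrank.trans_le hle))

theorem exists_eq_sum_of_finrank_eq {f : M₁ →+* M₂} {g : E₁ →+* E₂}
    (hfg : (algebraMap M₂ E₂).comp f = g.comp (algebraMap M₁ E₁))
    (h : Module.finrank M₁ E₁ = Module.finrank M₂ E₂) {ι : Type*} [Fintype ι] {w : ι → M₂}
    (hw : ∀ x, ∃ a : ι → M₁, x = ∑ i, f (a i) * w i) {v : ι → E₂}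
    (hv : ∀ a : ι → E₁, ∑ i, g (a i) * v i = 0 → ∀ i, a i = 0) (x : E₂) :
    ∃ a : ι → E₁, x = ∑ i, g (a i) * v i := by
  algebraize [f, g, (algebraMap M₂ E₂).comp f]
  have : IsScalarTower M₁ E₁ E₂ := .of_algebraMap_eq' hfg
  have hspan : Submodule.span M₁ (Set.range w) = ⊤ := eq_top_iff.2 fun y _ =>
    (Submodule.mem_span_range_iff_exists_fun M₁).2 ((hw y).imp fun _ => Eq.symm)
  have hspan' := span_eq_top_of_finrank_eq h hspan (Fintype.linearIndependent_iff.2 hv)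
  exact ((Submodule.mem_span_range_iff_exists_fun E₁).1 (hspan' ▸ Submodule.mem_top)).imp
    fun _ => Eq.symm

theorem HasFrobeniusExpansion.of_finiteDimensional {p : ℕ} [hp : Fact p.Prime] {M E : Type*}
    [Field M] [Field E] [CharP E p] [Algebra M E] [FiniteDimensional M E] {w : M}
    (hw : HasFrobeniusExpansion p w) {t : E}
    (ht : ∀ a : ℕ → E, ∑ i ∈ Finset.range p, a i ^ p * t ^ i = 0 → ∀ i < p, a i = 0) :
    HasFrobeniusExpansion p t := by
  have : CharP M p := (algebraMap M E).charP (algebraMap M E).injective p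
  have hcomm : (algebraMap M E).comp (frobenius M p) = (frobenius E p).comp (algebraMap M E) :=
    RingHom.ext fun x => map_pow (algebraMap M E) x p
  have hspan (y : M) : ∃ a : Fin p → M, y = ∑ i, frobenius M p (a i) * w ^ (i : ℕ) := by
    obtain ⟨a, ha⟩ := hw y
    exact ⟨fun i => a i, by simpa only [Finset.sum_range, frobenius_def] using ha⟩
  have hindep (a : Fin p → E) (ha : ∑ i, frobenius E p (a i) * t ^ (i : ℕ) = 0) (i : Fin p) :
      a i = 0 := by
    have h0 := ht (Function.extend Fin.val a 0)
    simp only [Finset.sum_range, Fin.val_injective.extend_apply, ← frobenius_def p] at h0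
    simpa only [Fin.val_injective.extend_apply] using h0 ha i i.2
  intro x
  obtain ⟨a, ha⟩ := exists_eq_sum_of_finrank_eq hcomm rfl hspan hindep x
  refine ⟨Function.extend Fin.val a 0, ?_⟩
  simpa only [Finset.sum_range, Fin.val_injective.extend_apply, frobenius_def] using ha

end FiniteExtension

section Descent

open IsDiscreteValuationRing

variable {p : ℕ} {R E : Type*} [CommRing R] [Field E] [Algebra R E]

theorem algebraMap_sum_pow_mul_pow {s t : R} {c : ℕ → R} {a : ℕ → E}
    (hc : ∀ i < p, algebraMap R E (c i) = algebraMap R E s * a i) :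
    algebraMap R E (∑ i ∈ Finset.range p, c i ^ p * t ^ i) =
      algebraMap R E s ^ p * ∑ i ∈ Finset.range p, a i ^ p * algebraMap R E t ^ i := by
  rw [map_sum, Finset.mul_sum]
  refine Finset.sum_congr rfl fun i hi => ?_
  rw [map_mul, map_pow, map_pow, hc i (Finset.mem_range.1 hi), mul_pow, mul_assoc]

variable [IsDomain R] [IsFractionRing R E]

theorem exists_algebraMap_eq_mul (n : ℕ) (a : ℕ → E) : ∃ s : R, s ≠ 0 ∧
    ∃ c : ℕ → R, ∀ i < n, algebraMap R E (c i) = algebraMap R E s * a i := by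
  obtain ⟨s, hs⟩ := IsLocalization.exist_integer_multiples (nonZeroDivisors R) (Finset.range n) a
  have hc (i : ℕ) : ∃ c, i < n → algebraMap R E c = algebraMap R E s * a i := by
    by_cases hi : i < n
    · obtain ⟨c, hc⟩ := hs i (Finset.mem_range.2 hi)
      exact ⟨c, fun _ => hc.trans (Algebra.smul_def _ _)⟩
    · exact ⟨0, fun h => absurd h hi⟩
  choose c hc using hc
  exact ⟨s, nonZeroDivisors.ne_zero s.2, c, hc⟩

theorem eq_zero_of_sum_eq_zero_of_isFractionRing {t : R}
    (ht : ∀ a : ℕ → R, ∑ i ∈ Finset.range p, a i ^ p * t ^ i = 0 → ∀ i < p, a i = 0) {a : ℕ → E}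
    (ha : ∑ i ∈ Finset.range p, a i ^ p * algebraMap R E t ^ i = 0) {i : ℕ} (hi : i < p) :
    a i = 0 := by
  obtain ⟨s, hs, c, hc⟩ := exists_algebraMap_eq_mul (R := R) p a
  have hsum : ∑ i ∈ Finset.range p, c i ^ p * t ^ i = 0 := IsFractionRing.injective R E <| by
    rw [algebraMap_sum_pow_mul_pow hc, ha, mul_zero, map_zero]
  have hci := hc i hi
  rw [ht c hsum i hi, map_zero, eq_comm, mul_eq_zero, IsFractionRing.to_map_eq_zero_iff] at hci
  exact hci.resolve_left hs

variable [IsDiscreteValuationRing R] [hp : Fact p.Prime] {t : R}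

theorem dvd_of_pow_dvd_sum_pow_mul_pow (ht : Irreducible t) {s : R} {c : ℕ → R}
    (h : s ^ p ∣ ∑ i ∈ Finset.range p, c i ^ p * t ^ i) {i : ℕ} (hi : i < p) : s ∣ c i := by
  have hle : addVal R (s ^ p) ≤ p * addVal R (c i) + (i * 1 : ℕ) := by
    refine (addVal_le_iff_dvd.2 h).trans ?_
    rw [addVal_sum_pow_mul_pow p (m := 1) (by simpa using addVal_uniformizer ht)
      (by simpa using hp.out.ne_one) c subset_rfl]
    exact Finset.inf_le (Finset.mem_range.2 hi)
  rw [← addVal_le_iff_dvd]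
  rcases eq_or_ne (c i) 0 with hci | hci
  · rw [hci, addVal_zero]
    exact le_top
  obtain ⟨l, hl⟩ := exists_addVal_eq_natCast hci
  rw [hl, addVal_pow, nsmul_eq_mul, mul_one] at hle
  by_contra! hlt
  rw [hl, natCast_lt_addVal_iff] at hlt
  have hmul : ((p * (l + 1) : ℕ) : ℕ∞) ≤ (p * l + i : ℕ) := by
    push_cast
    exact (mul_le_mul_right (by exact_mod_cast hlt) _).trans hle
  have : p * (l + 1) ≤ p * l + i := by exact_mod_cast hmul
  rw [mul_add, mul_one] at this
  omega

theorem HasFrobeniusExpansion.of_algebraMap_of_isFractionRing (ht : Irreducible t)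
    (h : HasFrobeniusExpansion p (algebraMap R E t)) : HasFrobeniusExpansion p t := by
  intro x
  obtain ⟨a, ha⟩ := h (algebraMap R E x)
  obtain ⟨s, hs, c, hc⟩ := exists_algebraMap_eq_mul (R := R) p a
  have hsum : s ^ p * x = ∑ i ∈ Finset.range p, c i ^ p * t ^ i := by
    refine IsFractionRing.injective R E ?_
    rw [algebraMap_sum_pow_mul_pow hc, ← ha, map_mul, map_pow]
  have hdvd (i : ℕ) : ∃ d, i < p → c i = s * d := by
    by_cases hi : i < p
    · obtain ⟨d, hd⟩ := dvd_of_pow_dvd_sum_pow_mul_pow ht (Dvd.intro x hsum) hi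
      exact ⟨d, fun _ => hd⟩
    · exact ⟨0, fun h => absurd h hi⟩
  choose d hd using hdvd
  refine ⟨d, mul_left_cancel₀ (pow_ne_zero p hs) ?_⟩
  rw [hsum, Finset.mul_sum]
  refine Finset.sum_congr rfl fun i hi => ?_
  rw [hd i (Finset.mem_range.1 hi), mul_pow, mul_assoc]

end Descent

/-! ### Normalization of a purely inseparable base change -/

section PRadical

variable {p : ℕ} {O B : Type*} [CommRing O] [CommRing B]

theorem isPRadical_of_injective {i : O →+* B} (hi : Function.Injective i)
    (h : ∀ b, ∃ (n : ℕ) (o : O), i o = b ^ p ^ n) : IsPRadical i p :=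
  ⟨h, ((RingHom.injective_iff_ker_eq_bot i).1 hi).trans_le bot_le⟩

variable [Algebra O B]

theorem faithfulSMul_of_isPRadical [IsReduced O] (h : IsPRadical (algebraMap O B) p) :
    FaithfulSMul O B := by
  rw [faithfulSMul_iff_algebraMap_injective, RingHom.injective_iff_ker_eq_bot, eq_bot_iff]
  exact (h.ker_le'.trans pNilradical_le_nilradical).trans (nilradical_eq_zero O).le

variable {E : Type*} [Field E] [Algebra B E] [IsFractionRing B E] [Algebra O E]
  [IsScalarTower O B E]

theorem exists_pow_mul_algebraMap_eq [IsDomain B] (h : IsPRadical (algebraMap O B) p) (x : E) :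
    ∃ (n : ℕ) (a b : O), algebraMap O E b ≠ 0 ∧
      x ^ p ^ n * algebraMap O E b = algebraMap O E a := by
  obtain ⟨c, s, hs, rfl⟩ := IsFractionRing.div_surjective (A := B) x
  obtain ⟨n, a, ha⟩ := h.pow_mem' c
  obtain ⟨k, b, hb⟩ := h.pow_mem' s
  have hs0 : algebraMap B E s ≠ 0 := IsFractionRing.to_map_ne_zero_of_mem_nonZeroDivisors hs
  have hbE : algebraMap O E b = algebraMap B E s ^ p ^ k := by
    rw [IsScalarTower.algebraMap_apply O B E, hb, map_pow]
  have haE : algebraMap O E a = algebraMap B E c ^ p ^ n := by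
    rw [IsScalarTower.algebraMap_apply O B E, ha, map_pow]
  refine ⟨n + k, a ^ p ^ k, b ^ p ^ n, ?_, ?_⟩
  · rw [map_pow, hbE]
    exact pow_ne_zero _ (pow_ne_zero _ hs0)
  · rw [map_pow, map_pow, haE, hbE, ← pow_mul, ← pow_mul, ← pow_add, ← pow_add, add_comm k n,
      ← mul_pow, div_mul_cancel₀ _ hs0]

variable [hp : Fact p.Prime]

theorem isIntegral_of_isPRadical (h : IsPRadical (algebraMap O B) p) : Algebra.IsIntegral O B :=
  ⟨fun b => by
    obtain ⟨n, o, ho⟩ := h.pow_mem' b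
    exact IsIntegral.of_pow (pow_pos hp.out.pos n) (ho ▸ isIntegral_algebraMap)⟩

theorem exists_algebraMap_eq_of_isIntegral_of_mul_eq [IsDomain O] [IsIntegrallyClosed O]
    [FaithfulSMul O E] {x : E} (hx : IsIntegral O x) {a b : O} (hb : algebraMap O E b ≠ 0)
    (h : x * algebraMap O E b = algebraMap O E a) : ∃ o, algebraMap O E o = x := by
  let _ : Algebra (FractionRing O) E := FractionRing.liftAlgebra O E
  have : IsScalarTower O (FractionRing O) E := FractionRing.isScalarTower_liftAlgebra O E
  have hval : algebraMap (FractionRing O) E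
      (algebraMap O (FractionRing O) a / algebraMap O (FractionRing O) b) = x := by
    rw [map_div₀, ← IsScalarTower.algebraMap_apply, ← IsScalarTower.algebraMap_apply, ← h,
      mul_div_cancel_right₀ _ hb]
  rw [← hval, isIntegral_algebraMap_iff (algebraMap (FractionRing O) E).injective] at hx
  obtain ⟨o, ho⟩ := IsIntegrallyClosed.isIntegral_iff.1 hx
  exact ⟨o, by rw [← hval, ← ho, ← IsScalarTower.algebraMap_apply]⟩

variable [IsDomain O] [IsDomain B]

theorem isLocalHom_algebraMap_integralClosure (h : IsPRadical (algebraMap O B) p) :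
    IsLocalHom (algebraMap O (integralClosure B E)) := by
  have := faithfulSMul_of_isPRadical h
  have := isIntegral_of_isPRadical h
  have := FaithfulSMul.trans O B (integralClosure B E)
  have : Algebra.IsIntegral O (integralClosure B E) := Algebra.IsIntegral.trans B
  infer_instance

theorem isPRadical_algebraMap_integralClosure [IsIntegrallyClosed O]
    (h : IsPRadical (algebraMap O B) p) :
    IsPRadical (algebraMap O (integralClosure B E)) p := by
  have := faithfulSMul_of_isPRadical h
  have := isIntegral_of_isPRadical h
  have := FaithfulSMul.trans O B E
  have := FaithfulSMul.trans O B (integralClosure B E)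
  refine isPRadical_of_injective (FaithfulSMul.algebraMap_injective O _) fun x => ?_
  obtain ⟨n, a, b, hb, hab⟩ := exists_pow_mul_algebraMap_eq h (x : E)
  obtain ⟨o, ho⟩ := exists_algebraMap_eq_of_isIntegral_of_mul_eq
    ((isIntegral_trans (R := O) (x : E) x.2).pow _) hb hab
  exact ⟨n, o, Subtype.ext ho⟩

theorem valuationRing_integralClosure_of_isPRadical [ValuationRing O]
    (h : IsPRadical (algebraMap O B) p) : ValuationRing (integralClosure B E) := by
  have hint {x : E} {n : ℕ} {c : O} (hx : x ^ p ^ n = algebraMap O E c) : IsIntegral B x := by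
    refine IsIntegral.of_pow (pow_pos hp.out.pos n) ?_
    rw [hx, IsScalarTower.algebraMap_apply O B E]
    exact isIntegral_algebraMap
  refine (ValuationRing.iff_isInteger_or_isInteger _ E).2 fun x => ?_
  obtain ⟨n, a, b, hb, hab⟩ := exists_pow_mul_algebraMap_eq h x
  rcases ValuationRing.dvd_total b a with ⟨c, rfl⟩ | ⟨c, rfl⟩
  · rw [map_mul, mul_comm] at hab
    exact Or.inl ⟨⟨x, hint (mul_left_cancel₀ hb hab)⟩, rfl⟩
  · rw [map_mul, mul_left_comm] at hab
    rw [map_mul] at hb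
    have hc : x ^ p ^ n * algebraMap O E c = 1 :=
      mul_left_cancel₀ (left_ne_zero_of_mul hb) (hab.trans (mul_one _).symm)
    refine Or.inr ⟨⟨x⁻¹, hint (n := n) (c := c) ?_⟩, rfl⟩
    rw [inv_pow]
    exact inv_eq_of_mul_eq_one_right hc

end PRadical

section FractionRing

variable {A B E : Type*} [CommRing A] [CommRing B] [IsDomain B] [Algebra A B] [Field E]
  [Algebra B E] [IsFractionRing B E]

theorem isFractionRing_subalgebra_of_forall_exists_mul_mem {D : Subalgebra A B}
    (hD : ∀ b, ∃ m ∈ D, m ≠ 0 ∧ m * b ∈ D) : IsFractionRing D E := by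
  have : FaithfulSMul D E := (faithfulSMul_iff_algebraMap_injective D E).2 fun a b hab =>
    Subtype.ext (IsFractionRing.injective B E hab)
  refine IsFractionRing.of_field D E fun x => ?_
  obtain ⟨a, b, hb, rfl⟩ := IsFractionRing.div_surjective (A := B) x
  obtain ⟨m, hmD, hm, hma⟩ := hD a
  obtain ⟨k, hkD, hk, hkb⟩ := hD b
  have hne {c : B} (hc : c ≠ 0) : algebraMap B E c ≠ 0 :=
    (map_ne_zero_iff _ (IsFractionRing.injective B E)).2 hc
  refine ⟨⟨_, mul_mem hkD hma⟩, ⟨_, mul_mem hmD hkb⟩, ?_⟩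
  change _ = algebraMap B E (k * (m * a)) / algebraMap B E (m * (k * b))
  have hm0 := hne hm
  have hk0 := hne hk
  have hb0 := hne (nonZeroDivisors.ne_zero hb)
  simp only [map_mul]
  field_simp

theorem exists_ne_zero_forall_mem_exists_algebraMap_eq_mul [Algebra A E]
    [IsScalarTower A B E] {N : Submodule A E} (hN : N.FG) :
    ∃ s : B, s ≠ 0 ∧ ∀ x ∈ N, ∃ b, algebraMap B E b = algebraMap B E s * x := by
  obtain ⟨S, rfl⟩ := hN
  obtain ⟨s, hs, h⟩ := FractionalIdeal.isFractional_of_fg (S := nonZeroDivisors B)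
    (Submodule.fg_span (R := B) S.finite_toSet : (Submodule.span B (S : Set E)).FG)
  refine ⟨s, nonZeroDivisors.ne_zero hs, fun x hx => ?_⟩
  obtain ⟨b, hb⟩ := h x (Submodule.span_subset_span A B _ hx)
  exact ⟨b, hb.trans (Algebra.smul_def s x)⟩

end FractionRing

theorem isNoetherianRing_of_forall_exists_isUnit_mul_eq {A R : Type*} [CommRing A] [CommRing R]
    [IsNoetherianRing A] (φ : A →+* R) (h : ∀ x, ∃ u, IsUnit u ∧ ∃ a, φ a = u * x) :
    IsNoetherianRing R := by
  refine (isNoetherianRing_iff_ideal_fg R).2 fun I => ?_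
  have hI : (I.comap φ).map φ = I := by
    refine le_antisymm Ideal.map_comap_le fun x hx => ?_
    obtain ⟨u, hu, a, ha⟩ := h x
    rw [← Ideal.unit_mul_mem_iff_mem _ hu, ← ha]
    refine Ideal.mem_map_of_mem φ ?_
    rw [Ideal.mem_comap, ha]
    exact Ideal.mul_mem_left _ _ hx
  rw [← hI]
  exact Ideal.FG.map (IsNoetherian.noetherian _) φ

section GeometricModel

open Polynomial IsDiscreteValuationRing
open IsLocalRing (ResidueField)

theorem injective_of_map_X_ne_zero_of_not_isUnit {L B : Type*} [Field L] [CommRing B] [IsDomain B]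
    {f : L[X] →+* B} (h0 : f X ≠ 0) (hu : ¬ IsUnit (f X)) : Function.Injective f := by
  rw [RingHom.injective_iff_ker_eq_bot]
  by_contra hne
  have hmax := IsPrime.to_maximal_ideal (hpi := RingHom.ker_isPrime f) hne
  obtain ⟨g, i, hi, hg⟩ := hmax.exists_inv (x := X) h0
  refine hu (IsUnit.of_mul_eq_one_right (f g) ?_)
  rw [← map_mul, ← map_one f, ← hg, map_add, hi, add_zero]

theorem algebraMap_surjective_of_forall_exists_isIntegral_mul {L κ : Type*} [Field L]
    [IsAlgClosed L] [Field κ] [Algebra L κ] [Algebra L[X] κ] [IsScalarTower L L[X] κ]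
    (hX : algebraMap L[X] κ X = 0)
    (h : ∀ a : κ, ∃ m ≠ 0, IsIntegral L[X] m ∧ IsIntegral L[X] (m * a)) :
    Function.Surjective (algebraMap L κ) := by
  have hfac : algebraMap L[X] κ = (algebraMap L κ).comp (evalRingHom 0) := by
    refine Polynomial.ringHom_ext (fun a => ?_) (by simp [hX])
    rw [RingHom.comp_apply, coe_evalRingHom, eval_C, IsScalarTower.algebraMap_apply L L[X] κ]
    rfl
  have hint {a : κ} (ha : IsIntegral L[X] a) : IsIntegral L a :=
    RingHom.IsIntegralElem.of_comp (f := evalRingHom (0 : L)) (hfac ▸ ha)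
  have : Algebra.IsIntegral L κ := ⟨fun a => by
    obtain ⟨m, hm0, hm, hma⟩ := h a
    rw [← inv_mul_cancel_left₀ hm0 a]
    exact (hint hm).inv.mul (hint hma)⟩
  exact IsAlgClosed.algebraMap_bijective_of_isIntegral.2

/-- Finiteness data for a purely inseparable extension `B` of a local ring `O` of a curve:
`B` is a localization of its subring `D` at elements of `O`, and `D` is finite over `L[y]`, where
`y` is a nonzero nonunit of `O`. It is used for `B` the base change of `O` to a perfect field `L`,
`D` the base change of a coordinate ring and `L[y]` a Noether normalization. -/
structure IsGeometricModel (p : ℕ) {L O B : Type*} [Field L] [CommRing O] [CommRing B]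
    [Algebra L[X] B] [Algebra O B] (y : O) (D : Subalgebra L[X] B) : Prop where
  isPRadical : IsPRadical (algebraMap O B) p
  algebraMap_X : algebraMap L[X] B X = algebraMap O B y
  ne_zero : y ≠ 0
  not_isUnit : ¬ IsUnit y
  finite : Module.Finite L[X] D
  exists_mul_mem : ∀ b : B, ∃ m : O, IsUnit m ∧ algebraMap O B m ∈ D ∧ algebraMap O B m * b ∈ D

namespace IsGeometricModel

variable {p : ℕ} {L O B : Type*} [Field L] [CommRing O] [CommRing B] [Algebra L[X] B] [Algebra O B]
  {y : O} {D : Subalgebra L[X] B}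

theorem isIntegral_of_mem {b : B} (h : IsGeometricModel p y D) (hb : b ∈ D) :
    IsIntegral L[X] b :=
  have := h.finite
  (Algebra.IsIntegral.isIntegral (R := L[X]) (⟨b, hb⟩ : D)).map D.val

variable [hp : Fact p.Prime] [IsDomain O] [IsDomain B]

theorem algebraMap_polynomial_injective (h : IsGeometricModel p y D) :
    Function.Injective (algebraMap L[X] B) := by
  have := faithfulSMul_of_isPRadical h.isPRadical
  have := isIntegral_of_isPRadical h.isPRadical
  refine injective_of_map_X_ne_zero_of_not_isUnit ?_ ?_ <;> rw [h.algebraMap_X]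
  · exact (map_ne_zero_iff _ (FaithfulSMul.algebraMap_injective O B)).2 h.ne_zero
  · exact fun hu => h.not_isUnit (isUnit_of_map_unit (algebraMap O B) y hu)

theorem charP [CharP L p] (h : IsGeometricModel p y D) : CharP B p :=
  charP_of_injective_ringHom (f := (algebraMap L[X] B).comp (C : L →+* L[X]))
    (h.algebraMap_polynomial_injective.comp C_injective) p

theorem not_isUnit_algebraMap_integralClosure (h : IsGeometricModel p y D) (E : Type*) [Field E]
    [Algebra B E] [IsFractionRing B E] [Algebra O E] [IsScalarTower O B E] :
    ¬ IsUnit (algebraMap O (integralClosure B E) y) :=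
  have := isLocalHom_algebraMap_integralClosure (E := E) h.isPRadical
  fun hu => h.not_isUnit (isUnit_of_map_unit _ y hu)

variable (E : Type*) [Field E] [Algebra B E] [IsFractionRing B E] [Algebra L[X] E]
  [IsScalarTower L[X] B E]

theorem faithfulSMul (h : IsGeometricModel p y D) : FaithfulSMul L[X] E :=
  have : FaithfulSMul L[X] B :=
    (faithfulSMul_iff_algebraMap_injective _ _).2 h.algebraMap_polynomial_injective
  FaithfulSMul.trans L[X] B E

theorem finiteDimensional (h : IsGeometricModel p y D) [Algebra (FractionRing L[X]) E]
    [IsScalarTower L[X] (FractionRing L[X]) E] :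
    FiniteDimensional (FractionRing L[X]) E := by
  have := h.finite
  have := faithfulSMul_of_isPRadical h.isPRadical
  have : IsFractionRing D E := by
    refine isFractionRing_subalgebra_of_forall_exists_mul_mem fun b => ?_
    obtain ⟨m, hm, hmD, hmb⟩ := h.exists_mul_mem b
    exact ⟨_, hmD, (hm.map (algebraMap O B)).ne_zero, hmb⟩
  have : FaithfulSMul L[X] D := (faithfulSMul_iff_algebraMap_injective _ _).2 fun a b hab =>
    h.algebraMap_polynomial_injective (congrArg Subtype.val hab)
  exact Module.Finite.of_isLocalization L[X] D (nonZeroDivisors L[X])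

theorem finite_integralClosure [CharP L p] [PerfectRing L p] (h : IsGeometricModel p y D) :
    Module.Finite L[X] (integralClosure L[X] E) := by
  have := h.faithfulSMul E
  let _ : Algebra (FractionRing L[X]) E := FractionRing.liftAlgebra L[X] E
  have : IsScalarTower L[X] (FractionRing L[X]) E := FractionRing.isScalarTower_liftAlgebra L[X] E
  have := h.finiteDimensional E
  exact finite_integralClosure_of_finite_frobenius (FractionRing L[X])
    (hasFrobeniusExpansion_X (p := p) L).finite_frobenius

theorem hasFrobeniusExpansion [CharP L p] [PerfectRing L p] (h : IsGeometricModel p y D)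
    [IsDiscreteValuationRing (integralClosure B E)] {t : integralClosure B E}
    (ht : Irreducible t) : HasFrobeniusExpansion p t := by
  have := h.charP
  have : CharP E p := charP_of_injective_algebraMap (IsFractionRing.injective B E) p
  have : CharP (integralClosure B E) p :=
    charP_of_injective_algebraMap (FaithfulSMul.algebraMap_injective B _) p
  have := h.faithfulSMul E
  let _ : Algebra (FractionRing L[X]) E := FractionRing.liftAlgebra L[X] E
  have : IsScalarTower L[X] (FractionRing L[X]) E := FractionRing.isScalarTower_liftAlgebra L[X] E
  have := h.finiteDimensional E
  have hX : HasFrobeniusExpansion p (algebraMap L[X] (FractionRing L[X]) X) :=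
    (hasFrobeniusExpansion_X L).algebraMap_of_isFractionRing
  have ht1 : addVal (integralClosure B E) t = (1 : ℕ) := by simpa using addVal_uniformizer ht
  have hexp : HasFrobeniusExpansion p (algebraMap (integralClosure B E) E t) :=
    hX.of_finiteDimensional fun a ha i hi => eq_zero_of_sum_eq_zero_of_isFractionRing
      (fun a ha i hi =>
        eq_zero_of_sum_pow_mul_pow_eq_zero p ht1 hp.out.not_dvd_one ha hi) ha hi
  exact hexp.of_algebraMap_of_isFractionRing ht

variable [Algebra O E] [IsScalarTower O B E]

theorem exists_isIntegral_mul [IsIntegrallyClosed O] (h : IsGeometricModel p y D)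
    (x : integralClosure B E) : ∃ m : O, IsUnit m ∧ algebraMap O B m ∈ D ∧
      IsIntegral L[X] (algebraMap O (integralClosure B E) m * x) := by
  obtain ⟨n, o, ho⟩ := (isPRadical_algebraMap_integralClosure (E := E) h.isPRadical).pow_mem' x
  obtain ⟨m, hm, hmD, hmo⟩ := h.exists_mul_mem (algebraMap O B o)
  refine ⟨m, hm, hmD, IsIntegral.of_pow (pow_pos hp.out.pos n) ?_⟩
  have hpow : (algebraMap O (integralClosure B E) m * x) ^ p ^ n =
      algebraMap B (integralClosure B E)
        (algebraMap O B m ^ (p ^ n - 1) * (algebraMap O B m * algebraMap O B o)) := by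
    rw [mul_pow, ← ho, ← mul_assoc, pow_sub_one_mul (pow_pos hp.out.pos n).ne', map_mul, map_pow,
      ← IsScalarTower.algebraMap_apply, ← IsScalarTower.algebraMap_apply]
  rw [hpow]
  exact (h.isIntegral_of_mem (mul_mem (pow_mem hmD _) hmo)).algebraMap

section PerfectField

variable [CharP L p] [PerfectRing L p]

theorem exists_conductor [IsIntegrallyClosed O] (h : IsGeometricModel p y D) :
    ∃ s : integralClosure B E, s ≠ 0 ∧
      ∀ x : integralClosure B E, s * x ∈ (algebraMap B (integralClosure B E)).range := by
  have hfg : (integralClosure L[X] E).toSubmodule.FG :=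
    Module.Finite.iff_fg.1 (h.finite_integralClosure E)
  obtain ⟨s, hs, hsN⟩ := exists_ne_zero_forall_mem_exists_algebraMap_eq_mul (B := B) hfg
  refine ⟨algebraMap B _ s, (map_ne_zero_iff _ (FaithfulSMul.algebraMap_injective B _)).2 hs,
    fun x => ?_⟩
  obtain ⟨m, hm, -, hint⟩ := h.exists_isIntegral_mul E x
  obtain ⟨b, hb⟩ := hsN _ (hint.map (IsScalarTower.toAlgHom L[X] (integralClosure B E) E))
  obtain ⟨u, hu⟩ := hm.exists_left_inv
  have hb' : algebraMap B (integralClosure B E) b =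
      algebraMap B _ s * (algebraMap O (integralClosure B E) m * x) := Subtype.ext hb
  refine ⟨algebraMap O B u * b, ?_⟩
  rw [map_mul, hb', ← IsScalarTower.algebraMap_apply, mul_left_comm, ← mul_assoc _ _ x, ← map_mul,
    hu, map_one, one_mul]

theorem isNoetherianRing [IsIntegrallyClosed O] (h : IsGeometricModel p y D) :
    IsNoetherianRing (integralClosure B E) := by
  have := h.finite_integralClosure E
  have : IsNoetherianRing (integralClosure L[X] E) :=
    isNoetherian_of_tower L[X] (isNoetherian_of_isNoetherianRing_of_finite _ _)
  let φ : integralClosure L[X] E →+* integralClosure B E :=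
    (algebraMap (integralClosure L[X] E) E).codRestrict (integralClosure B E).toSubring
      fun r => IsIntegral.tower_top r.2
  refine isNoetherianRing_of_forall_exists_isUnit_mul_eq φ fun x => ?_
  obtain ⟨m, hm, -, hint⟩ := h.exists_isIntegral_mul E x
  exact ⟨_, hm.map (algebraMap O (integralClosure B E)),
    ⟨_, hint.map (IsScalarTower.toAlgHom L[X] (integralClosure B E) E)⟩, rfl⟩

theorem isDiscreteValuationRing_integralClosure [IsDiscreteValuationRing O]
    (h : IsGeometricModel p y D) : IsDiscreteValuationRing (integralClosure B E) := by
  have := valuationRing_integralClosure_of_isPRadical (E := E) h.isPRadical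
  have := h.isNoetherianRing E
  have hy : algebraMap O (integralClosure B E) y ≠ 0 := by
    have := faithfulSMul_of_isPRadical h.isPRadical
    have := FaithfulSMul.trans O B (integralClosure B E)
    exact (map_ne_zero_iff _ (FaithfulSMul.algebraMap_injective O _)).2 h.ne_zero
  have hfield : ¬ IsField (integralClosure B E) := fun hf => by
    obtain ⟨b, hb⟩ := hf.mul_inv_cancel hy
    exact h.not_isUnit_algebraMap_integralClosure E (IsUnit.of_mul_eq_one _ hb)
  exact ((IsDiscreteValuationRing.TFAE (integralClosure B E) hfield).out 0 1).2 ‹_›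

end PerfectField

theorem algebraMap_residueField_surjective [IsAlgClosed L] [Algebra L B] [IsScalarTower L L[X] B]
    [Algebra L E] [IsScalarTower L B E] [IsIntegrallyClosed O] (h : IsGeometricModel p y D)
    [IsLocalRing (integralClosure B E)] :
    Function.Surjective (algebraMap L (ResidueField (integralClosure B E))) := by
  have hX : algebraMap L[X] (integralClosure B E) X = algebraMap O (integralClosure B E) y := by
    rw [IsScalarTower.algebraMap_apply L[X] B, h.algebraMap_X, ← IsScalarTower.algebraMap_apply]
  have : IsScalarTower L L[X] (integralClosure B E) := IsScalarTower.to₁₂₄ L L[X] B _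
  have : IsScalarTower L L[X] (ResidueField (integralClosure B E)) :=
    IsScalarTower.to₁₂₄ L L[X] (integralClosure B E) _
  refine algebraMap_surjective_of_forall_exists_isIntegral_mul ?_ fun a => ?_
  · rw [IsScalarTower.algebraMap_apply L[X] (integralClosure B E), hX]
    exact (IsLocalRing.residue_eq_zero_iff _).2 (h.not_isUnit_algebraMap_integralClosure E)
  · obtain ⟨x, rfl⟩ := IsLocalRing.residue_surjective a
    obtain ⟨m, hm, hmD, hmx⟩ := h.exists_isIntegral_mul E x
    let ρ := IsScalarTower.toAlgHom L[X] (integralClosure B E) (ResidueField (integralClosure B E))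
    have hmD' : IsIntegral L[X] (algebraMap O (integralClosure B E) m) := by
      rw [IsScalarTower.algebraMap_apply O B]
      exact (h.isIntegral_of_mem hmD).algebraMap
    exact ⟨ρ (algebraMap O _ m), ((hm.map _).map ρ).ne_zero, hmD'.map ρ,
      map_mul ρ _ x ▸ hmx.map ρ⟩

end IsGeometricModel

end GeometricModel

/-! ### Subrings containing the `p`-th powers -/

section Normalization

variable {B B₁ : Type*} [CommRing B] [CommRing B₁]

theorem exists_ringHom_map_eq_pow {p : ℕ} [hp : Fact p.Prime] [CharP B p] {η : B₁ →+* B}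
    (hη : Function.Injective η) (hpow : ∀ b, ∃ b₁, η b₁ = b ^ p) :
    ∃ φ : B →+* B₁, ∀ b, η (φ b) = b ^ p := by
  choose φ hφ using hpow
  exact ⟨{ toFun := φ
           map_one' := hη (by rw [hφ, one_pow, map_one])
           map_zero' := hη (by rw [hφ, zero_pow hp.out.ne_zero, map_zero])
           map_mul' := fun x y => hη (by simp only [map_mul, hφ, mul_pow])
           map_add' := fun x y => hη (by simp only [map_add, hφ, add_pow_char]) }, hφ⟩

variable [IsDomain B₁]
variable (E E₁ : Type*) [Field E] [Field E₁] [Algebra B E] [IsFractionRing B E] [Algebra B₁ E₁]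
  [IsFractionRing B₁ E₁]

theorem exists_ringEquiv_integralClosure_of_isIntegral {φ : B →+* B₁} (hφ : Function.Injective φ)
    (hint : φ.IsIntegral) (hfrac : ∀ b₁, ∃ c d, d ≠ 0 ∧ b₁ * φ d = φ c) :
    ∃ σ : integralClosure B E ≃+* integralClosure B₁ E₁,
      ∀ b, σ (algebraMap B _ b) = algebraMap B₁ _ (φ b) := by
  let ψ : E →+* E₁ := IsFractionRing.map hφ
  have hψ (b : B) : ψ (algebraMap B E b) = algebraMap B₁ E₁ (φ b) := IsLocalization.map_eq _ b
  have hcomp : ψ.comp (algebraMap B E) = (algebraMap B₁ E₁).comp φ := RingHom.ext hψ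
  let σ : integralClosure B E →+* integralClosure B₁ E₁ :=
    (ψ.comp (integralClosure B E).val.toRingHom).codRestrict (integralClosure B₁ E₁).toSubring
      fun x => x.2.map_of_comp_eq φ ψ hcomp.symm
  have hmem (b₁ : B₁) : algebraMap B₁ E₁ b₁ ∈ ψ.fieldRange := by
    obtain ⟨c, d, hd, hcd⟩ := hfrac b₁
    refine ⟨algebraMap B E c / algebraMap B E d, ?_⟩
    have hd0 : algebraMap B₁ E₁ (φ d) ≠ 0 :=
      (map_ne_zero_iff _ (IsFractionRing.injective B₁ E₁)).2 ((map_ne_zero_iff φ hφ).2 hd)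
    rw [map_div₀, hψ, hψ, ← hcd, map_mul, mul_div_cancel_right₀ _ hd0]
  have hψsurj (x₁ : E₁) : x₁ ∈ ψ.fieldRange := by
    obtain ⟨b, d, -, rfl⟩ := IsFractionRing.div_surjective (A := B₁) x₁
    exact div_mem (hmem b) (hmem d)
  refine ⟨RingEquiv.ofBijective σ ⟨fun x y hxy => ?_, fun ⟨x₁, hx₁⟩ => ?_⟩,
    fun b => Subtype.ext (hψ b)⟩
  · exact Subtype.ext (ψ.injective (congrArg Subtype.val hxy))
  · obtain ⟨x, rfl⟩ := hψsurj x₁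
    algebraize [φ, (algebraMap B₁ E₁).comp φ]
    obtain ⟨f, hf, hfx⟩ : (ψ.comp (algebraMap B E)).IsIntegralElem (ψ x) :=
      hcomp ▸ isIntegral_trans (R := B) (ψ x) hx₁
    refine ⟨⟨x, f, hf, ψ.injective ?_⟩, rfl⟩
    rw [Polynomial.hom_eval₂, hfx, map_zero]

variable [IsDomain B] {p : ℕ} [hp : Fact p.Prime]

theorem exists_ringEquiv_integralClosure_of_frobenius [CharP B p] {η : B₁ →+* B}
    (hη : Function.Injective η) (hpow : ∀ b, ∃ b₁, η b₁ = b ^ p)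
    (hfrac : ∀ b₁, ∃ c d, d ≠ 0 ∧ η b₁ * d ^ p = c ^ p) :
    ∃ σ : integralClosure B E ≃+* integralClosure B₁ E₁,
      (∀ b b₁, η b₁ = b ^ p → σ (algebraMap B _ b) = algebraMap B₁ _ b₁) ∧
      ∀ x b₁, σ x = algebraMap B₁ _ b₁ → algebraMap B _ (η b₁) = x ^ p := by
  obtain ⟨φ, hφ⟩ := exists_ringHom_map_eq_pow (p := p) hη hpow
  have hφinj : Function.Injective φ := fun b c hbc =>
    frobenius_inj B p (by simp only [frobenius_def, ← hφ, hbc])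
  have hint : φ.IsIntegral := fun b₁ =>
    ⟨Polynomial.X ^ p - Polynomial.C (η b₁), Polynomial.monic_X_pow_sub_C _ hp.out.ne_zero,
      hη (by simp [hφ])⟩
  obtain ⟨σ, hσ⟩ := exists_ringEquiv_integralClosure_of_isIntegral E E₁ hφinj hint fun b₁ => by
    obtain ⟨c, d, hd, hcd⟩ := hfrac b₁
    exact ⟨c, d, hd, hη (by rw [map_mul, hφ, hφ, hcd])⟩
  refine ⟨σ, fun b b₁ hb => by rw [hσ, hη ((hφ b).trans hb.symm)], fun x b₁ hx => ?_⟩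
  obtain ⟨c, d, hd, hcd⟩ := IsFractionRing.div_surjective (A := B) (x : E)
  have hd0 : algebraMap B E d ≠ 0 := IsFractionRing.to_map_ne_zero_of_mem_nonZeroDivisors hd
  have hxd : x * algebraMap B _ d = algebraMap B _ c :=
    Subtype.ext ((div_eq_iff hd0).1 hcd).symm
  have hb₁ : b₁ * φ d = φ c := by
    apply FaithfulSMul.algebraMap_injective B₁ (integralClosure B₁ E₁)
    rw [map_mul, ← hx, ← hσ, ← hσ, ← map_mul, hxd]
  refine mul_right_cancel₀ (pow_ne_zero p (fun h => hd0 (congrArg Subtype.val h)) :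
    algebraMap B (integralClosure B E) d ^ p ≠ 0) ?_
  rw [← mul_pow, hxd, ← map_pow, ← map_pow, ← map_mul, ← hφ, ← hφ, ← map_mul, hb₁]

end Normalization

theorem HasFrobeniusExpansion.map {p : ℕ} {R R₁ : Type*} [CommRing R] [CommRing R₁] {t : R}
    (h : HasFrobeniusExpansion p t) (σ : R ≃+* R₁) : HasFrobeniusExpansion p (σ t) := by
  intro x₁
  obtain ⟨a, ha⟩ := h (σ.symm x₁)
  refine ⟨fun i => σ (a i), ?_⟩
  simpa only [RingEquiv.apply_symm_apply, map_sum, map_mul, map_pow] using congrArg σ ha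

section FrobeniusSubring

open IsDiscreteValuationRing
open IsLocalRing (ResidueField residue)

/-- A ring homomorphism of domains is saturated if every element of the target that is a fraction
of elements of the image lies in the image. -/
def IsSaturated {O₁ O : Type*} [CommRing O₁] [CommRing O] (j : O₁ →+* O) : Prop :=
  ∀ (c d : O₁) (x : O), c ≠ 0 → j c * x = j d → ∃ e, x = j e

variable {O₁ O : Type*} [CommRing O₁] [CommRing O] {j : O₁ →+* O}

theorem IsSaturated.isLocalHom [Nontrivial O] (hsat : IsSaturated j)
    (hj : Function.Injective j) : IsLocalHom j where
  map_nonunit c hc := by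
    obtain ⟨u, hu⟩ := hc.exists_right_inv
    have hc0 : c ≠ 0 := by
      rintro rfl
      simp at hc
    obtain ⟨e, rfl⟩ := hsat c 1 u hc0 (by rw [hu, map_one])
    exact IsUnit.of_mul_eq_one e (hj (by rw [map_mul, hu, map_one]))

theorem exists_eq_add_pow_mul {c : O₁} (h : ∀ x, ∃ d q, x = j d + j c * q) (n : ℕ) (x : O) :
    ∃ d q, x = j d + j c ^ n * q := by
  induction n generalizing x with
  | zero => exact ⟨0, x, by simp⟩
  | succ n ih =>
    obtain ⟨d, q, rfl⟩ := ih x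
    obtain ⟨e, r, rfl⟩ := h q
    exact ⟨d + c ^ n * e, r, by simp only [map_add, map_mul, map_pow]; ring⟩

theorem exists_eq_sum_mul_pow_of_dvd_imp_dvd [IsDomain O] {n : ℕ} (hj : Function.Injective j)
    (hsat : IsSaturated j)
    (hrank : ∀ z : ℕ → O, ∃ c : ℕ → O₁, (∃ i ≤ n, c i ≠ 0) ∧
      ∑ i ∈ Finset.range (n + 1), j (c i) * z i = 0)
    {z : O} (hz : ∀ (e : O₁) (c : ℕ → O₁), j e ∣ ∑ i ∈ Finset.range n, j (c i) * z ^ i →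
      ∀ i < n, j e ∣ j (c i)) (x : O) :
    ∃ c : ℕ → O₁, x = ∑ i ∈ Finset.range n, j (c i) * z ^ i := by
  obtain ⟨c, ⟨i, hi, hci⟩, hc⟩ := hrank fun i => if i = n then x else z ^ i
  rw [Finset.sum_range_succ, if_pos rfl, Finset.sum_congr rfl fun i hi => by
    rw [if_neg (Finset.mem_range.1 hi).ne]] at hc
  have he0 : c n ≠ 0 := by
    intro h0
    have hdvd := hz 0 c (by simpa only [h0, map_zero, zero_mul, add_zero, zero_dvd_iff] using hc)
    rcases hi.lt_or_eq with hi | rfl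
    · have := hdvd i hi
      rw [map_zero, zero_dvd_iff] at this
      exact hci (hj (this.trans (map_zero j).symm))
    · exact hci h0
  have hdvd := hz (c n) c ⟨-x, by linear_combination hc⟩
  have hex (i : ℕ) : ∃ d, i < n → j (c i) = j (c n) * j d := by
    by_cases hi : i < n
    · obtain ⟨y, hy⟩ := hdvd i hi
      obtain ⟨d, rfl⟩ := hsat (c n) (c i) y he0 hy.symm
      exact ⟨d, fun _ => hy⟩
    · exact ⟨0, fun h => absurd h hi⟩
  choose d hd using hex
  refine ⟨fun i => -d i, mul_left_cancel₀ ((map_ne_zero_iff j hj).2 he0) ?_⟩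
  rw [eq_neg_of_add_eq_zero_right hc, Finset.mul_sum, ← Finset.sum_neg_distrib]
  exact Finset.sum_congr rfl fun i hi => by
    rw [hd i (Finset.mem_range.1 hi), map_neg]; ring

variable {p : ℕ} [hp : Fact p.Prime]

open Polynomial in
theorem eq_zero_of_sum_algebraMap_mul_pow_eq_zero {k κ : Type*} [Field k] [Field κ] [Algebra k κ]
    [CharP κ p] {z : κ} (hz : z ∉ (algebraMap k κ).range) (hzp : z ^ p ∈ (algebraMap k κ).range)
    {c : ℕ → k} (hc : ∑ i ∈ Finset.range p, algebraMap k κ (c i) * z ^ i = 0) {i : ℕ}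
    (hi : i < p) : c i = 0 := by
  obtain ⟨a, ha⟩ := hzp
  have hirr : Irreducible (X ^ p - C a) := by
    refine X_pow_sub_C_irreducible_of_prime hp.out fun b hb => hz ⟨b, frobenius_inj κ p ?_⟩
    rw [frobenius_def, frobenius_def, ← map_pow, hb, ha]
  have hdeg : (minpoly k z).natDegree = p := by
    rw [← minpoly.eq_of_irreducible_of_monic hirr (by simp [ha])
      (monic_X_pow_sub_C a hp.out.ne_zero), natDegree_X_pow_sub_C]
  have hli := linearIndependent_pow (K := k) z
  rw [hdeg, Fintype.linearIndependent_iff] at hli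
  rw [Finset.sum_range] at hc
  exact hli (fun i => c i) (by simpa only [Algebra.smul_def] using hc) ⟨i, hi⟩

variable [IsDomain O] [IsDiscreteValuationRing O]

theorem exists_irreducible_map_of_not_dvd_addVal (hsat : IsSaturated j)
    (hpow : ∀ x, ∃ c, j c = x ^ p) {c : O₁} {n : ℕ} (hc : addVal O (j c) = n) (hn : ¬ p ∣ n) :
    ∃ π, Irreducible (j π) := by
  obtain ⟨ϖ, hϖ⟩ := exists_irreducible O
  obtain ⟨k, -, hk⟩ := Nat.exists_mul_mod_eq_one_of_coprime
    ((Nat.Prime.coprime_iff_not_dvd hp.out).2 hn).symm hp.out.one_lt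
  obtain ⟨d, hd⟩ := hpow (ϖ ^ (n * k / p))
  have hvd : addVal O (j d) = (p * (n * k / p) : ℕ) := by
    rw [hd, ← pow_mul, hϖ.addVal_pow, mul_comm]
  have hvc : addVal O (j (c ^ k)) = (p * (n * k / p) : ℕ) + 1 := by
    rw [map_pow, addVal_pow, hc, nsmul_eq_mul, mul_comm]
    exact_mod_cast (hk ▸ Nat.div_add_mod (n * k) p).symm
  obtain ⟨x, hx⟩ : j d ∣ j (c ^ k) := by
    rw [← addVal_le_iff_dvd, hvd, hvc]
    exact le_self_add
  have hd0 : d ≠ 0 := fun h => ne_zero_of_addVal_eq_natCast hvd (by rw [h, map_zero])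
  obtain ⟨π, rfl⟩ := hsat d (c ^ k) x hd0 hx.symm
  rw [hx, addVal_mul, hvd] at hvc
  have hvπ := ENat.add_right_injective_of_ne_top (ENat.natCast_ne_top _) hvc
  exact ⟨π, ((addVal_eq_iff_associated _ _).1
    (hvπ.trans (addVal_uniformizer hϖ).symm)).irreducible_iff.2 hϖ⟩

theorem dvd_of_dvd_sum_mul_pow_of_dvd_addVal
    (hI : ∀ (c : O₁) (n : ℕ), addVal O (j c) = n → p ∣ n) {ϖ : O} (hϖ : Irreducible ϖ)
    (e : O₁) (c : ℕ → O₁) (h : j e ∣ ∑ i ∈ Finset.range p, j (c i) * ϖ ^ i) {i : ℕ}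
    (hi : i < p) : j e ∣ j (c i) := by
  rw [← addVal_le_iff_dvd, addVal_sum_mul_pow p (m := 1) (by simpa using addVal_uniformizer hϖ)
    (by simpa using hp.out.ne_one) (fun i => hI (c i)) subset_rfl] at h
  have hle := h.trans (Finset.inf_le (Finset.mem_range.2 hi))
  rw [mul_one] at hle
  rcases eq_or_ne (j (c i)) 0 with hci | hci
  · rw [hci]
    exact dvd_zero _
  obtain ⟨l, hl⟩ := exists_addVal_eq_natCast hci
  have he : j e ≠ 0 := by
    intro h0
    rw [h0, addVal_zero, hl, top_le_iff] at hle
    exact ENat.natCast_ne_top (l + i) (by exact_mod_cast hle)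
  obtain ⟨k, hk⟩ := exists_addVal_eq_natCast he
  obtain ⟨k', rfl⟩ := hI _ _ hk
  obtain ⟨l', rfl⟩ := hI _ _ hl
  rw [hk, hl] at hle
  rw [← addVal_le_iff_dvd, hk, hl]
  have hlt : p * k' < p * (l' + 1) := by
    have : p * k' ≤ p * l' + i := by exact_mod_cast hle
    rw [mul_add, mul_one]
    omega
  exact_mod_cast Nat.mul_le_mul_left p (Nat.le_of_lt_succ (Nat.lt_of_mul_lt_mul_left hlt))

variable [CharP O p]

theorem isUnit_sum_mul_pow_of_sub_notMem (hj : Function.Injective j) (hsat : IsSaturated j)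
    (hpow : ∀ x, ∃ c, j c = x ^ p) {z : O} (hz : ∀ c, z - j c ∉ IsLocalRing.maximalIdeal O)
    {c : ℕ → O₁} {i : ℕ} (hi : i < p) (hci : IsUnit (c i)) :
    IsUnit (∑ i ∈ Finset.range p, j (c i) * z ^ i) := by
  have := hsat.isLocalHom hj
  have := RingHom.domain_isLocalRing j
  have : CharP (ResidueField O) p := (CharP.charP_iff_prime_eq_zero hp.out).2 <| by
    rw [← map_natCast (residue O), CharP.cast_eq_zero, map_zero]
  let _ : Algebra (ResidueField O₁) (ResidueField O) := (ResidueField.map j).toAlgebra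
  have hmap (d : O₁) : algebraMap (ResidueField O₁) (ResidueField O) (residue O₁ d) =
    residue O (j d) := rfl
  have hz' : residue O z ∉ (algebraMap (ResidueField O₁) (ResidueField O)).range := by
    rintro ⟨a, ha⟩
    obtain ⟨d, rfl⟩ := IsLocalRing.residue_surjective a
    refine hz d ((IsLocalRing.residue_eq_zero_iff _).1 ?_)
    rw [map_sub, ← ha, hmap, sub_self]
  have hzp : residue O z ^ p ∈ (algebraMap (ResidueField O₁) (ResidueField O)).range := by
    obtain ⟨a, ha⟩ := hpow z
    exact ⟨residue O₁ a, by rw [hmap, ha, map_pow]⟩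
  rw [← IsLocalRing.residue_ne_zero_iff_isUnit]
  intro h0
  refine (IsLocalRing.residue_ne_zero_iff_isUnit (c i)).2 hci
    (eq_zero_of_sum_algebraMap_mul_pow_eq_zero hz' hzp (c := fun i => residue O₁ (c i)) ?_ hi)
  simpa only [map_sum, map_mul, map_pow, hmap] using h0

theorem dvd_of_dvd_sum_mul_pow_of_sub_notMem (hj : Function.Injective j) (hsat : IsSaturated j)
    (hpow : ∀ x, ∃ c, j c = x ^ p) {π : O₁} (hπ : Irreducible (j π)) {z : O}
    (hz : ∀ c, z - j c ∉ IsLocalRing.maximalIdeal O) (x : O) (c : ℕ → O₁)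
    (h : x ∣ ∑ i ∈ Finset.range p, j (c i) * z ^ i) {i : ℕ} (hi : i < p) : x ∣ j (c i) := by
  have := hsat.isLocalHom hj
  have hπ0 : π ≠ 0 := by
    rintro rfl
    exact hπ.ne_zero (map_zero j)
  have key (n : ℕ) (c : ℕ → O₁) (h : j π ^ n ∣ ∑ i ∈ Finset.range p, j (c i) * z ^ i) {i : ℕ}
      (hi : i < p) : j π ^ n ∣ j (c i) := by
    induction n generalizing c i with
    | zero => simp
    | succ n ih =>
      have hdvd (i : ℕ) : ∃ d, i < p → j (c i) = j π * j d := by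
        by_cases hi : i < p
        · have hci : ¬ IsUnit (j (c i)) := fun hci => hπ.not_isUnit <| isUnit_of_dvd_unit
            ((dvd_pow_self _ n.succ_ne_zero).trans h)
            (isUnit_sum_mul_pow_of_sub_notMem hj hsat hpow hz hi (isUnit_of_map_unit j _ hci))
          obtain ⟨y, hy⟩ : j π ∣ j (c i) := by
            rwa [← Ideal.mem_span_singleton, ← hπ.maximalIdeal_eq, IsLocalRing.mem_maximalIdeal]
          obtain ⟨d, rfl⟩ := hsat π (c i) y hπ0 hy.symm
          exact ⟨d, fun _ => hy⟩
        · exact ⟨0, fun h => absurd h hi⟩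
      choose d hd using hdvd
      rw [hd i hi, pow_succ']
      refine mul_dvd_mul_left _ (ih d ?_ hi)
      refine (mul_dvd_mul_iff_left hπ.ne_zero).1 ?_
      rw [← pow_succ', Finset.mul_sum]
      convert h using 1
      exact Finset.sum_congr rfl fun i hi => by rw [hd i (Finset.mem_range.1 hi), mul_assoc]
  rw [← addVal_le_iff_dvd, ← ENat.forall_natCast_le_iff_le] at h ⊢
  intro n hn
  have hn := h n hn
  rw [← hπ.addVal_pow, addVal_le_iff_dvd] at hn ⊢
  exact key n c hn hi

theorem exists_forall_exists_eq_sum_mul_pow (hj : Function.Injective j) (hsat : IsSaturated j)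
    (hpow : ∀ x, ∃ c, j c = x ^ p)
    (hrank : ∀ z : ℕ → O, ∃ c : ℕ → O₁, (∃ i ≤ p, c i ≠ 0) ∧
      ∑ i ∈ Finset.range (p + 1), j (c i) * z i = 0)
    (happrox : ∀ c, ¬ IsUnit (j c) → ∃ (n : ℕ) (x : O), ∀ d q, x ≠ j d + j c ^ n * q) :
    ∃ z, ∀ x, ∃ c : ℕ → O₁, x = ∑ i ∈ Finset.range p, j (c i) * z ^ i := by
  by_cases hI : ∀ (c : O₁) (n : ℕ), addVal O (j c) = n → p ∣ n
  · obtain ⟨ϖ, hϖ⟩ := exists_irreducible O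
    exact ⟨ϖ, exists_eq_sum_mul_pow_of_dvd_imp_dvd hj hsat hrank fun e c h i hi =>
      dvd_of_dvd_sum_mul_pow_of_dvd_addVal hI hϖ e c h hi⟩
  push Not at hI
  obtain ⟨c, n, hc, hn⟩ := hI
  obtain ⟨π, hπ⟩ := exists_irreducible_map_of_not_dvd_addVal hsat hpow hc hn
  obtain ⟨z, hz⟩ : ∃ z, ∀ c, z - j c ∉ IsLocalRing.maximalIdeal O := by
    by_contra! hres
    have hadd (y : O) : ∃ d q, y = j d + j π * q := by
      obtain ⟨d, hd⟩ := hres y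
      obtain ⟨q, hq⟩ := Ideal.mem_span_singleton.1 (hπ.maximalIdeal_eq ▸ hd)
      exact ⟨d, q, by rw [← hq, add_sub_cancel]⟩
    obtain ⟨n, x, hx⟩ := happrox π hπ.not_isUnit
    obtain ⟨d, q, hdq⟩ := exists_eq_add_pow_mul hadd n x
    exact hx d q hdq
  exact ⟨z, exists_eq_sum_mul_pow_of_dvd_imp_dvd hj hsat hrank fun e c h i hi =>
    dvd_of_dvd_sum_mul_pow_of_sub_notMem hj hsat hpow hπ hz (j e) c h hi⟩

end FrobeniusSubring

section BaseChange

open Polynomial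

variable {K : Type*} [Field K]

theorem isPRadical_includeRight (p : ℕ) [ExpChar K p] (L : Type*) [Field L] [Algebra K L]
    [IsPurelyInseparable K L] (O : Type*) [CommRing O] [Algebra K O] :
    IsPRadical (Algebra.TensorProduct.includeRight : O →ₐ[K] L ⊗[K] O).toRingHom p := by
  refine isPRadical_of_injective (Algebra.TensorProduct.includeRight_injective
    (algebraMap K L).injective) fun b => ?_
  obtain ⟨n, o, ho⟩ := IsPurelyInseparable.exists_pow_pow_mem_range_tensorProduct_of_expChar p
    (Algebra.TensorProduct.comm K L O b)
  refine ⟨n, o, (Algebra.TensorProduct.comm K L O).injective ?_⟩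
  rw [map_pow, ← ho]
  rfl

theorem finite_aeval_one_tmul (L : Type*) [Field L] [Algebra K L] {A : Type*} [CommRing A]
    [Algebra K A] {φ : K[X] →ₐ[K] A} (hφ : φ.toRingHom.Finite) :
    (aeval (1 ⊗ₜ φ X : L ⊗[K] A) : L[X] →ₐ[L] L ⊗[K] A).toRingHom.Finite := by
  convert! (RingHom.Finite.tensorProductMap (f := AlgHom.id K L) (RingEquiv.refl L).finite hφ).comp
    (polyEquivTensor K L).toRingEquiv.finite using 1
  ext <;> simp

variable {L : Type*} [Field L] [Algebra K L]

theorem exists_mem_one_tmul_mul_mem_range {O A : Type*} [CommRing O] [Algebra K O] [CommRing A]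
    [Algebra K A] [Algebra A O] [IsScalarTower K A O] (M : Submonoid A) [IsLocalization M O]
    (b : L ⊗[K] O) : ∃ m ∈ M, (1 ⊗ₜ algebraMap A O m) * b ∈
      (Algebra.TensorProduct.map (AlgHom.id L L) (IsScalarTower.toAlgHom K A O)).range := by
  have hA (a : A) : (1 ⊗ₜ algebraMap A O a : L ⊗[K] O) ∈
      (Algebra.TensorProduct.map (AlgHom.id L L) (IsScalarTower.toAlgHom K A O)).range :=
    ⟨1 ⊗ₜ a, by simp⟩
  induction b with
  | zero => exact ⟨1, M.one_mem, by rw [mul_zero]; exact zero_mem _⟩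
  | tmul l o =>
    obtain ⟨⟨a, m⟩, ham⟩ := IsLocalization.surj M o
    refine ⟨m, m.2, l ⊗ₜ a, ?_⟩
    simp [Algebra.TensorProduct.tmul_mul_tmul, mul_comm _ o, ham]
  | add x y hx hy =>
    obtain ⟨m, hm, hmx⟩ := hx
    obtain ⟨k, hk, hky⟩ := hy
    refine ⟨k * m, M.mul_mem hk hm, ?_⟩
    have hmul : (1 ⊗ₜ algebraMap A O (k * m) : L ⊗[K] O) * (x + y) =
        1 ⊗ₜ algebraMap A O k * (1 ⊗ₜ algebraMap A O m * x) +
        1 ⊗ₜ algebraMap A O m * (1 ⊗ₜ algebraMap A O k * y) := by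
      rw [map_mul, ← one_mul (1 : L), ← Algebra.TensorProduct.tmul_mul_tmul, one_mul]
      ring
    rw [hmul]
    exact add_mem (mul_mem (hA k) hmx) (mul_mem (hA m) hky)

theorem exists_isGeometricModel (p : ℕ) [ExpChar K p] [IsPurelyInseparable K L] {O A : Type*}
    [CommRing O] [Algebra K O] [CommRing A] [Algebra K A] [Algebra A O] [IsScalarTower K A O]
    (M : Submonoid A) [IsLocalization M O] {φ : K[X] →ₐ[K] A} (hφ : φ.toRingHom.Finite)
    (h0 : algebraMap A O (φ X) ≠ 0) (hu : ¬ IsUnit (algebraMap A O (φ X))) :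
    letI : Algebra O (L ⊗[K] O) := Algebra.TensorProduct.rightAlgebra
    letI : Algebra L[X] (L ⊗[K] O) :=
      (aeval (1 ⊗ₜ algebraMap A O (φ X)) : L[X] →ₐ[L] L ⊗[K] O).toRingHom.toAlgebra
    ∃ D : Subalgebra L[X] (L ⊗[K] O), IsGeometricModel p (algebraMap A O (φ X)) D := by
  let _ : Algebra O (L ⊗[K] O) := Algebra.TensorProduct.rightAlgebra
  let _ : Algebra L[X] (L ⊗[K] O) :=
    (aeval (1 ⊗ₜ algebraMap A O (φ X)) : L[X] →ₐ[L] L ⊗[K] O).toRingHom.toAlgebra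
  let _ : Algebra L[X] (L ⊗[K] A) :=
    (aeval (1 ⊗ₜ φ X) : L[X] →ₐ[L] L ⊗[K] A).toRingHom.toAlgebra
  have hfin : Module.Finite L[X] (L ⊗[K] A) := finite_aeval_one_tmul L hφ
  let g : L ⊗[K] A →ₐ[L] L ⊗[K] O :=
    Algebra.TensorProduct.map (AlgHom.id L L) (IsScalarTower.toAlgHom K A O)
  have hg : g.comp (aeval (1 ⊗ₜ φ X) : L[X] →ₐ[L] L ⊗[K] A) =
      aeval (1 ⊗ₜ algebraMap A O (φ X)) := by
    ext
    simp [g]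
  let G : L ⊗[K] A →ₐ[L[X]] L ⊗[K] O := { g.toRingHom with commutes' := DFunLike.congr_fun hg }
  refine ⟨G.range, isPRadical_includeRight p L O, aeval_X _, h0, hu, ?_, fun b => ?_⟩
  · exact Module.Finite.of_surjective G.rangeRestrict.toLinearMap G.rangeRestrict_surjective
  · obtain ⟨m, hm, hmb⟩ := exists_mem_one_tmul_mul_mem_range (L := L) M b
    have hgm : g (1 ⊗ₜ m) = 1 ⊗ₜ algebraMap A O m := by simp [g]
    exact ⟨algebraMap A O m, IsLocalization.map_units O ⟨m, hm⟩, ⟨1 ⊗ₜ m, hgm⟩, hmb⟩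

theorem exists_sum_mul_eq_zero_of_baseChange {O₁ O ι : Type*} [CommRing O₁] [Algebra K O₁]
    [CommRing O] [Algebra K O] [Fintype ι] (j : O₁ →ₐ[K] O) (z : ι → O) {β : ι → L ⊗[K] O₁}
    (hβ : β ≠ 0)
    (h : ∑ i, Algebra.TensorProduct.map (AlgHom.id L L) j (β i) * (1 ⊗ₜ z i) = 0) :
    ∃ c : ι → O₁, c ≠ 0 ∧ ∑ i, j (c i) * z i = 0 := by
  classical
  by_contra! hno
  let g : (ι → O₁) →ₗ[K] O :=
    { toFun := fun c => ∑ i, j (c i) * z i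
      map_add' := fun c d => by simp [add_mul, Finset.sum_add_distrib]
      map_smul' := fun k c => by simp [Finset.smul_sum] }
  have hg : Function.Injective g := (injective_iff_map_eq_zero g).2 fun c hc => by
    by_contra hc0
    exact hno c hc0 hc
  let e := TensorProduct.piRight K K L fun _ : ι => O₁
  have hLg (w : L ⊗[K] (ι → O₁)) : g.lTensor L w =
      ∑ i, Algebra.TensorProduct.map (AlgHom.id L L) j (e w i) * (1 ⊗ₜ z i) := by
    induction w with
    | zero => simp
    | add x y hx hy => simp only [map_add, hx, hy, Pi.add_apply, add_mul, Finset.sum_add_distrib]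
    | tmul l c => simp [g, e, TensorProduct.tmul_sum]
  have hw : g.lTensor L (e.symm β) = 0 := by rw [hLg, LinearEquiv.apply_symm_apply, h]
  have hwe := Module.Flat.lTensor_preserves_injective_linearMap (M := L) g hg
    (hw.trans (map_zero _).symm)
  exact hβ (by simpa using hwe)

variable {p : ℕ}

theorem one_tmul_mem_frobenius_range_of_mem_adjoin [Fact p.Prime] [CharP L p] [PerfectRing L p]
    {O : Type*} [CommRing O] [Algebra K O] [CharP (L ⊗[K] O) p] {a : O}
    (ha : a ∈ Algebra.adjoin K (Set.range fun o : O => o ^ p)) :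
    (1 ⊗ₜ a : L ⊗[K] O) ∈ (frobenius (L ⊗[K] O) p).range := by
  change (Algebra.TensorProduct.includeRight : O →ₐ[K] L ⊗[K] O) a ∈ _
  induction ha using Algebra.adjoin_induction with
  | mem x hx =>
    obtain ⟨o, rfl⟩ := hx
    exact ⟨1 ⊗ₜ o, by simp [frobenius_def, Algebra.TensorProduct.tmul_pow]⟩
  | algebraMap k =>
    obtain ⟨l, hl⟩ := (bijective_frobenius L p).2 (algebraMap K L k)
    refine ⟨algebraMap L _ l, ?_⟩
    rw [← RingHom.map_frobenius, hl, AlgHom.commutes, ← IsScalarTower.algebraMap_apply]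
  | add x y _ _ hx hy => rw [map_add]; exact add_mem hx hy
  | mul x y _ _ hx hy => rw [map_mul]; exact mul_mem hx hy

/-- The properties of the subring of a local ring that comes from the normalized Frobenius
pullback: it contains all `p`-th powers, is saturated and consists of fractions of elements of the
algebra generated by the `p`-th powers. -/
structure IsFrobeniusSubring (p : ℕ) {K O₁ O : Type*} [Field K] [CommRing O₁] [Algebra K O₁]
    [CommRing O] [Algebra K O] (j : O₁ →ₐ[K] O) : Prop where
  injective : Function.Injective j
  exists_eq_pow : ∀ o : O, ∃ c, j c = o ^ p
  isSaturated : IsSaturated j.toRingHom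
  exists_fraction : ∀ c : O₁, ∃ a ∈ Algebra.adjoin K (Set.range fun o : O => o ^ p),
    ∃ b ∈ Algebra.adjoin K (Set.range fun o : O => o ^ p), b ≠ 0 ∧ b * j c = a

namespace IsFrobeniusSubring

variable {O₁ O : Type*} [CommRing O₁] [Algebra K O₁] [CommRing O] [Algebra K O] {j : O₁ →ₐ[K] O}

theorem map_injective (h : IsFrobeniusSubring p j) :
    Function.Injective (Algebra.TensorProduct.map (AlgHom.id L L) j) :=
  Module.Flat.lTensor_preserves_injective_linearMap (M := L) j.toLinearMap h.injective

variable [hp : Fact p.Prime]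

theorem exists_map_eq_pow [CharP (L ⊗[K] O) p] (h : IsFrobeniusSubring p j) (b : L ⊗[K] O) :
    ∃ b₁, Algebra.TensorProduct.map (AlgHom.id L L) j b₁ = b ^ p := by
  induction b with
  | zero => exact ⟨0, by simp [hp.out.ne_zero]⟩
  | tmul l o =>
    obtain ⟨c, hc⟩ := h.exists_eq_pow o
    exact ⟨(l ^ p) ⊗ₜ c, by simp [hc, Algebra.TensorProduct.tmul_pow]⟩
  | add x y hx hy =>
    obtain ⟨a, ha⟩ := hx
    obtain ⟨b, hb⟩ := hy
    exact ⟨a + b, by rw [map_add, ha, hb, add_pow_char]⟩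

theorem exists_mul_pow_eq_pow [CharP L p] [PerfectRing L p] [IsDomain (L ⊗[K] O)]
    [CharP (L ⊗[K] O) p] (h : IsFrobeniusSubring p j) (b₁ : L ⊗[K] O₁) :
    ∃ c d : L ⊗[K] O, d ≠ 0 ∧
      Algebra.TensorProduct.map (AlgHom.id L L) j b₁ * d ^ p = c ^ p := by
  induction b₁ with
  | zero => exact ⟨0, 1, one_ne_zero, by simp [hp.out.ne_zero]⟩
  | tmul l o₁ =>
    obtain ⟨l, rfl⟩ : ∃ l', l' ^ p = l := (bijective_frobenius L p).2 l
    obtain ⟨_, ha, b, hb, hb0, rfl⟩ := h.exists_fraction o₁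
    obtain ⟨e, he : e ^ p = _⟩ := one_tmul_mem_frobenius_range_of_mem_adjoin (L := L) ha
    obtain ⟨d, hd : d ^ p = _⟩ := one_tmul_mem_frobenius_range_of_mem_adjoin (L := L) hb
    refine ⟨(l ⊗ₜ 1) * e, d, ?_, ?_⟩
    · rintro rfl
      rw [zero_pow hp.out.ne_zero] at hd
      exact hb0 (Algebra.TensorProduct.includeRight_injective (R := K) (A := L)
        (algebraMap K L).injective (hd.symm.trans (map_zero _).symm))
    · simp only [mul_pow, he, hd, Algebra.TensorProduct.tmul_pow, one_pow,
        Algebra.TensorProduct.map_tmul, AlgHom.id_apply, Algebra.TensorProduct.tmul_mul_tmul,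
        mul_one, one_mul, mul_comm b]
  | add x y hx hy =>
    obtain ⟨c, d, hd, hcd⟩ := hx
    obtain ⟨c', d', hd', hcd'⟩ := hy
    refine ⟨c * d' + c' * d, d * d', mul_ne_zero hd hd', ?_⟩
    rw [map_add, add_pow_char, mul_pow, mul_pow, mul_pow, ← hcd, ← hcd']
    ring

end IsFrobeniusSubring

end BaseChange

/-! ### The geometric normalization -/

section GeometricPoint

open IsDiscreteValuationRing

variable {K L O₁ O : Type*} [Field K] [Field L] [Algebra K L] [CommRing O] [Algebra K O]
variable {p : ℕ} {R : Type*} [CommRing R] [Algebra (L ⊗[K] O) R]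

theorem exists_sum_mul_eq_zero_of_hasFrobeniusExpansion [CommRing O₁] [Algebra K O₁]
    {j : O₁ →ₐ[K] O} [FaithfulSMul (L ⊗[K] O) R] [Nontrivial (L ⊗[K] O₁)] {t : R}
    (ht : HasFrobeniusExpansion p t)
    (hpow : ∀ x : R, ∃ b₁,
      algebraMap (L ⊗[K] O) R (Algebra.TensorProduct.map (AlgHom.id L L) j b₁) = x ^ p)
    {ι : Type*} [Fintype ι] (hι : p < Fintype.card ι) (z : ι → O) :
    ∃ c : ι → O₁, c ≠ 0 ∧ ∑ i, j (c i) * z i = 0 := by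
  classical
  let _ : Algebra (L ⊗[K] O₁) R := ((algebraMap (L ⊗[K] O) R).comp
    (Algebra.TensorProduct.map (AlgHom.id L L) j).toRingHom).toAlgebra
  have hspan : Submodule.span (L ⊗[K] O₁)
      (((Finset.range p).image (t ^ ·) : Finset R) : Set R) = ⊤ := by
    refine eq_top_iff.2 fun x _ => ?_
    obtain ⟨a, rfl⟩ := ht x
    refine sum_mem fun i hi => ?_
    obtain ⟨b₁, hb₁⟩ := hpow (a i)
    rw [← hb₁]
    exact Submodule.smul_mem _ b₁ (Submodule.subset_span (Finset.mem_image_of_mem _ hi))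
  have hdep : ¬ LinearIndependent (L ⊗[K] O₁) fun i => algebraMap (L ⊗[K] O) R (1 ⊗ₜ z i) := by
    intro hli
    have hcard := linearIndependent_le_span_finset _ hli _ hspan
    rw [Cardinal.mk_fintype, Nat.cast_le] at hcard
    have himage := Finset.card_image_le (s := Finset.range p) (f := (t ^ ·))
    rw [Finset.card_range] at himage
    omega
  rw [Fintype.not_linearIndependent_iff] at hdep
  obtain ⟨β, hβ, i, hi⟩ := hdep
  refine exists_sum_mul_eq_zero_of_baseChange j z (fun h => hi (congrFun h i))
    (FaithfulSMul.algebraMap_injective (L ⊗[K] O) R ?_)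
  simpa [Algebra.smul_def, RingHom.algebraMap_toAlgebra] using hβ

variable [hp : Fact p.Prime] [CharP R p] [CharP L p] [PerfectRing L p] {j : O₁ → O}

theorem exists_algebraMap_eq_pow_add_mul
    (hroot : ∀ c, ∃ x : R, algebraMap (L ⊗[K] O) R (1 ⊗ₜ j c) = x ^ p) {y : O}
    (happrox : ∀ o, ∃ c q, o = j c + y * q) (b : L ⊗[K] O) :
    ∃ x r : R, algebraMap (L ⊗[K] O) R b = x ^ p + algebraMap (L ⊗[K] O) R (1 ⊗ₜ y) * r := by
  induction b with
  | zero => exact ⟨0, 0, by simp [hp.out.ne_zero]⟩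
  | tmul l o =>
    obtain ⟨l, rfl⟩ : ∃ l', l' ^ p = l := (bijective_frobenius L p).2 l
    obtain ⟨c, q, rfl⟩ := happrox o
    obtain ⟨x, hx⟩ := hroot c
    refine ⟨algebraMap (L ⊗[K] O) R (l ⊗ₜ 1) * x, algebraMap (L ⊗[K] O) R ((l ^ p) ⊗ₜ q), ?_⟩
    rw [mul_pow, ← hx, ← map_pow, ← map_mul, ← map_mul, ← map_add]
    simp [TensorProduct.tmul_add, Algebra.TensorProduct.tmul_pow]
  | add x y hx hy =>
    obtain ⟨x, r, hx⟩ := hx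
    obtain ⟨y, q, hy⟩ := hy
    exact ⟨x + y, r + q, by rw [map_add, hx, hy, add_pow_char]; ring⟩

theorem range_algebraMap_eq_frobEval_range
    (hpow : ∀ x : R, x ^ p ∈ (algebraMap (L ⊗[K] O) R).range)
    (hroot : ∀ c, ∃ x : R, algebraMap (L ⊗[K] O) R (1 ⊗ₜ j c) = x ^ p) {z : O}
    (hz : ∀ o, ∃ c : ℕ → O₁, o = ∑ i ∈ Finset.range p, j (c i) * z ^ i) :
    (algebraMap (L ⊗[K] O) R).range =
      (frobEval p (algebraMap (L ⊗[K] O) R (1 ⊗ₜ z))).range := by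
  apply le_antisymm
  · rintro _ ⟨b, rfl⟩
    induction b with
    | zero => rw [map_zero]; exact zero_mem _
    | add x y hx hy => rw [map_add]; exact add_mem hx hy
    | tmul l o =>
      obtain ⟨l, rfl⟩ : ∃ l', l' ^ p = l := (bijective_frobenius L p).2 l
      obtain ⟨c, rfl⟩ := hz o
      choose x hx using hroot
      refine (mem_frobEval_range_iff p).2
        ⟨fun i => algebraMap (L ⊗[K] O) R (l ⊗ₜ 1) * x (c i), ?_⟩
      simp only [mul_pow, ← hx, ← map_pow, ← map_mul, ← map_sum, TensorProduct.tmul_sum,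
        Algebra.TensorProduct.tmul_pow, Algebra.TensorProduct.tmul_mul_tmul, one_pow, one_mul,
        mul_one]
  · intro x hx
    obtain ⟨a, rfl⟩ := (mem_frobEval_range_iff p).1 hx
    exact sum_mem fun i _ => mul_mem (hpow _) (pow_mem (RingHom.mem_range_self _ _) i)

theorem exists_ne_add_pow_mul [IsDomain R] [IsDiscreteValuationRing R] [Algebra L R]
    [IsScalarTower L (L ⊗[K] O) R] {s : R} (hs0 : s ≠ 0)
    (hs : ∀ x, s * x ∈ imageSubmodule L (L ⊗[K] O) R)
    (hroot : ∀ c, ∃ x : R, algebraMap (L ⊗[K] O) R (1 ⊗ₜ j c) = x ^ p) {y : O}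
    (hy : ¬ IsUnit (algebraMap (L ⊗[K] O) R (1 ⊗ₜ y))) :
    ∃ (n : ℕ) (o : O), ∀ c q, o ≠ j c + y ^ n * q := by
  by_contra! hno
  obtain ⟨n, ⟨_, ⟨b, rfl⟩, hn⟩, hpn⟩ := exists_mem_valueSet_not_dvd hp.out.ne_one hs0 hs
  obtain ⟨x, r, hx⟩ := exists_algebraMap_eq_pow_add_mul hroot (hno (n + 1)) b
  have hlt : (n : ℕ∞) < addVal R (algebraMap (L ⊗[K] O) R (1 ⊗ₜ (y ^ (n + 1))) * r) := by
    have htmul : (1 ⊗ₜ (y ^ (n + 1)) : L ⊗[K] O) = (1 ⊗ₜ y) ^ (n + 1) := by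
      rw [Algebra.TensorProduct.tmul_pow, one_pow]
    rw [natCast_lt_addVal_iff, htmul, addVal_mul, map_pow, addVal_pow]
    refine le_trans ?_ le_self_add
    calc ((n + 1 : ℕ) : ℕ∞) = (n + 1) • (1 : ℕ∞) := by simp
      _ ≤ _ := by gcongr; exact one_le_addVal_iff.2 hy
  have hb : addVal R (algebraMap (L ⊗[K] O) R b) = n := hn
  refine hpn (dvd_of_addVal_pow_eq_natCast (x := x) (R := R) ?_)
  rw [← hb] at hlt
  rw [← hb, ← AddValuation.map_sub_eq_of_lt_left _ hlt, hx, add_sub_cancel_right]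

end GeometricPoint

section GeomNorm

theorem algebraMap_residueField_surjective_of_ringEquiv {L L₁ R R₁ : Type*} [CommRing L]
    [CommRing L₁] [CommRing R] [CommRing R₁] [IsLocalRing R] [IsLocalRing R₁] [Algebra L R]
    [Algebra L₁ R₁] (σ : R ≃+* R₁) {τ : L → L₁}
    (hσ : ∀ c, σ (algebraMap L R c) = algebraMap L₁ R₁ (τ c))
    (h : Function.Surjective (algebraMap L (IsLocalRing.ResidueField R))) :
    Function.Surjective (algebraMap L₁ (IsLocalRing.ResidueField R₁)) := by
  intro a
  obtain ⟨x, rfl⟩ := ((IsLocalRing.ResidueField.mapEquiv σ).surjective.comp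
    IsLocalRing.residue_surjective) a
  obtain ⟨c, hc⟩ := h (IsLocalRing.residue R x)
  refine ⟨τ c, ?_⟩
  rw [Function.comp_apply, ← hc, IsScalarTower.algebraMap_apply L R,
    IsScalarTower.algebraMap_apply L₁ R₁, ← hσ]
  rfl

open Polynomial IsDiscreteValuationRing
open IsLocalRing (ResidueField)

variable {K : Type u} [Field K]

theorem isUnit_of_isUnit_algebraMap_geomNorm (p : ℕ) [Fact p.Prime] [CharP K p] {L O : Type u}
    [Field L] [Algebra K L] [IsPurelyInseparable K L] [CommRing O] [IsDomain O] [Algebra K O]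
    [IsDomain (L ⊗[K] O)] {o : O}
    (ho : IsUnit (algebraMap (Geom K L O) (GeomNorm K L O) (1 ⊗ₜ[K] o : L ⊗[K] O))) :
    IsUnit o := by
  let _ : Algebra O (L ⊗[K] O) := Algebra.TensorProduct.rightAlgebra
  have hrad : IsPRadical (algebraMap O (L ⊗[K] O)) p := isPRadical_includeRight p L O
  have := isLocalHom_algebraMap_integralClosure (E := FractionRing (L ⊗[K] O)) hrad
  exact isUnit_of_map_unit (algebraMap O (integralClosure (L ⊗[K] O) (FractionRing (L ⊗[K] O)))) o
    ho

theorem exists_geomNorm_structure (p : ℕ) [hp : Fact p.Prime] [CharP K p] {L : Type u} [Field L]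
    [Algebra K L] [IsAlgClosed L] [IsPurelyInseparable K L] {O : Type u} [CommRing O] [IsDomain O]
    [IsDiscreteValuationRing O] [Algebra K O] [IsDomain (L ⊗[K] O)] {A : Type*} [CommRing A]
    [Algebra K A] [Algebra A O] [IsScalarTower K A O] (M : Submonoid A) [IsLocalization M O]
    {φ : K[X] →ₐ[K] A} (hφ : φ.toRingHom.Finite) (h0 : algebraMap A O (φ X) ≠ 0)
    (hu : ¬ IsUnit (algebraMap A O (φ X))) :
    ∃ (_ : IsDomain (GeomNorm K L O)) (_ : IsDiscreteValuationRing (GeomNorm K L O)),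
      Function.Surjective (algebraMap L (ResidueField (GeomNorm K L O))) ∧
      (∀ t : GeomNorm K L O, Irreducible t → HasFrobeniusExpansion p t) ∧
      ∃ s : GeomNorm K L O, s ≠ 0 ∧
        ∀ x, s * x ∈ imageSubmodule L (Geom K L O) (GeomNorm K L O) := by
  have : CharP L p := charP_of_injective_algebraMap (algebraMap K L).injective p
  let _ : Algebra O (L ⊗[K] O) := Algebra.TensorProduct.rightAlgebra
  let _ : Algebra L[X] (L ⊗[K] O) :=
    (aeval (1 ⊗ₜ algebraMap A O (φ X)) : L[X] →ₐ[L] L ⊗[K] O).toRingHom.toAlgebra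
  have : IsScalarTower L L[X] (L ⊗[K] O) := .of_algebraMap_eq fun c => (aeval_C _ c).symm
  obtain ⟨D, h⟩ := exists_isGeometricModel p (L := L) M hφ h0 hu
  let E := FractionRing (L ⊗[K] O)
  have hdvr := h.isDiscreteValuationRing_integralClosure E
  exact ⟨inferInstanceAs (IsDomain (integralClosure (L ⊗[K] O) E)), hdvr,
    h.algebraMap_residueField_surjective E, fun t ht => h.hasFrobeniusExpansion E ht,
    h.exists_conductor E⟩

variable {L O₁ O : Type u} [Field L] [Algebra K L] [CommRing O₁] [Algebra K O₁] [CommRing O]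
variable [Algebra K O] {p : ℕ} [hp : Fact p.Prime] [CharP L p] [PerfectRing L p] {j : O₁ →ₐ[K] O}

theorem IsFrobeniusSubring.exists_ringEquiv_geomNorm [IsDomain (L ⊗[K] O)]
    (hj : IsFrobeniusSubring p j) :
    ∃ σ : GeomNorm K L O ≃+* GeomNorm K L O₁,
      (∀ (b : L ⊗[K] O) (b₁ : L ⊗[K] O₁),
        Algebra.TensorProduct.map (AlgHom.id L L) j b₁ = b ^ p →
        σ (algebraMap (Geom K L O) _ b) = algebraMap (Geom K L O₁) _ b₁) ∧
      ∀ (x : GeomNorm K L O) (b₁ : L ⊗[K] O₁), σ x = algebraMap (Geom K L O₁) _ b₁ →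
        algebraMap (Geom K L O) _ (Algebra.TensorProduct.map (AlgHom.id L L) j b₁) = x ^ p := by
  have : CharP (L ⊗[K] O) p := charP_of_injective_algebraMap (algebraMap L (L ⊗[K] O)).injective p
  let η : L ⊗[K] O₁ →+* L ⊗[K] O := (Algebra.TensorProduct.map (AlgHom.id L L) j).toRingHom
  have hη : Function.Injective η := hj.map_injective
  have : IsDomain (L ⊗[K] O₁) := hη.isDomain η
  exact exists_ringEquiv_integralClosure_of_frobenius (B := L ⊗[K] O) (B₁ := L ⊗[K] O₁)
    (FractionRing (L ⊗[K] O)) (FractionRing (L ⊗[K] O₁)) hη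
    hj.exists_map_eq_pow hj.exists_mul_pow_eq_pow

theorem algebraMap_geomNorm_surjective_of_differentialDegree_eq_one
    [IsDomain (GeomNorm K L O)] [IsDiscreteValuationRing (GeomNorm K L O)]
    (hj : IsFrobeniusSubring p j) {σ : GeomNorm K L O ≃+* GeomNorm K L O₁}
    (hσ : ∀ (b : L ⊗[K] O) (b₁ : L ⊗[K] O₁),
      Algebra.TensorProduct.map (AlgHom.id L L) j b₁ = b ^ p →
      σ (algebraMap (Geom K L O) _ b) = algebraMap (Geom K L O₁) _ b₁)
    (hres : Function.Surjective (algebraMap L (ResidueField (GeomNorm K L O))))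
    (hexp : ∀ t : GeomNorm K L O, Irreducible t → HasFrobeniusExpansion p t)
    {s : GeomNorm K L O} (hs0 : s ≠ 0)
    (hs : ∀ x, s * x ∈ imageSubmodule L (Geom K L O) (GeomNorm K L O))
    (hd : differentialDegree K L O₁ = 1) :
    Function.Surjective (algebraMap (Geom K L O₁) (GeomNorm K L O₁)) := by
  have : Nontrivial (L ⊗[K] O) := (algebraMap (Geom K L O) (GeomNorm K L O)).domain_nontrivial
  have : CharP (L ⊗[K] O) p := charP_of_injective_algebraMap (algebraMap L (L ⊗[K] O)).injective p
  have : IsDomain (GeomNorm K L O₁) := σ.symm.injective.isDomain σ.symm.toRingHom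
  have : IsDiscreteValuationRing (GeomNorm K L O₁) :=
    RingEquivClass.isDiscreteValuationRing σ
  have : CharP (GeomNorm K L O₁) p :=
    charP_of_injective_algebraMap (algebraMap L (GeomNorm K L O₁)).injective p
  have hσL (c : L) : σ (algebraMap L _ c) = algebraMap L (GeomNorm K L O₁) (c ^ p) :=
    hσ (algebraMap L (L ⊗[K] O) c) (algebraMap L (L ⊗[K] O₁) (c ^ p)) (by
      rw [AlgHom.commutes, map_pow])
  obtain ⟨t, ht⟩ := exists_irreducible (GeomNorm K L O)
  have hσt : Irreducible (σ t) := (MulEquiv.irreducible_iff σ).2 ht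
  refine (((hexp t ht).map σ).isPBasis hσt).algebraMap_surjective_of_finrank_kaehlerCoker_eq_zero
    hσt (algebraMap_residueField_surjective_of_ringEquiv σ hσL hres)
    ((map_ne_zero_iff σ σ.injective).2 hs0) (fun x => ?_) (by simpa [differentialDegree] using hd)
  obtain ⟨b, hb : algebraMap (Geom K L O) (GeomNorm K L O) b = _⟩ := hs (σ.symm x)
  obtain ⟨b₁, hb₁⟩ := hj.exists_map_eq_pow b
  refine ⟨b₁, (hσ b b₁ hb₁).symm.trans ?_⟩
  rw [hb, map_mul, RingEquiv.apply_symm_apply]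

theorem exists_map_eq_pow_and_exists_eq_pow_of_differentialDegree_eq_one
    [IsDomain (L ⊗[K] O)] [IsDomain (GeomNorm K L O)] [IsDiscreteValuationRing (GeomNorm K L O)]
    (hj : IsFrobeniusSubring p j)
    (hres : Function.Surjective (algebraMap L (ResidueField (GeomNorm K L O))))
    (hexp : ∀ t : GeomNorm K L O, Irreducible t → HasFrobeniusExpansion p t)
    {s : GeomNorm K L O} (hs0 : s ≠ 0)
    (hs : ∀ x, s * x ∈ imageSubmodule L (Geom K L O) (GeomNorm K L O))
    (hd : differentialDegree K L O₁ = 1) :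
    (∀ x, ∃ b₁ : L ⊗[K] O₁, algebraMap (Geom K L O) (GeomNorm K L O)
      (Algebra.TensorProduct.map (AlgHom.id L L) j b₁) = x ^ p) ∧
    ∀ b₁ : L ⊗[K] O₁, ∃ x, algebraMap (Geom K L O) (GeomNorm K L O)
      (Algebra.TensorProduct.map (AlgHom.id L L) j b₁) = x ^ p := by
  obtain ⟨σ, hσ, hσ'⟩ := hj.exists_ringEquiv_geomNorm (L := L)
  have hsurj :=
    algebraMap_geomNorm_surjective_of_differentialDegree_eq_one hj hσ hres hexp hs0 hs hd
  refine ⟨fun x => ?_, fun b₁ => ?_⟩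
  · obtain ⟨b₁, hb₁⟩ := hsurj (σ x)
    exact ⟨b₁, hσ' x b₁ hb₁.symm⟩
  · obtain ⟨x, hx⟩ := σ.surjective (algebraMap (Geom K L O₁) _ b₁)
    exact ⟨x, hσ' x b₁ hx⟩

theorem exists_range_algebraMap_geomNorm_eq_frobEval_range [CharP K p] [IsPurelyInseparable K L]
    [IsDomain O] [IsDiscreteValuationRing O] [IsDomain (L ⊗[K] O)] [IsDomain (GeomNorm K L O)]
    [IsDiscreteValuationRing (GeomNorm K L O)] [CharP (GeomNorm K L O) p]
    (hj : IsFrobeniusSubring p j)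
    (hexp : ∀ t : GeomNorm K L O, Irreducible t → HasFrobeniusExpansion p t)
    {s : GeomNorm K L O} (hs0 : s ≠ 0)
    (hs : ∀ x, s * x ∈ imageSubmodule L (Geom K L O) (GeomNorm K L O))
    (hpow : ∀ x, ∃ b₁ : L ⊗[K] O₁, algebraMap (Geom K L O) (GeomNorm K L O)
      (Algebra.TensorProduct.map (AlgHom.id L L) j b₁) = x ^ p)
    (hroot : ∀ b₁ : L ⊗[K] O₁, ∃ x, algebraMap (Geom K L O) (GeomNorm K L O)
      (Algebra.TensorProduct.map (AlgHom.id L L) j b₁) = x ^ p) :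
    ∃ z : GeomNorm K L O, (algebraMap (Geom K L O) (GeomNorm K L O)).range =
      (frobEval p z).range := by
  have : IsDomain (Geom K L O) := ‹IsDomain (L ⊗[K] O)›
  have hinj : Function.Injective (algebraMap (Geom K L O) (GeomNorm K L O)) :=
    FaithfulSMul.algebraMap_injective (Geom K L O)
      (integralClosure (Geom K L O) (FractionRing (Geom K L O)))
  let _ : Algebra (L ⊗[K] O) (GeomNorm K L O) :=
    inferInstanceAs (Algebra (Geom K L O) (GeomNorm K L O))
  have : IsScalarTower L (L ⊗[K] O) (GeomNorm K L O) := .of_algebraMap_eq' rfl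
  have : FaithfulSMul (L ⊗[K] O) (GeomNorm K L O) :=
    (faithfulSMul_iff_algebraMap_injective _ _).2 hinj
  have : CharP O p := charP_of_injective_algebraMap (algebraMap K O).injective p
  have hroot' (c : O₁) :
      ∃ x, algebraMap (L ⊗[K] O) (GeomNorm K L O) (1 ⊗ₜ j c) = x ^ p := hroot (1 ⊗ₜ c)
  have : Nontrivial (L ⊗[K] O₁) :=
    (Algebra.TensorProduct.map (AlgHom.id L L) j).toRingHom.domain_nontrivial
  have hpow' (x : GeomNorm K L O) : ∃ b₁, algebraMap (L ⊗[K] O) (GeomNorm K L O)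
      (Algebra.TensorProduct.map (AlgHom.id L L) j b₁) = x ^ p := hpow x
  have hs' : ∀ x, s * x ∈ imageSubmodule L (L ⊗[K] O) (GeomNorm K L O) := hs
  obtain ⟨t, ht⟩ := exists_irreducible (GeomNorm K L O)
  have hrank (z : ℕ → O) : ∃ c : ℕ → O₁, (∃ i ≤ p, c i ≠ 0) ∧
      ∑ i ∈ Finset.range (p + 1), j (c i) * z i = 0 := by
    obtain ⟨c, hc, hsum⟩ := exists_sum_mul_eq_zero_of_hasFrobeniusExpansion (hexp t ht) hpow'
      (ι := Fin (p + 1)) (by simp) fun i => z i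
    obtain ⟨i, hi⟩ := Function.ne_iff.1 hc
    refine ⟨fun i => c (Fin.ofNat (p + 1) i), ⟨i, Nat.lt_succ_iff.1 i.2, by simpa using hi⟩, ?_⟩
    rw [Finset.sum_range, ← hsum]
    simp
  obtain ⟨z, hz⟩ := exists_forall_exists_eq_sum_mul_pow hj.injective hj.isSaturated
    hj.exists_eq_pow hrank fun c hc => exists_ne_add_pow_mul hs0 hs' hroot'
      fun hu => hc (isUnit_of_isUnit_algebraMap_geomNorm p hu)
  exact ⟨_, range_algebraMap_eq_frobEval_range
    (fun x => (hpow' x).elim fun b₁ hb₁ => ⟨_, hb₁⟩) hroot' hz⟩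

end GeomNorm

section Invariants

open Polynomial IsDiscreteValuationRing

variable {K : Type u} [Field K] {L : Type u} [Field L] [Algebra K L] {O : Type u} [CommRing O]
variable [Algebra K O] [IsDomain (GeomNorm K L O)] [IsDiscreteValuationRing (GeomNorm K L O)]

theorem semigroup_eq_of_valueSet_eq_closure_pair {m p : ℕ}
    (h : valueSet (imageSubmodule L (Geom K L O) (GeomNorm K L O)) =
      AddSubmonoid.closure {m, p}) :
    semigroup K L O = {l : ℤ | ∃ a b : ℕ, l = m * a + p * b} := by
  ext l
  have hvalue : l ∈ semigroup K L O ↔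
      ∃ n ∈ valueSet (imageSubmodule L (Geom K L O) (GeomNorm K L O)), l = n :=
    ⟨fun ⟨x, n, hn, hl⟩ => ⟨n, ⟨_, ⟨x, rfl⟩, hn⟩, hl⟩,
      fun ⟨n, ⟨_, ⟨x, rfl⟩, hn⟩, hl⟩ => ⟨x, n, hn, hl⟩⟩
  rw [hvalue, h]
  simp only [SetLike.mem_coe, AddSubmonoid.mem_closure_pair, smul_eq_mul, Set.mem_ofPred_eq]
  constructor
  · rintro ⟨_, ⟨a, b, rfl⟩, rfl⟩
    exact ⟨a, b, by push_cast; ring⟩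
  · rintro ⟨a, b, rfl⟩
    exact ⟨_, ⟨a, b, rfl⟩, by push_cast; ring⟩

end Invariants

section Main

open Polynomial IsDiscreteValuationRing

variable {K : Type u} [Field K] {p : ℕ} [hp : Fact p.Prime] [CharP K p]

theorem invariants_of_isFrobeniusSubring [IsSepClosed K] {L : Type u} [Field L] [Algebra K L]
    [IsAlgClosure K L] {O₁ O : Type u} [CommRing O₁] [Algebra K O₁] [CommRing O] [IsDomain O]
    [IsDiscreteValuationRing O] [Algebra K O] [IsDomain (L ⊗[K] O)] {A : Type*} [CommRing A]
    [Algebra K A] [Algebra A O] [IsScalarTower K A O] (M : Submonoid A) [IsLocalization M O]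
    {φ : K[X] →ₐ[K] A} (hφ : φ.toRingHom.Finite) (h0 : algebraMap A O (φ X) ≠ 0)
    (hu : ¬ IsUnit (algebraMap A O (φ X))) {j : O₁ →ₐ[K] O} (hj : IsFrobeniusSubring p j)
    (hd : differentialDegree K L O₁ = 1) :
    ∃ (_ : IsDomain (GeomNorm K L O)) (_ : IsDiscreteValuationRing (GeomNorm K L O)),
      Module.Finite L (DiffCoker K L O) ∧
      semigroup K L O = {l : ℤ | ∃ a b : ℕ, l = differentialDegree K L O * a + p * b} ∧
      Module.Finite L (DeltaQuotient K L O) ∧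
      (deltaInvariant K L O : ℚ) =
        ((differentialDegree K L O : ℚ) - 1) * ((p : ℚ) - 1) / 2 := by
  have : Algebra.IsAlgebraic K L := IsAlgClosure.isAlgebraic
  have : IsAlgClosed L := IsAlgClosure.isAlgClosed K
  have : CharP L p := charP_of_injective_algebraMap (algebraMap K L).injective p
  obtain ⟨hdom, hdvr, hres, hexp, s, hs0, hs⟩ := exists_geomNorm_structure p (L := L) M hφ h0 hu
  have : CharP (GeomNorm K L O) p :=
    charP_of_injective_algebraMap (algebraMap L (GeomNorm K L O)).injective p
  obtain ⟨hpow, hroot⟩ :=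
    exists_map_eq_pow_and_exists_eq_pow_of_differentialDegree_eq_one hj hres hexp hs0 hs hd
  obtain ⟨ζ, hζ⟩ := exists_range_algebraMap_geomNorm_eq_frobEval_range hj hexp hs0 hs hpow hroot
  have hW : (imageSubmodule L (Geom K L O) (GeomNorm K L O) : Set (GeomNorm K L O)) =
    (frobEval p ζ).range := congrArg SetLike.coe hζ
  obtain ⟨t, ht⟩ := exists_irreducible (GeomNorm K L O)
  obtain ⟨z, m, hz, hm, hζz⟩ := (hexp t ht).exists_addVal_eq_and_frobEval_range_eq ht hW hs0 hs
  rw [← hζz] at hW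
  obtain ⟨hcoker, hdm : differentialDegree K L O = m⟩ :=
    ((hexp t ht).isPBasis ht).finite_kaehlerCoker_and_one_add_finrank_eq ht hres hW hz hm
  obtain ⟨hfin, hδ : 2 * deltaInvariant K L O = (m - 1) * (p - 1)⟩ :=
    finite_quotient_and_two_mul_finrank_eq hres hW hs0 hs hz hm
  refine ⟨hdom, hdvr, hcoker, ?_, hfin, ?_⟩
  · rw [hdm]
    exact semigroup_eq_of_valueSet_eq_closure_pair (valueSet_eq_closure_pair hW hz hm)
  · have hm1 : 1 ≤ m := Nat.one_le_iff_ne_zero.2 fun h => hm (h ▸ dvd_zero p)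
    have hδ' : (2 : ℚ) * deltaInvariant K L O = ((m : ℚ) - 1) * ((p : ℚ) - 1) := by
      have := congrArg (Nat.cast (R := ℚ)) hδ
      rwa [Nat.cast_mul, Nat.cast_mul, Nat.cast_sub hm1, Nat.cast_sub hp.out.one_le] at this
    rw [hdm, ← hδ']
    ring

end Main

/-! ### Noether normalization and Frobenius on affine curves -/

section NoetherNormalization

open Polynomial

theorem finite_aeval_of_natDegree_ne_zero {K : Type*} [Field K] {q : K[X]} (hq : q.natDegree ≠ 0) :
    (aeval q : K[X] →ₐ[K] K[X]).toRingHom.Finite := by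
  set g : K[X] →+* K[X] := (aeval q : K[X] →ₐ[K] K[X]).toRingHom
  have hgC : g.comp C = C := RingHom.ext (aeval_C q)
  have hgX : g X = q := aeval_X q
  have hX : g.IsIntegralElem X := by
    have hq0 : q ≠ 0 := ne_zero_of_natDegree_gt (Nat.pos_of_ne_zero hq)
    refine ⟨(q * C q.leadingCoeff⁻¹).map C - C (C q.leadingCoeff⁻¹ * X), ?_, ?_⟩
    · refine ((monic_mul_leadingCoeff_inv hq0).map C).sub_of_left (degree_C_le.trans_lt ?_)
      rw [degree_map, degree_mul_leadingCoeff_inv _ hq0]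
      exact natDegree_pos_iff_degree_pos.1 (Nat.pos_of_ne_zero hq)
    · rw [eval₂_sub, eval₂_C, eval₂_map, hgC, map_mul, hgX, ← RingHom.comp_apply, hgC, eval₂_mul,
        eval₂_C, eval₂_C_X, mul_comm, sub_self]
  have hint : g.IsIntegral := by
    intro f
    induction f using Polynomial.induction_on with
    | C a => exact hgC ▸ g.isIntegralElem_map
    | add f₁ f₂ h₁ h₂ => exact h₁.add g h₂
    | monomial n a h => rw [pow_succ, ← mul_assoc]; exact h.mul g hX
  have hft : (g.comp C).FiniteType := by
    rw [hgC]
    exact (RingHom.finiteType_algebraMap (A := K) (B := K[X])).2 inferInstance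
  exact hint.to_finite hft.of_comp_finiteType

theorem exists_finite_polynomial_algHom_of_finite {K A : Type*} [Field K] [CommRing A] [IsDomain A]
    [Algebra K A] {g : K[X] →ₐ[K] A} (hg : Function.Injective g) (hfin : g.toRingHom.Finite)
    {P : Ideal A} [hP : P.IsPrime] (hP0 : P ≠ ⊥) :
    ∃ φ : K[X] →ₐ[K] A, φ.toRingHom.Finite ∧ φ X ≠ 0 ∧ φ X ∈ P := by
  let _ : Algebra K[X] A := g.toRingHom.toAlgebra
  have : Algebra.IsIntegral K[X] A := ⟨hfin.to_isIntegral⟩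
  obtain ⟨q, hq, hq0⟩ := Submodule.exists_mem_ne_zero_of_ne_bot
    fun h : P.comap (algebraMap K[X] A) = ⊥ => hP0 (Ideal.eq_bot_of_comap_eq_bot h)
  have hdeg : q.natDegree ≠ 0 := by
    intro h
    obtain ⟨k, rfl⟩ := natDegree_eq_zero.1 h
    exact (hP.comap (algebraMap K[X] A)).ne_top
      (Ideal.eq_top_of_isUnit_mem _ hq ((isUnit_iff_ne_zero.2 fun hk => hq0 (by simp [hk])).map C))
  have hX : g.comp (aeval q) X = g q := by rw [AlgHom.comp_apply, aeval_X]
  exact ⟨g.comp (aeval q), hfin.comp (finite_aeval_of_natDegree_ne_zero hdeg),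
    hX ▸ (map_ne_zero_iff g hg).2 hq0, hX ▸ hq⟩

theorem krullDimLE_one_of_isIntegral (R A : Type*) [CommRing R] [IsDomain R] [CommRing A]
    [IsDomain A] [Algebra R A] [FaithfulSMul R A] [Algebra.IsIntegral R A]
    [Ring.DimensionLEOne A] : Ring.KrullDimLE 1 R := by
  have hinj := FaithfulSMul.algebraMap_injective R A
  refine Ring.krullDimLE_one_iff_of_isPrime_bot.2 fun Q hQ _ => ?_
  obtain ⟨I, hI, rfl⟩ := Ideal.exists_ideal_over_prime_of_isIntegral_of_isDomain (S := A) Q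
    (((RingHom.injective_iff_ker_eq_bot (algebraMap R A)).1 hinj).trans_le bot_le)
  have hI0 : I ≠ ⊥ := by
    rintro rfl
    exact hQ (Ideal.comap_bot_of_injective _ hinj)
  have := Ring.DimensionLEOne.maximalOfPrime hI0 hI
  exact Ideal.isMaximal_comap_of_isIntegral_of_isMaximal I

theorem exists_finite_polynomial_algHom {K A : Type*} [Field K] [CommRing A] [IsDomain A]
    [Algebra K A] [Algebra.FiniteType K A] [Ring.DimensionLEOne A] {P : Ideal A} [hP : P.IsPrime]
    (hP0 : P ≠ ⊥) :
    ∃ φ : K[X] →ₐ[K] A, φ.toRingHom.Finite ∧ φ X ≠ 0 ∧ φ X ∈ P := by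
  obtain ⟨s, g, hg, hfin⟩ := exists_finite_inj_algHom_of_fg K A
  let _ : Algebra (MvPolynomial (Fin s) K) A := g.toRingHom.toAlgebra
  have : Algebra.IsIntegral (MvPolynomial (Fin s) K) A := ⟨hfin.to_isIntegral⟩
  have : FaithfulSMul (MvPolynomial (Fin s) K) A :=
    (faithfulSMul_iff_algebraMap_injective _ _).2 hg
  have hs : s ≤ 1 := by
    have hdim := krullDimLE_one_of_isIntegral (MvPolynomial (Fin s) K) A
    rw [Ring.krullDimLE_iff, MvPolynomial.ringKrullDim_of_isNoetherianRing,
      ringKrullDim_eq_zero_of_field, zero_add, Nat.card_fin] at hdim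
    exact_mod_cast hdim
  obtain rfl | rfl : s = 0 ∨ s = 1 := by omega
  · have hfield : IsField (MvPolynomial (Fin 0) K) :=
      (MvPolynomial.isEmptyAlgEquiv K (Fin 0)).toMulEquiv.isField (Field.toIsField K)
    let _ : Field A := (isField_of_isIntegral_of_isField' hfield).toField
    exact absurd (Ideal.eq_bot_of_prime P) hP0
  · let e : K[X] ≃ₐ[K] MvPolynomial (Fin 1) K := (MvPolynomial.uniqueAlgEquiv K (Fin 1)).symm
    exact exists_finite_polynomial_algHom_of_finite (g := g.comp e.toAlgHom) (hg.comp e.injective)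
      (hfin.comp (RingHom.Finite.of_surjective e.toRingEquiv.toRingHom e.surjective)) hP0

theorem isDomain_tensorProduct_of_isLocalization {K L A O : Type*} [Field K] [Field L] [Algebra K L]
    [CommRing A] [Algebra K A] [CommRing O] [Algebra K O] [Algebra A O] [IsScalarTower K A O]
    {M : Submonoid A} [IsLocalization M O] (hM : M ≤ nonZeroDivisors A)
    [IsDomain (L ⊗[K] A)] : IsDomain (L ⊗[K] O) := by
  set g := Algebra.TensorProduct.map (AlgHom.id L L) (IsScalarTower.toAlgHom K A O)
  have hg : Function.Injective g :=
    Module.Flat.lTensor_preserves_injective_linearMap (M := L)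
      (IsScalarTower.toAlgHom K A O).toLinearMap (IsLocalization.injective O hM)
  have hunit {m : A} (hm : m ∈ M) : IsUnit ((1 : L) ⊗ₜ[K] algebraMap A O m) :=
    (IsLocalization.map_units O ⟨m, hm⟩).map
      (Algebra.TensorProduct.includeRight : O →ₐ[K] L ⊗[K] O)
  have : Nontrivial (L ⊗[K] O) := hg.nontrivial
  have : NoZeroDivisors (L ⊗[K] O) := by
    refine ⟨fun {x y} hxy => ?_⟩
    obtain ⟨m, hm, a, ha : g a = _⟩ := exists_mem_one_tmul_mul_mem_range (L := L) M x
    obtain ⟨n, hn, b, hb : g b = _⟩ := exists_mem_one_tmul_mul_mem_range (L := L) M y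
    have hab : a * b = 0 := hg (by rw [map_mul, map_zero, ha, hb, mul_mul_mul_comm, hxy, mul_zero])
    refine (mul_eq_zero.1 hab).imp ?_ ?_ <;> rintro rfl
    · exact (hunit hm).mul_right_eq_zero.1 (ha.symm.trans (map_zero g))
    · exact (hunit hn).mul_right_eq_zero.1 (hb.symm.trans (map_zero g))
  exact NoZeroDivisors.to_isDomain _

end NoetherNormalization

section FrobeniusPair

theorem map_map_eq_pow {K A G : Type*} [Field K] {p : ℕ} [Fact p.Prime] [CharP K p]
    [CommRing A] [Algebra K A] [CommRing G] [Nontrivial G] [Algebra K G] {α : A →+* G}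
    {β : G →ₐ[K] A} (hα : ∀ k, α (algebraMap K A k) = algebraMap K G (k ^ p))
    (hβα : ∀ a, β (α a) = a ^ p) (hG : Algebra.adjoin K (Set.range α) = ⊤) (g : G) :
    α (β g) = g ^ p := by
  have : CharP G p := charP_of_injective_algebraMap (algebraMap K G).injective p
  have hg : g ∈ Algebra.adjoin K (Set.range α) := hG ▸ Algebra.mem_top
  induction hg using Algebra.adjoin_induction with
  | mem x hx =>
    obtain ⟨a, rfl⟩ := hx
    rw [hβα, map_pow]
  | algebraMap k => rw [β.commutes, hα, map_pow]
  | add x y _ _ hx hy => rw [map_add, map_add, hx, hy, add_pow_char]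
  | mul x y _ _ hx hy => rw [map_mul, map_mul, hx, hy, mul_pow]

theorem isSaturated_of_forall_exists_eq_pow {O₁ O : Type*} [CommRing O₁] [IsDomain O₁]
    [IsIntegrallyClosed O₁] [CommRing O] [IsDomain O] {j : O₁ →+* O} (hj : Function.Injective j)
    {n : ℕ} (hn : n ≠ 0) (hpow : ∀ x, ∃ c, j c = x ^ n) : IsSaturated j := by
  intro c d x hc hx
  obtain ⟨e, he⟩ := hpow x
  have hdvd : c ^ n ∣ d ^ n := ⟨e, hj (by rw [map_pow, ← hx, mul_pow, map_mul, map_pow, he])⟩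
  obtain ⟨f, rfl⟩ := (IsIntegrallyClosed.pow_dvd_pow_iff hn).1 hdvd
  exact ⟨f, mul_left_cancel₀ ((map_ne_zero_iff j hj).2 hc) (hx.trans (map_mul j c f))⟩

section Lift

variable {G N O : Type*} (κ : Type*) [CommRing G] [CommRing κ] [Algebra G κ] [CommRing N]
variable [Algebra G N] [Algebra N κ] [IsScalarTower G N κ] [IsIntegralClosure N G κ]

theorem exists_mul_algebraMap_eq_algebraMap [IsFractionRing G κ] (n : N) :
    ∃ g, ∃ h ∈ nonZeroDivisors G, n * algebraMap G N h = algebraMap G N g := by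
  obtain ⟨⟨g, h⟩, hgh⟩ := IsLocalization.surj (nonZeroDivisors G) (algebraMap N κ n)
  refine ⟨g, h, h.2, IsIntegralClosure.algebraMap_injective N G κ ?_⟩
  rw [map_mul, ← IsScalarTower.algebraMap_apply, ← IsScalarTower.algebraMap_apply, hgh]

theorem exists_ringHom_of_isIntegralClosure [IsDomain G] [IsFractionRing G κ] [CommRing O]
    [IsDomain O] [IsIntegrallyClosed O] {γ : G →+* O} (hγ : Function.Injective γ) :
    ∃ τ : N →+* O, Function.Injective τ ∧ ∀ g, τ (algebraMap G N g) = γ g := by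
  let _ : Field κ := IsFractionRing.toField G
  let E := FractionRing O
  have hOE : Function.Injective (algebraMap O E) := IsFractionRing.injective O E
  have hγE : Function.Injective ((algebraMap O E).comp γ) := hOE.comp hγ
  let ψ : κ →+* E := IsFractionRing.lift hγE
  let θ : N →+* E := ψ.comp (algebraMap N κ)
  have hθγ : (algebraMap O E).comp γ = θ.comp (algebraMap G N) := by
    ext g
    simp only [θ, RingHom.comp_apply, ← IsScalarTower.algebraMap_apply]
    exact (IsFractionRing.lift_algebraMap hγE g).symm
  have hmem (n : N) : θ n ∈ (Algebra.ofId O E).range := by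
    obtain ⟨f, hf, hfn⟩ := IsIntegralClosure.isIntegral G κ n
    refine IsIntegrallyClosed.isIntegral_iff.1 ⟨f.map γ, hf.map γ, ?_⟩
    rw [Polynomial.eval₂_map, hθγ, ← Polynomial.hom_eval₂, hfn, map_zero]
  let e := AlgEquiv.ofInjective (Algebra.ofId O E) hOE
  have he (x) : algebraMap O E (e.symm x) = x := congrArg Subtype.val (e.apply_symm_apply x)
  let τ : N →+* O := e.symm.toRingEquiv.toRingHom.comp (θ.codRestrict _ hmem)
  have hτ (n : N) : algebraMap O E (τ n) = θ n := he _
  refine ⟨τ, fun x y hxy => ?_, fun g => hOE ?_⟩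
  · refine IsIntegralClosure.algebraMap_injective N G κ (ψ.injective ?_)
    exact (hτ x).symm.trans ((congrArg _ hxy).trans (hτ y))
  · rw [hτ]
    exact (RingHom.congr_fun hθγ g).symm

theorem isIntegrallyClosed_of_isIntegralClosure [IsDomain G] [IsFractionRing G κ] :
    IsIntegrallyClosed N := by
  let _ : Field κ := IsFractionRing.toField G
  have : FaithfulSMul N κ := (faithfulSMul_iff_algebraMap_injective N κ).2
    (IsIntegralClosure.algebraMap_injective N G κ)
  have : IsIntegrallyClosedIn N κ := .of_isIntegralClosure G
  exact .of_isIntegrallyClosedIn N κ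

theorem exists_map_mul_eq_map [IsDomain G] [IsFractionRing G κ] [CommRing O] [IsDomain O]
    {γ : G →+* O} {τ : N →+* O} (hτ : Function.Injective τ)
    (hτγ : ∀ g, τ (algebraMap G N g) = γ g) {x : O} {n s : N} (hs : s ≠ 0) (hx : x * τ s = τ n) :
    ∃ g h : G, γ h ≠ 0 ∧ γ h * x = γ g := by
  obtain ⟨g, h, hh, hg⟩ := exists_mul_algebraMap_eq_algebraMap (G := G) κ n
  obtain ⟨g', h', hh', hg'⟩ := exists_mul_algebraMap_eq_algebraMap (G := G) κ s
  have hGN : Function.Injective (algebraMap G N) := by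
    refine .of_comp (f := algebraMap N κ) ?_
    rw [← RingHom.coe_comp, ← IsScalarTower.algebraMap_eq]
    exact IsFractionRing.injective G κ
  have hγ : Function.Injective γ := (funext hτγ : τ ∘ algebraMap G N = γ) ▸ hτ.comp hGN
  have hγ0 {k : G} (hk : k ∈ nonZeroDivisors G) : γ k ≠ 0 :=
    (map_ne_zero_iff γ hγ).2 (nonZeroDivisors.ne_zero hk)
  have hγg : τ n * γ h = γ g := by rw [← hτγ, ← hτγ, ← map_mul, hg]
  have hγg' : τ s * γ h' = γ g' := by rw [← hτγ, ← hτγ, ← map_mul, hg']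
  refine ⟨g * h', h * g', ?_, ?_⟩
  · rw [map_mul, ← hγg']
    exact mul_ne_zero (hγ0 hh) (mul_ne_zero ((map_ne_zero_iff τ hτ).2 hs) (hγ0 hh'))
  · rw [map_mul, map_mul, ← hγg, ← hγg', ← hx]
    ring

end Lift

section Localization

variable {A N O O₁ : Type*} [CommRing A] [CommRing N] [CommRing O] [Algebra A O] {p : ℕ}
variable {α : A →+* N} {τ : N →+* O} {P : Ideal A} [P.IsPrime] [IsLocalization.AtPrime O P]
variable {Q : Ideal N} [hQ : Q.IsPrime]

theorem isUnit_map_of_notMem (hτ : Function.Injective τ)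
    (hτα : ∀ a, τ (α a) = algebraMap A O a ^ p) (hPQ : ∀ a, α a ∈ Q ↔ a ∈ P) {n : N}
    (hn : n ∉ Q) : IsUnit (τ n) := by
  by_contra hu
  obtain ⟨⟨a, s⟩, has : τ n * algebraMap A O s = algebraMap A O a⟩ :=
    IsLocalization.surj P.primeCompl (τ n)
  have ha : a ∈ P := by
    by_contra ha
    have : IsUnit (algebraMap A O a) := IsLocalization.map_units O (⟨a, ha⟩ : P.primeCompl)
    exact hu (isUnit_of_mul_isUnit_left (has ▸ this))
  have hnp : n ^ p * α s = α a := hτ (by rw [map_mul, map_pow, hτα, hτα, ← mul_pow, has])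
  rcases hQ.mem_or_mem (hnp ▸ (hPQ a).2 ha) with h | h
  · exact hn (hQ.mem_of_pow_mem p h)
  · exact s.2 ((hPQ s).1 h)

theorem exists_ringHom_of_isLocalization_atPrime [CommRing O₁] [Algebra N O₁]
    [IsLocalization.AtPrime O₁ Q] (hτ : Function.Injective τ)
    (hτα : ∀ a, τ (α a) = algebraMap A O a ^ p) (hPQ : ∀ a, α a ∈ Q ↔ a ∈ P) :
    ∃ j : O₁ →+* O, Function.Injective j ∧ (∀ n, j (algebraMap N O₁ n) = τ n) ∧
      ∀ x, ∃ c, j c = x ^ p := by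
  let j : O₁ →+* O := IsLocalization.lift (M := Q.primeCompl)
    fun n => isUnit_map_of_notMem hτ hτα hPQ n.2
  have hj (n : N) : j (algebraMap N O₁ n) = τ n := IsLocalization.lift_eq _ _
  refine ⟨j, ?_, hj, fun x => ?_⟩
  · refine (IsLocalization.injective_iff_map_algebraMap_eq Q.primeCompl j).2 fun x y =>
      ⟨congrArg j, fun h => ?_⟩
    rw [hj, hj] at h
    rw [hτ h]
  · obtain ⟨⟨a, s⟩, has : x * algebraMap A O s = algebraMap A O a⟩ :=
      IsLocalization.surj P.primeCompl x
    obtain ⟨u, hu⟩ := IsLocalization.map_units O₁ (⟨α s, (hPQ s).not.2 s.2⟩ : Q.primeCompl)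
    refine ⟨algebraMap N O₁ (α a) * ↑u⁻¹,
      ((IsLocalization.map_units O s).pow p).mul_right_cancel ?_⟩
    rw [← mul_pow, has, ← hτα, ← hτα, ← hj, ← hj, ← map_mul, mul_assoc, ← hu, Units.inv_mul,
      mul_one]

end Localization

theorem exists_isFrobeniusSubring {K A G : Type*} [Field K] {p : ℕ} [hp : Fact p.Prime] [CharP K p]
    [CommRing A] [IsDomain A] [Algebra K A] [CommRing G] [IsDomain G] [Algebra K G] {α : A →+* G}
    {β : G →ₐ[K] A} (hα : ∀ k, α (algebraMap K A k) = algebraMap K G (k ^ p))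
    (hβα : ∀ a, β (α a) = a ^ p) (hG : Algebra.adjoin K (Set.range α) = ⊤)
    {O : Type*} [CommRing O] [IsDomain O] [IsIntegrallyClosed O] [Algebra K O] [Algebra A O]
    [IsScalarTower K A O] {P : Ideal A} [P.IsPrime] [IsLocalization.AtPrime O P]
    (κ : Type*) [CommRing κ] [Algebra G κ] [IsFractionRing G κ]
    {N : Type*} [CommRing N] [Algebra G N] [Algebra N κ] [IsScalarTower G N κ]
    [IsIntegralClosure N G κ] {Q : Ideal N} [Q.IsPrime]
    (hPQ : ∀ g, algebraMap G N g ∈ Q ↔ β g ∈ P)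
    {O₁ : Type*} [CommRing O₁] [Algebra K O₁] [Algebra N O₁] [IsLocalization.AtPrime O₁ Q]
    (hK : ∀ k, algebraMap K O₁ k = algebraMap N O₁ (algebraMap G N (algebraMap K G k))) :
    ∃ j : O₁ →ₐ[K] O, IsFrobeniusSubring p j := by
  have hp0 : p ≠ 0 := hp.out.ne_zero
  have hβ : Function.Injective β := (injective_iff_map_eq_zero β).2 fun g hg =>
    pow_eq_zero_iff hp0 |>.1 (by rw [← map_map_eq_pow hα hβα hG, hg, map_zero])
  let γ : G →ₐ[K] O := (IsScalarTower.toAlgHom K A O).comp β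
  have hγ : Function.Injective γ :=
    (IsLocalization.injective O P.primeCompl_le_nonZeroDivisors).comp hβ
  obtain ⟨τ, hτ, hτγ⟩ := exists_ringHom_of_isIntegralClosure κ (N := N) (γ := γ.toRingHom) hγ
  have hγα (a : A) : γ (α a) = algebraMap A O a ^ p := by
    rw [AlgHom.comp_apply, hβα, map_pow, IsScalarTower.coe_toAlgHom']
  obtain ⟨j₀, hj₀, hj₀τ, hpow⟩ := exists_ringHom_of_isLocalization_atPrime (O := O) (O₁ := O₁)
    (α := (algebraMap G N).comp α) (τ := τ) (P := P) (Q := Q) hτ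
    (fun a => (hτγ (α a)).trans (hγα a))
    fun a => (hPQ (α a)).trans (by rw [hβα]; exact ‹P.IsPrime›.pow_mem_iff_mem p hp.out.pos)
  have hjK (k : K) : j₀ (algebraMap K O₁ k) = algebraMap K O k := by
    rw [hK, hj₀τ, hτγ]
    exact γ.commutes k
  let j : O₁ →ₐ[K] O := { j₀ with commutes' := hjK }
  have := isIntegrallyClosed_of_isIntegralClosure (G := G) (N := N) κ
  have := hτ.isDomain τ
  have : IsIntegrallyClosed O₁ :=
    isIntegrallyClosed_of_isLocalization O₁ Q.primeCompl Q.primeCompl_le_nonZeroDivisors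
  have : IsDomain O₁ := hj₀.isDomain j₀
  refine ⟨j, hj₀, hpow, isSaturated_of_forall_exists_eq_pow hj₀ hp0 hpow, fun c => ?_⟩
  have hadj (g : G) : γ g ∈ Algebra.adjoin K (Set.range fun o : O => o ^ p) := by
    have hg : γ g ∈ (Algebra.adjoin K (Set.range α)).map γ := ⟨g, hG ▸ Algebra.mem_top, rfl⟩
    rw [AlgHom.map_adjoin] at hg
    refine Algebra.adjoin_mono ?_ hg
    rintro _ ⟨_, ⟨a, rfl⟩, rfl⟩
    exact ⟨algebraMap A O a, (hγα a).symm⟩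
  obtain ⟨⟨n, s⟩, hns : c * algebraMap N O₁ s = algebraMap N O₁ n⟩ :=
    IsLocalization.surj Q.primeCompl c
  have hs : (s : N) ≠ 0 := fun hs => s.2 (hs ▸ Q.zero_mem)
  obtain ⟨g, h, hh, hgh⟩ := exists_map_mul_eq_map κ (x := j₀ c) hτ hτγ hs
    (n := n) (by rw [← hj₀τ, ← hj₀τ, ← map_mul, hns])
  exact ⟨γ g, hadj g, γ h, hadj h, hh, hgh⟩

end FrobeniusPair

/-! ### Rings of sections of schemes over a field -/

section Sections

variable {K : Type u} [Field K] {X Y : Scheme.{u}} (f : X ⟶ Spec (.of K))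

/-- The structure map from `K` to the sections of a `K`-scheme over an open subset. -/
noncomputable def toSections (U : X.Opens) : K →+* Γ(X, U) :=
  ((Scheme.ΓSpecIso (.of K)).inv ≫ f.appLE ⊤ U le_top).hom

/-- The germ map with values in the local ring of a `K`-scheme regarded as a `K`-algebra. -/
noncomputable def toLocalRing {U : X.Opens} {x : X} (hx : x ∈ U) : Γ(X, U) →+* LocalRing f x :=
  (X.presheaf.germ U x hx).hom

theorem toLocalRing_toSections {U : X.Opens} {x : X} (hx : x ∈ U) (k : K) :
    toLocalRing f hx (toSections f U k) = algebraMap K (LocalRing f x) k := by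
  have hres := X.presheaf.germ_res (homOfLE (le_top : U ≤ ⊤)) x hx
  exact congr((Scheme.ΓSpecIso (.of K)).inv ≫ f.appTop ≫ $hres |>.hom k)

theorem appLE_toSections (g : Y ⟶ X) {U : X.Opens} {V : Y.Opens} (e : V ≤ g ⁻¹ᵁ U) (k : K) :
    (g.appLE U V e).hom (toSections f U k) = toSections (g ≫ f) V k :=
  congr((Scheme.ΓSpecIso (.of K)).inv ≫
    $(Scheme.Hom.appLE_comp_appLE g f ⊤ U V le_top e) |>.hom k)

theorem ΓSpecIso_inv_appLE_top {K L : Type u} [CommRing K] [CommRing L] (φ : K →+* L) :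
    (Scheme.ΓSpecIso (.of K)).inv ≫ (Spec.map (CommRingCat.ofHom φ)).appLE ⊤ ⊤ le_top =
      CommRingCat.ofHom φ ≫ (Scheme.ΓSpecIso (.of L)).inv := by
  rw [Scheme.ΓSpecIso_inv_naturality, Scheme.Hom.appTop, Scheme.Hom.app_eq_appLE]
  rfl

theorem toSections_comp_specMap {K' : Type u} [Field K'] (φ : K' →+* K) (U : X.Opens) (k : K') :
    toSections (f ≫ Spec.map (CommRingCat.ofHom φ)) U k = toSections f U (φ k) := by
  have h : (Scheme.ΓSpecIso (.of K')).inv ≫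
      (f ≫ Spec.map (CommRingCat.ofHom φ)).appLE ⊤ U le_top =
      CommRingCat.ofHom φ ≫ (Scheme.ΓSpecIso (.of K)).inv ≫ f.appLE ⊤ U le_top := by
    rw [← Scheme.Hom.appLE_comp_appLE f _ ⊤ ⊤ U le_top le_top,
      reassoc_of% ΓSpecIso_inv_appLE_top φ]
  exact congr($h |>.hom k)

theorem isPushout_toSections {L : Type u} [Field L] {φ : K →+* L} {f : X ⟶ Spec (.of K)}
    {g : Y ⟶ X} {h : Y ⟶ Spec (.of L)}
    (H : IsPullback g h f (Spec.map (CommRingCat.ofHom φ))) {U : X.Opens} (hU : IsAffineOpen U)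
    {V : Y.Opens} (hV : V = g ⁻¹ᵁ U) :
    IsPushout (CommRingCat.ofHom (toSections f U)) (CommRingCat.ofHom φ)
      (g.appLE U V hV.le) (CommRingCat.ofHom (toSections h V)) := by
  have hpush := (isIso_pushoutSection_iff H (US := ⊤) (UT := ⊤) (UX := U) (UY := V)
    le_top le_top (by simp [hV])).1
      (isIso_pushoutSection_of_isAffineOpen H _ _ _ (isAffineOpen_top _) (isAffineOpen_top _) hU)
  refine IsPushout.of_iso hpush (Scheme.ΓSpecIso (.of K)) (Iso.refl _) (Scheme.ΓSpecIso (.of L))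
    (Iso.refl _) ?_ ?_ ?_ ?_
  · rw [← Iso.inv_comp_eq]
    exact (Category.comp_id _).symm
  · rw [← Iso.inv_comp_eq, ← Category.assoc, ΓSpecIso_inv_appLE_top, Category.assoc,
      Iso.inv_hom_id, Category.comp_id]
  · simp
  · rw [← Iso.inv_comp_eq]
    exact (Category.comp_id _).symm

theorem finiteType_toSections [LocallyOfFiniteType f] {U : X.Opens} (hU : IsAffineOpen U) :
    (toSections f U).FiniteType :=
  (f.finiteType_appLE (isAffineOpen_top _) hU le_top).comp (RingHom.FiniteType.of_surjective _
    (Scheme.ΓSpecIso (.of K)).symm.commRingCatIsoToRingEquiv.surjective)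

end Sections

section Pushout

variable {R S T G : Type u} [CommRing R] [CommRing S] [CommRing T] [CommRing G]

theorem adjoin_range_eq_top_of_isPushout [Algebra T G] {a : R →+* S} {b : R →+* T} {c : S →+* G}
    (h : IsPushout (CommRingCat.ofHom a) (CommRingCat.ofHom b) (CommRingCat.ofHom c)
      (CommRingCat.ofHom (algebraMap T G))) :
    Algebra.adjoin T (Set.range c) = ⊤ := by
  rw [← Algebra.toSubring_eq_top, Algebra.adjoin_eq_ring_closure, Set.union_comm]
  exact CommRingCat.closure_range_union_range_eq_top_of_isPushout h

theorem isDomain_tensorProduct_of_isPushout [Algebra R S] [Algebra R T] [IsDomain G]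
    {c : S →+* G} {l : T →+* G}
    (h : IsPushout (CommRingCat.ofHom (algebraMap R S)) (CommRingCat.ofHom (algebraMap R T))
      (CommRingCat.ofHom c) (CommRingCat.ofHom l)) : IsDomain (T ⊗[R] S) :=
  ((CommRingCat.isPushout_tensorProduct R T S).flip.isoIsPushout _ _
    h).commRingCatIsoToRingEquiv.toMulEquiv.isDomain _

end Pushout

/-! ### Regular closed points of curves -/

section Curve

theorem topologicalKrullDim_le_zero_of_isClosed_genericPoint {X : Type*} [TopologicalSpace X]
    [QuasiSober X] [IrreducibleSpace X] (h : IsClosed ({genericPoint X} : Set X)) :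
    topologicalKrullDim X ≤ 0 := by
  have huniv : {genericPoint X} = Set.univ := h.closure_eq.symm.trans (genericPoint_closure X)
  have : Subsingleton X := ⟨fun x y =>
    Set.subsingleton_singleton (huniv ▸ Set.mem_univ x) (huniv ▸ Set.mem_univ y)⟩
  have : DiscreteTopology X := Subsingleton.discreteTopology
  exact topologicalKrullDim_zero_of_discreteTopology X

theorem isDiscreteValuationRing_of_ringKrullDim_le_one {O : Type*} [CommRing O] [IsDomain O]
    [IsRegularLocalRing O] (hdim : ringKrullDim O ≤ 1) (hO : ¬ IsField O) :
    IsDiscreteValuationRing O := by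
  rw [← (IsRegularLocalRing.iff_finrank_cotangentSpace O).1 ‹_›] at hdim
  have hprincipal : (IsLocalRing.maximalIdeal O).IsPrincipal :=
    IsLocalRing.finrank_cotangentSpace_le_one_iff.1 (by exact_mod_cast hdim)
  exact ((IsDiscreteValuationRing.TFAE O hO).out 0 4).2 hprincipal

variable {X : Scheme.{u}} {U : X.Opens} (hU : IsAffineOpen U)
include hU

theorem ringKrullDim_le_topologicalKrullDim : ringKrullDim Γ(X, U) ≤ topologicalKrullDim X := by
  rw [← PrimeSpectrum.topologicalKrullDim_eq_ringKrullDim Γ(X, U)]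
  change topologicalKrullDim (Spec Γ(X, U)) ≤ _
  rw [← IsHomeomorph.topologicalKrullDim_eq _ hU.isoSpec.hom.homeomorph.isHomeomorph]
  exact topologicalKrullDim_subspace_le X U

theorem eq_genericPoint_of_primeIdealOf_eq_bot [IsIntegral X] {x : X} (hxU : x ∈ U)
    (h : (hU.primeIdealOf ⟨x, hxU⟩).asIdeal = ⊥) : x = genericPoint X := by
  have : Nonempty U := ⟨⟨x, hxU⟩⟩
  have hgen : genericPoint X ∈ U := (genericPoint_specializes x).mem_open U.isOpen hxU
  have hprime : hU.primeIdealOf ⟨x, hxU⟩ = hU.primeIdealOf ⟨genericPoint X, hgen⟩ := by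
    rw [hU.primeIdealOf_genericPoint, genericPoint_eq_bot_of_affine]
    exact PrimeSpectrum.ext h
  simpa only [hU.fromSpec_primeIdealOf] using congrArg hU.fromSpec hprime

theorem primeIdealOf_ne_bot [IsIntegral X] (hdim : ¬ topologicalKrullDim X ≤ 0) {x : X}
    (hx : IsClosed ({x} : Set X)) (hxU : x ∈ U) : (hU.primeIdealOf ⟨x, hxU⟩).asIdeal ≠ ⊥ := by
  intro h
  rw [eq_genericPoint_of_primeIdealOf_eq_bot hU hxU h] at hx
  exact hdim (topologicalKrullDim_le_zero_of_isClosed_genericPoint hx)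

end Curve

section RegularPoint

variable {K : Type u} [Field K] {C : Scheme.{u}} (f : C ⟶ Spec (.of K)) {U : C.Opens}

theorem isDiscreteValuationRing_stalk [IsIntegral C] (hdim : topologicalKrullDim C = 1) {P : C}
    (hP : IsClosed ({P} : Set C)) [IsRegularLocalRing (C.presheaf.stalk P)] :
    IsDiscreteValuationRing (C.presheaf.stalk P) := by
  obtain ⟨U, hU, hPU, -⟩ := exists_isAffineOpen_mem_and_subset (Opens.mem_top P)
  have : Nonempty U := ⟨⟨P, hPU⟩⟩
  let _ := (C.presheaf.germ U P hPU).hom.toAlgebra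
  have : IsLocalization.AtPrime (C.presheaf.stalk P) (hU.primeIdealOf ⟨P, hPU⟩).asIdeal :=
    hU.isLocalization_stalk ⟨P, hPU⟩
  refine isDiscreteValuationRing_of_ringKrullDim_le_one ?_ (IsLocalization.AtPrime.not_isField
    Γ(C, U) (primeIdealOf_ne_bot hU (by rw [hdim]; norm_num) hP hPU) _)
  rw [IsLocalization.AtPrime.ringKrullDim_eq_height (hU.primeIdealOf ⟨P, hPU⟩).asIdeal]
  exact (Ideal.height_le_ringKrullDim_of_ne_top (Ideal.IsPrime.ne_top inferInstance)).trans
    (hdim ▸ ringKrullDim_le_topologicalKrullDim hU)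

theorem isDomain_tensorProduct_sections (L : Type u) [Field L] [Algebra K L]
    [GeometricallyIntegral f] (hU : IsAffineOpen U) [hne : Nonempty U] :
    letI := (toSections f U).toAlgebra
    IsDomain (L ⊗[K] Γ(C, U)) := by
  let _ := (toSections f U).toAlgebra
  let s : Spec (.of L) ⟶ Spec (.of K) := Spec.map (CommRingCat.ofHom (algebraMap K L))
  have : IsIntegral (pullback f s) :=
    pullback_of_geometrically (GeometricallyIntegral.geometrically_isIntegral (f := f)) L s
  have : Surjective s := ⟨fun x => ⟨(⊥ : PrimeSpectrum L), Subsingleton.elim _ _⟩⟩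
  obtain ⟨x, hx⟩ := (pullback.fst f s).surjective hne.some.1
  have : Nonempty (pullback.fst f s ⁻¹ᵁ U) := ⟨⟨x, (hx ▸ hne.some.2 :)⟩⟩
  exact isDomain_tensorProduct_of_isPushout
    (isPushout_toSections (IsPullback.of_hasPullback f s) hU rfl)

theorem isDomain_tensorProduct_localRing (L : Type u) [Field L] [Algebra K L] [IsIntegral C]
    [GeometricallyIntegral f] (P : C) : IsDomain (L ⊗[K] LocalRing f P) := by
  obtain ⟨U, hU, hPU, -⟩ := exists_isAffineOpen_mem_and_subset (Opens.mem_top P)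
  have : Nonempty U := ⟨⟨P, hPU⟩⟩
  let _ : Algebra K Γ(C, U) := (toSections f U).toAlgebra
  let _ : Algebra Γ(C, U) (LocalRing f P) := (toLocalRing f hPU).toAlgebra
  have : IsScalarTower K Γ(C, U) (LocalRing f P) :=
    .of_algebraMap_eq fun k => (toLocalRing_toSections f hPU k).symm
  have : IsLocalization.AtPrime (LocalRing f P) (hU.primeIdealOf ⟨P, hPU⟩).asIdeal :=
    hU.isLocalization_stalk ⟨P, hPU⟩
  have : IsDomain (L ⊗[K] Γ(C, U)) := isDomain_tensorProduct_sections f L hU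
  exact isDomain_tensorProduct_of_isLocalization
    (hU.primeIdealOf ⟨P, hPU⟩).asIdeal.primeCompl_le_nonZeroDivisors

theorem exists_isLocalization_finite_polynomial_algHom [IsIntegral C] [LocallyOfFiniteType f]
    (hdim : topologicalKrullDim C = 1) {P : C} (hP : IsClosed ({P} : Set C)) :
    ∃ (A : Type u) (_ : CommRing A) (_ : Algebra K A) (_ : Algebra A (LocalRing f P))
      (_ : IsScalarTower K A (LocalRing f P)) (M : Submonoid A)
      (_ : IsLocalization M (LocalRing f P))
      (φ : Polynomial K →ₐ[K] A), φ.toRingHom.Finite ∧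
        algebraMap A (LocalRing f P) (φ Polynomial.X) ≠ 0 ∧
        ¬ IsUnit (algebraMap A (LocalRing f P) (φ Polynomial.X)) := by
  obtain ⟨U, hU, hPU, -⟩ := exists_isAffineOpen_mem_and_subset (Opens.mem_top P)
  have : Nonempty U := ⟨⟨P, hPU⟩⟩
  let _ : Algebra K Γ(C, U) := (toSections f U).toAlgebra
  let _ : Algebra Γ(C, U) (LocalRing f P) := (toLocalRing f hPU).toAlgebra
  have htower : IsScalarTower K Γ(C, U) (LocalRing f P) :=
    .of_algebraMap_eq fun k => (toLocalRing_toSections f hPU k).symm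
  set I := (hU.primeIdealOf ⟨P, hPU⟩).asIdeal
  have hloc : IsLocalization.AtPrime (LocalRing f P) I := hU.isLocalization_stalk ⟨P, hPU⟩
  have : Algebra.FiniteType K Γ(C, U) := finiteType_toSections f hU
  have hdimU : ringKrullDim Γ(C, U) ≤ 1 := hdim ▸ ringKrullDim_le_topologicalKrullDim hU
  have : Ring.DimensionLEOne Γ(C, U) := ⟨fun {Q} hQ0 hQ =>
    Ring.krullDimLE_one_iff_of_isPrime_bot.1 (Ring.krullDimLE_iff.2 hdimU) Q hQ0 hQ⟩
  obtain ⟨φ, hφ, hX0, hXI⟩ := exists_finite_polynomial_algHom (K := K)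
    (primeIdealOf_ne_bot hU (by rw [hdim]; norm_num) hP hPU)
  refine ⟨Γ(C, U), inferInstance, inferInstance, inferInstance, htower, I.primeCompl, hloc, φ, hφ,
    ?_, ?_⟩
  · exact (map_ne_zero_iff _ (IsLocalization.injective _ I.primeCompl_le_nonZeroDivisors)).2 hX0
  · rw [IsLocalization.AtPrime.isUnit_to_map_iff (LocalRing f P) I]
    exact fun h => h hXI

end RegularPoint

/-! ### The local ring of the normalized Frobenius twist -/

section Normalization

theorem isFractionRing_fromSpecStalk_app {X : Scheme.{u}} [IsIntegral X] {V : X.Opens}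
    (hV : IsAffineOpen V) (hgen : genericPoint X ∈ V) :
    letI := ((X.fromSpecStalk (genericPoint X)).app V).hom.toAlgebra
    IsFractionRing Γ(X, V)
      Γ(Spec (X.presheaf.stalk (genericPoint X)), X.fromSpecStalk (genericPoint X) ⁻¹ᵁ V) := by
  set ι := X.fromSpecStalk (genericPoint X)
  let _ := (ι.app V).hom.toAlgebra
  have : Nonempty V := ⟨⟨_, hgen⟩⟩
  have := functionField_isFractionRing_of_isAffineOpen X V hV
  have htop : ⊤ = ι ⁻¹ᵁ V := by
    refine (eq_top_iff.2 fun y _ => ?_).symm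
    have hy : ι y ⤳ genericPoint X :=
      (Scheme.range_fromSpecStalk (x := genericPoint X)).subset ⟨y, rfl⟩
    exact hy.mem_open V.isOpen hgen
  let e : X.functionField ≅ Γ(Spec (X.presheaf.stalk (genericPoint X)), ι ⁻¹ᵁ V) :=
    (Scheme.ΓSpecIso _).symm ≪≫
      (Spec (X.presheaf.stalk (genericPoint X))).presheaf.mapIso (eqToIso htop).symm.op
  have he : X.presheaf.germ V (genericPoint X) hgen ≫ e.hom = ι.app V := by
    rw [Scheme.fromSpecStalk_app hgen]
    rfl
  exact IsLocalization.isLocalization_of_algEquiv _ (AlgEquiv.ofRingEquiv (R := Γ(X, V))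
    (f := e.commRingCatIsoToRingEquiv) fun x => congr($he |>.hom x))

section Relative

variable {X Y : Scheme.{u}} (f : X ⟶ Y) [QuasiCompact f] [QuasiSeparated f] {V : Y.Opens}

theorem preimage_le_preimage_fromNormalization :
    f ⁻¹ᵁ V ≤ f.toNormalization ⁻¹ᵁ f.fromNormalization ⁻¹ᵁ V := by
  rw [← Scheme.Hom.comp_preimage, f.toNormalization_fromNormalization]

theorem fromNormalization_app_comp_toNormalization_appLE :
    f.fromNormalization.app V ≫ f.toNormalization.appLE (f.fromNormalization ⁻¹ᵁ V) (f ⁻¹ᵁ V)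
      (preimage_le_preimage_fromNormalization f) = f.app V := by
  simp only [Scheme.Hom.app_eq_appLE, Scheme.Hom.appLE_comp_appLE,
    f.toNormalization_fromNormalization]

theorem isIntegralClosure_toNormalization_appLE (hV : IsAffineOpen V) :
    letI := (f.app V).hom.toAlgebra
    letI := (f.toNormalization.appLE (f.fromNormalization ⁻¹ᵁ V) (f ⁻¹ᵁ V)
      (preimage_le_preimage_fromNormalization f)).hom.toAlgebra
    IsIntegralClosure Γ(f.normalization, f.fromNormalization ⁻¹ᵁ V) Γ(Y, V) Γ(X, f ⁻¹ᵁ V) := by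
  let _ := (f.app V).hom.toAlgebra
  let _ := (f.toNormalization.appLE (f.fromNormalization ⁻¹ᵁ V) (f ⁻¹ᵁ V)
    (preimage_le_preimage_fromNormalization f)).hom.toAlgebra
  let e : Γ(f.normalization, f.fromNormalization ⁻¹ᵁ V) ≃+*
      integralClosure Γ(Y, V) Γ(X, f ⁻¹ᵁ V) := (f.normalizationObjIso hV).commRingCatIsoToRingEquiv
  have he (s) : algebraMap _ Γ(X, f ⁻¹ᵁ V) s = e s :=
    congr($(f.normalizationObjIso_hom_val hV).hom s).symm
  refine ⟨fun x y hxy => ?_, fun {x} => ⟨fun hx => ?_, ?_⟩⟩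
  · rw [he, he] at hxy
    exact e.injective (Subtype.ext hxy)
  · obtain ⟨y, hy⟩ := e.surjective ⟨x, hx⟩
    exact ⟨y, (he y).trans (congrArg Subtype.val hy)⟩
  · rintro ⟨y, rfl⟩
    rw [he]
    exact (e y).2

end Relative

end Normalization

theorem appLE_mem_primeIdealOf_iff {X Y : Scheme.{u}} {f : X ⟶ Y} {x : X} {y : Y} (hxy : f x = y)
    {V : Y.Opens} (hV : IsAffineOpen V) {U : X.Opens} (hU : IsAffineOpen U) (hUV : U ≤ f ⁻¹ᵁ V)
    (hx : x ∈ U) (hy : y ∈ V) (s : Γ(Y, V)) :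
    (f.appLE V U hUV).hom s ∈ (hU.primeIdealOf ⟨x, hx⟩).asIdeal ↔
      s ∈ (hV.primeIdealOf ⟨y, hy⟩).asIdeal := by
  subst hxy
  rw [← IsAffineOpen.comap_primeIdealOf_appLE V hV U hU hUV hx]
  rfl

theorem appLE_appLE_of_comp_eq_absoluteFrobenius {X Y : Scheme.{u}} {p : ℕ} [Fact p.Prime]
    {h : (p : Γ(X, ⊤)) = 0} {F : X ⟶ Y} {g : Y ⟶ X} (hF : F ≫ g = absoluteFrobenius X p h)
    {U : X.Opens} {V : Y.Opens} (hVU : V ≤ g ⁻¹ᵁ U) (hUV : U ≤ F ⁻¹ᵁ V) (s : Γ(X, U)) :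
    (F.appLE V U hUV).hom ((g.appLE U V hVU).hom s) = s ^ p := by
  have hcomp : g.appLE U V hVU ≫ F.appLE V U hUV = (absoluteFrobenius X p h).app U := by
    rw [Scheme.Hom.appLE_comp_appLE, Scheme.Hom.app_eq_appLE]
    congr 1
  exact congr($hcomp |>.hom s)

section Frobenius

variable {K : Type u} [Field K] {p : ℕ} [Fact p.Prime] [CharP K p]

theorem appLE_toSections_of_isPullback {C Y : Scheme.{u}} {f : C ⟶ Spec (.of K)} {pr : Y ⟶ C}
    {str : Y ⟶ Spec (.of K)} (hpb : IsPullback pr str f (specFrobenius p K)) {U : C.Opens}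
    {V : Y.Opens} (hVU : V ≤ pr ⁻¹ᵁ U) (k : K) :
    (pr.appLE U V hVU).hom (toSections f U k) = toSections str V (k ^ p) := by
  rw [appLE_toSections, hpb.w]
  exact toSections_comp_specMap str (frobenius K p) V k

theorem exists_isFrobeniusSubring_of_isAffineOpen {C Y Z : Scheme.{u}} [IsIntegral C]
    [IsIntegral Y] {f : C ⟶ Spec (.of K)} {pr : Y ⟶ C} {str : Y ⟶ Spec (.of K)} {F : C ⟶ Y}
    (hpb : IsPullback pr str f (specFrobenius p K))
    (hFpr : F ≫ pr = absoluteFrobenius C p (natCast_globalSections_eq_zero p f))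
    (hFstr : F ≫ str = f) {ι : Z ⟶ Y} [QuasiCompact ι] [QuasiSeparated ι] {P : C}
    [IsDomain (LocalRing f P)] [IsIntegrallyClosed (LocalRing f P)] {P₁ : ι.normalization}
    (hP₁ : ι.fromNormalization P₁ = F P) {U : C.Opens} (hU : IsAffineOpen U) (hPU : P ∈ U)
    {V : Y.Opens} (hV : IsAffineOpen V) (hVU : V = pr ⁻¹ᵁ U) (hUV : U ≤ F ⁻¹ᵁ V)
    (hfrac : letI := (ι.app V).hom.toAlgebra; IsFractionRing Γ(Y, V) Γ(Z, ι ⁻¹ᵁ V)) :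
    ∃ j : LocalRing (ι.fromNormalization ≫ str) P₁ →ₐ[K] LocalRing f P,
      IsFrobeniusSubring p j := by
  have hW : IsAffineOpen (ι.fromNormalization ⁻¹ᵁ V) := hV.preimage _
  have hFP : F P ∈ V := hUV hPU
  have hP₁W : P₁ ∈ ι.fromNormalization ⁻¹ᵁ V := by
    rwa [← hP₁] at hFP
  have : Nonempty U := ⟨⟨P, hPU⟩⟩
  have : Nonempty V := ⟨⟨F P, hFP⟩⟩
  let _ := (toSections f U).toAlgebra
  let _ := (toSections str V).toAlgebra
  let _ := (ι.app V).hom.toAlgebra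
  let _ := (ι.fromNormalization.app V).hom.toAlgebra
  let _ := (ι.toNormalization.appLE (ι.fromNormalization ⁻¹ᵁ V) (ι ⁻¹ᵁ V)
    (preimage_le_preimage_fromNormalization ι)).hom.toAlgebra
  let _ := (toLocalRing f hPU).toAlgebra
  let _ := (toLocalRing (ι.fromNormalization ≫ str) hP₁W).toAlgebra
  have : IsScalarTower Γ(Y, V) Γ(ι.normalization, ι.fromNormalization ⁻¹ᵁ V) Γ(Z, ι ⁻¹ᵁ V) :=
    .of_algebraMap_eq fun s =>
      congr($(fromNormalization_app_comp_toNormalization_appLE ι).hom s).symm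
  have : IsScalarTower K Γ(C, U) (LocalRing f P) :=
    .of_algebraMap_eq fun k => (toLocalRing_toSections f hPU k).symm
  have := isIntegralClosure_toNormalization_appLE ι hV
  have : IsLocalization.AtPrime (LocalRing f P) (hU.primeIdealOf ⟨P, hPU⟩).asIdeal :=
    hU.isLocalization_stalk ⟨P, hPU⟩
  have : IsLocalization.AtPrime (LocalRing (ι.fromNormalization ≫ str) P₁)
      (hW.primeIdealOf ⟨P₁, hP₁W⟩).asIdeal := hW.isLocalization_stalk ⟨P₁, hP₁W⟩
  let β : Γ(Y, V) →ₐ[K] Γ(C, U) :=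
    { (F.appLE V U hUV).hom with
      commutes' := fun k => (appLE_toSections str F hUV k).trans (by rw [hFstr]; rfl) }
  refine exists_isFrobeniusSubring (β := β) (P := (hU.primeIdealOf ⟨P, hPU⟩).asIdeal)
    (Q := (hW.primeIdealOf ⟨P₁, hP₁W⟩).asIdeal) (appLE_toSections_of_isPullback hpb hVU.le)
    (appLE_appLE_of_comp_eq_absoluteFrobenius hFpr hVU.le hUV)
    (adjoin_range_eq_top_of_isPushout (isPushout_toSections hpb hU hVU)) Γ(Z, ι ⁻¹ᵁ V)
    (fun s => ?_) fun k => ?_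
  · rw [RingHom.algebraMap_toAlgebra, Scheme.Hom.app_eq_appLE]
    exact (appLE_mem_primeIdealOf_iff hP₁ hV hW le_rfl hP₁W hFP s).trans
      (appLE_mem_primeIdealOf_iff rfl hV hU hUV hPU hFP s).symm
  · rw [RingHom.algebraMap_toAlgebra (ι.fromNormalization.app V).hom, Scheme.Hom.app_eq_appLE]
    exact (toLocalRing_toSections (ι.fromNormalization ≫ str) hP₁W k).symm.trans <|
      congrArg _ (appLE_toSections str ι.fromNormalization le_rfl k).symm

theorem exists_isFrobeniusSubring_of_normalization {C Y Z : Scheme.{u}} [IsIntegral C]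
    [IsIntegral Y] {f : C ⟶ Spec (.of K)} {pr : Y ⟶ C} {str : Y ⟶ Spec (.of K)} {F : C ⟶ Y}
    (hpb : IsPullback pr str f (specFrobenius p K))
    (hFpr : F ≫ pr = absoluteFrobenius C p (natCast_globalSections_eq_zero p f))
    (hFstr : F ≫ str = f) {ι : Z ⟶ Y} [QuasiCompact ι] [QuasiSeparated ι]
    (hfrac : ∀ V : Y.Opens, IsAffineOpen V → Nonempty V →
      letI := (ι.app V).hom.toAlgebra; IsFractionRing Γ(Y, V) Γ(Z, ι ⁻¹ᵁ V))
    {P : C} [IsDomain (LocalRing f P)] [IsIntegrallyClosed (LocalRing f P)]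
    {P₁ : ι.normalization} (hP₁ : ι.fromNormalization P₁ = F P) :
    ∃ j : LocalRing (ι.fromNormalization ≫ str) P₁ →ₐ[K] LocalRing f P,
      IsFrobeniusSubring p j := by
  obtain ⟨U, hU, hPU, -⟩ := exists_isAffineOpen_mem_and_subset (Opens.mem_top P)
  have : IsAffineHom (specFrobenius p K) := by
    unfold specFrobenius
    infer_instance
  have : IsAffineHom pr := MorphismProperty.of_isPullback hpb.flip inferInstance
  have hUV : U ≤ F ⁻¹ᵁ pr ⁻¹ᵁ U := by
    rw [← Scheme.Hom.comp_preimage, hFpr]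
    exact le_rfl
  have hV := hU.preimage pr
  exact exists_isFrobeniusSubring_of_isAffineOpen hpb hFpr hFstr hP₁ hU hPU hV rfl hUV
    (hfrac _ hV ⟨⟨F P, hUV hPU⟩⟩)

theorem exists_isFrobeniusSubring_of_isPullback {C Y : Scheme.{u}} [IsIntegral C]
    [IsIntegral Y] [QuasiSeparatedSpace Y] {f : C ⟶ Spec (.of K)} {pr : Y ⟶ C}
    {str : Y ⟶ Spec (.of K)} {F : C ⟶ Y} (hpb : IsPullback pr str f (specFrobenius p K))
    (hFpr : F ≫ pr = absoluteFrobenius C p (natCast_globalSections_eq_zero p f))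
    (hFstr : F ≫ str = f) {P : C} [IsDomain (LocalRing f P)] [IsIntegrallyClosed (LocalRing f P)]
    {P₁ : normalization Y} (hP₁ : normalizationMap Y P₁ = F P) :
    ∃ j : LocalRing (normalizationMap Y ≫ str) P₁ →ₐ[K] LocalRing f P, IsFrobeniusSubring p j :=
  exists_isFrobeniusSubring_of_normalization hpb hFpr hFstr
    (fun _ hV ⟨x⟩ => isFractionRing_fromSpecStalk_app hV
      ((genericPoint_specializes x.1).mem_open (Opens.isOpen _) x.2)) hP₁

instance quasiSeparatedSpace_frobeniusTwist_of_locallyOfFiniteType {X : Scheme.{u}}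
    (f : X ⟶ Spec (.of K)) [LocallyOfFiniteType f] : QuasiSeparatedSpace (frobeniusTwist p f) :=
  have : LocallyOfFiniteType (frobeniusTwistStr p f) :=
    MorphismProperty.of_isPullback (isPullback_frobeniusTwist p f) ‹_›
  have : IsLocallyNoetherian (frobeniusTwist p f) :=
    LocallyOfFiniteType.isLocallyNoetherian (frobeniusTwistStr p f)
  inferInstance

end Frobenius

end FrobCurve

open FrobCurve in
theorem mainTheorem7_general {K : Type u} [Field K] [IsSepClosed K] (p : ℕ) [Fact p.Prime]
    [CharP K p] (L : Type u) [Field L] [Algebra K L] [IsAlgClosure K L]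
    (C : Scheme.{u}) (f : C ⟶ Spec (.of K)) [GeometricallyIntegral f]
    [LocallyOfFiniteType f] (hdim : topologicalKrullDim C = 1)
    (P : C) (hP : IsClosed ({P} : Set C)) (hreg : IsRegularLocalRing (C.presheaf.stalk P))
    (P₁ : normalization (frobeniusTwist p f))
    (hP₁ : normalizationMap (frobeniusTwist p f) P₁ = relativeFrobenius p f P)
    (hd : differentialDegree K L
      (LocalRing (normalizationMap (frobeniusTwist p f) ≫ frobeniusTwistStr p f) P₁) = 1) :
    ∃ (_ : IsDomain (GeomNorm K L (LocalRing f P)))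
      (_ : IsDiscreteValuationRing (GeomNorm K L (LocalRing f P))),
      Module.Finite L (DiffCoker K L (LocalRing f P)) ∧
      semigroup K L (LocalRing f P) =
        {l : ℤ | ∃ a b : ℕ, l = differentialDegree K L (LocalRing f P) * a + p * b} ∧
      Module.Finite L (DeltaQuotient K L (LocalRing f P)) ∧
      (deltaInvariant K L (LocalRing f P) : ℚ) =
        ((differentialDegree K L (LocalRing f P) : ℚ) - 1) * ((p : ℚ) - 1) / 2 := by
  have : IsIntegral C := GeometricallyIntegral.isIntegral_of_subsingleton f
  have : IsDomain (LocalRing f P) := inferInstanceAs (IsDomain (C.presheaf.stalk P))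
  have : IsDiscreteValuationRing (LocalRing f P) := isDiscreteValuationRing_stalk hdim hP
  have : IsDomain (L ⊗[K] LocalRing f P) := isDomain_tensorProduct_localRing f L P
  obtain ⟨A, _, _, _, _, M, _, φ, hφ, h0, hu⟩ :=
    exists_isLocalization_finite_polynomial_algHom f hdim hP
  obtain ⟨j, hj⟩ :=
    exists_isFrobeniusSubring_of_isPullback (Y := frobeniusTwist p f)
      (F := relativeFrobenius p f) (isPullback_frobeniusTwist p f)
      (pullback.lift_fst _ _ _) (pullback.lift_snd _ _ _) hP₁
  exact invariants_of_isFrobeniusSubring M hφ h0 hu hj hd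

theorem mainTheorem7 {K : Type u} [Field K] [IsSepClosed K] (p : ℕ) [Fact p.Prime] [CharP K p]
    (L : Type u) [Field L] [Algebra K L] [IsAlgClosure K L]
    (C : Scheme.{u}) (f : C ⟶ Spec (.of K)) [GeometricallyIntegral f] [IsSeparated f]
    [LocallyOfFiniteType f] [QuasiCompact f] (hdim : topologicalKrullDim C = 1)
    (P : C) (hP : IsClosed ({P} : Set C)) (hreg : IsRegularLocalRing (C.presheaf.stalk P))
    (P₁ : FrobCurve.normalizedFrobenius p f)
    (hP₁ : FrobCurve.normalizedFrobeniusMap p f P₁ = FrobCurve.relativeFrobenius p f P)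
    (hd : FrobCurve.differentialDegree K L
      (FrobCurve.LocalRing (FrobCurve.normalizedFrobeniusStr p f) P₁) = 1) :
    ∃ (_ : IsDomain (FrobCurve.GeomNorm K L (FrobCurve.LocalRing f P)))
      (_ : IsDiscreteValuationRing (FrobCurve.GeomNorm K L (FrobCurve.LocalRing f P))),
      Module.Finite L (FrobCurve.DiffCoker K L (FrobCurve.LocalRing f P)) ∧
      FrobCurve.semigroup K L (FrobCurve.LocalRing f P) =
        {l : ℤ | ∃ a b : ℕ,
          l = FrobCurve.differentialDegree K L (FrobCurve.LocalRing f P) * a + p * b} ∧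
      Module.Finite L (FrobCurve.DeltaQuotient K L (FrobCurve.LocalRing f P)) ∧
      (FrobCurve.deltaInvariant K L (FrobCurve.LocalRing f P) : ℚ) =
        ((FrobCurve.differentialDegree K L (FrobCurve.LocalRing f P) : ℚ) - 1) * ((p : ℚ) - 1) / 2 :=
  mainTheorem7_general p L C f hdim P hP hreg P₁ hP₁ hd
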